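/- Let $G=(V,E)$ be a finite simple graph with $V=\{0,\dots,n-1\}$, let $d$ be a positive integer, and let $\mathrm{idx}\colon E\to\{1,\dots,|E|\}$ be a bijection. For $e\in E$ let $p_e$ be the middle point of $e$. For a subgraph $H$ of $G$ put $R(H)=\{p_e : e\in E(H)\}$, and let $R=R(G)$. Let $\mathrm{dist}_H(x,y)$ be half of the distance of the points $x,y\in V(H)\cup R(H)$ in the graph obtained from $H$ by subdividing each edge $e$ by $p_e$. A *pseudotree* is a connected spanning subgraph $Q$ of $G$ with at most one cycle; if it has a cycle, this is denoted by $C_Q$. A *center point* of $Q$ is a point $r\in V\cup R(Q)$ with $\max_{v\in V}\mathrm{dist}_Q(r,v)\le d/2$. Give each edge $e$ the length $\ell(e)=(1,u_{\mathrm{idx}(e)})\in\mathbb R\times\mathbb R^{|E|}$, where $u_j$ is the $j$-th unit vector, and compare lengths lexicographically. The length of a path is the sum of the lengths of its edges; a path starting at a middle point $p_e$ contains a half of $e$, of length $\frac12\ell(e)$. For a pseudotree $Q$, a point $r\in V\cup R(Q)$ and $v\in V$, let $\delta_Q(r,v)$ be the minimum length of a path in $Q$ from $r$ to $v$. For a pseudotree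 $Q$ with distinct center points $r_1,r_2$, the triplet $(r_1,r_2,Q)$ is *good* if 1. $\lambda(v)\le\lambda(u)+\ell(uv)$ for all $u,v\in V$ with $uv\in E$, where $\lambda(v)=\max\{\delta_Q(r_1,v),\delta_Q(r_2,v)\}$; and 2. if $Q$ has a cycle, then both $r_1$ and $r_2$ lie on $C_Q$. **Theorem.** There are an algorithm and a polynomial $p$ such that, for every input consisting of such $G$, $\mathrm{idx}$ and $d$ and of two distinct points $r_1,r_2\in V\cup R$, the algorithm halts after at most $p(n)$ steps, and either outputs a pseudotree $Q$ of $G$ such that $r_1$ and $r_2$ are center points of $Q$ and $(r_1,r_2,Q)$ is good, or correctly reports that there is no such $Q$. Here an algorithm is a program of a random access machine on natural numbers whose only arithmetic operations are addition and truncated subtraction, at unit cost. The graph and its edge numbering are given by the $n\times n$ matrix with entry $\mathrm{idx}(ij)$ if $ij\in E$ and $0$ otherwise. -/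

import Mathlib

/-! ## Points of a graph and unperturbed distances -/

/-- Potential points of a graph on `Fin n`: `Sum.inl v` is the vertex `v`, and `Sum.inr e` is
the middle point `p_e` of the edge `e`. -/
abbrev Point (n : ℕ) : Type := Fin n ⊕ Sym2 (Fin n)

/-- The set `V ∪ R(H)` of the vertices and the middle points of edges of `H`. -/
def points {n : ℕ} (H : SimpleGraph (Fin n)) : Set (Point n) :=
  Set.range Sum.inl ∪ Sum.inr '' H.edgeSet

/-- The graph obtained from `H` by subdividing each edge `e` by its middle point.  (Unordered
pairs that are not edges of `H` are isolated here; they do not belong to `points H`.) -/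
def subdivision {n : ℕ} (H : SimpleGraph (Fin n)) : SimpleGraph (Point n) :=
  SimpleGraph.fromRel fun x y =>
    ∃ v e, x = Sum.inl v ∧ y = Sum.inr e ∧ e ∈ H.edgeSet ∧ v ∈ e

/-- The (unperturbed) distance between two points of `H`: half of their distance in the
subdivision. -/
noncomputable def pointDist {n : ℕ} (H : SimpleGraph (Fin n)) (r s : Point n) : ℝ :=
  ((subdivision H).dist r s : ℝ) / 2

/-- The eccentricity of a point: the maximum of its distances to the vertices. -/
noncomputable def ecc {n : ℕ} (H : SimpleGraph (Fin n)) (r : Point n) : ℝ :=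
  ⨆ v : Fin n, pointDist H r (Sum.inl v)

/-! ## Pseudotrees and center points -/

/-- A (spanning) pseudotree of `G`: a connected spanning subgraph with at most one cycle. -/
def IsPseudotree {n : ℕ} (G Q : SimpleGraph (Fin n)) : Prop :=
  Q ≤ G ∧ Q.Connected ∧
    ∀ (u v : Fin n) (c : Q.Walk u u) (c' : Q.Walk v v), c.IsCycle → c'.IsCycle →
      ∀ e, e ∈ c.edges ↔ e ∈ c'.edges

/-- `r` is a center point of `Q`, with respect to the diameter bound `d`. -/
def IsCenter {n : ℕ} (d : ℕ) (Q : SimpleGraph (Fin n)) (r : Point n) : Prop :=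
  r ∈ points Q ∧ ecc Q r ≤ (d : ℝ) / 2

/-- `r₁` and `r₂` are distinct center points of the pseudotree `Q` of `G`. -/
def Reconf {n : ℕ} (G : SimpleGraph (Fin n)) (d : ℕ) (r₁ r₂ : Point n)
    (Q : SimpleGraph (Fin n)) : Prop :=
  IsPseudotree G Q ∧ IsCenter d Q r₁ ∧ IsCenter d Q r₂ ∧ r₁ ≠ r₂

/-! ## Perturbed lengths -/

/-- Perturbed lengths: elements of `ℝ × ℝ^m` with the lexicographic order. -/
abbrev PLen (m : ℕ) : Type := ℝ ×ₗ Lex (Fin m → ℝ)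

/-- `idx` numbers the edges of `G` bijectively by `1, …, |E|`. -/
def IsEdgeIndex {n : ℕ} (G : SimpleGraph (Fin n)) (idx : Sym2 (Fin n) → ℕ) : Prop :=
  Set.BijOn idx G.edgeSet (Set.Icc 1 G.edgeSet.ncard)

/-- The multiple by `c` of the length of `e`: `c` times `(1, u)`, where `u` is the unit vector
belonging to the index of `e`. -/
noncomputable def scaledLen {n : ℕ} (m : ℕ) (idx : Sym2 (Fin n) → ℕ) (c : ℝ)
    (e : Sym2 (Fin n)) : PLen m :=
  toLex (c * 1, toLex fun j : Fin m => c * if idx e = (j : ℕ) + 1 then 1 else 0)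

/-- The perturbed length of an edge. -/
noncomputable def edgeLen {n : ℕ} (m : ℕ) (idx : Sym2 (Fin n) → ℕ) (e : Sym2 (Fin n)) :
    PLen m :=
  scaledLen m idx 1 e

/-- The perturbed length of a walk. -/
noncomputable def walkLen {n : ℕ} (m : ℕ) (idx : Sym2 (Fin n) → ℕ) {H : SimpleGraph (Fin n)}
    {u v : Fin n} (p : H.Walk u v) : PLen m :=
  (p.edges.map (edgeLen m idx)).sum

/-- The perturbed lengths of the paths in `H` from the point `r` to the vertex `v`.  A path from
a middle point `p_e` consists of half of `e` and a path from that end of `e` to `v`. -/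
def pathLens {n : ℕ} (m : ℕ) (idx : Sym2 (Fin n) → ℕ) (H : SimpleGraph (Fin n)) (r : Point n)
    (v : Fin n) : Set (PLen m) :=
  match r with
  | Sum.inl u => {x | ∃ p : H.Walk u v, p.IsPath ∧ x = walkLen m idx p}
  | Sum.inr e => {x | ∃ a ∈ e, ∃ p : H.Walk a v,
      p.IsPath ∧ x = scaledLen m idx (1 / 2) e + walkLen m idx p}

open Classical in
/-- The perturbed distance in `H` from the point `r` to the vertex `v`: the minimum of the
lengths of the paths (which exists when `H` is connected, see `pertDist_isLeast`). -/
noncomputable def pertDist {n : ℕ} (m : ℕ) (idx : Sym2 (Fin n) → ℕ) (H : SimpleGraph (Fin n))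
    (r : Point n) (v : Fin n) : PLen m :=
  if h : ∃ x, IsLeast (pathLens m idx H r v) x then h.choose else 0

theorem finite_pathLens {n : ℕ} (m : ℕ) (idx : Sym2 (Fin n) → ℕ) (H : SimpleGraph (Fin n))
    (r : Point n) (v : Fin n) : (pathLens m idx H r v).Finite := by
  classical
  cases r with
  | inl u =>
    refine (Set.finite_range fun p : H.Path u v => walkLen m idx p.1).subset ?_
    rintro x ⟨p, hp, rfl⟩
    exact ⟨⟨p, hp⟩, rfl⟩
  | inr e =>
    refine (Set.finite_range fun q : (Σ a : Fin n, H.Path a v) =>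
      scaledLen m idx (1 / 2) e + walkLen m idx q.2.1).subset ?_
    rintro x ⟨a, -, p, hp, rfl⟩
    exact ⟨⟨a, p, hp⟩, rfl⟩

theorem nonempty_pathLens {n : ℕ} (m : ℕ) (idx : Sym2 (Fin n) → ℕ) {H : SimpleGraph (Fin n)}
    (hH : H.Connected) (r : Point n) (v : Fin n) : (pathLens m idx H r v).Nonempty := by
  cases r with
  | inl u =>
    obtain ⟨p, hp⟩ := (hH.preconnected u v).exists_isPath
    exact ⟨_, p, hp, rfl⟩
  | inr e =>
    induction e with
    | _ a b =>
      obtain ⟨p, hp⟩ := (hH.preconnected a v).exists_isPath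
      exact ⟨_, a, Sym2.mem_mk_left a b, p, hp, rfl⟩

theorem pertDist_isLeast {n : ℕ} (m : ℕ) (idx : Sym2 (Fin n) → ℕ) {H : SimpleGraph (Fin n)}
    (hH : H.Connected) (r : Point n) (v : Fin n) :
    IsLeast (pathLens m idx H r v) (pertDist m idx H r v) := by
  have h : ∃ x, IsLeast (pathLens m idx H r v) x := by
    obtain ⟨x, hx, hmin⟩ := Set.exists_min_image _ id (finite_pathLens m idx H r v)
      (nonempty_pathLens m idx hH r v)
    exact ⟨x, hx, hmin⟩
  rw [pertDist, dif_pos h]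
  exact h.choose_spec

/-! ## Good triplets -/

/-- The label of `v`: the larger one of the perturbed distances from `r₁` and `r₂` in `Q`. -/
noncomputable def label {n : ℕ} (m : ℕ) (idx : Sym2 (Fin n) → ℕ) (r₁ r₂ : Point n)
    (Q : SimpleGraph (Fin n)) (v : Fin n) : PLen m :=
  max (pertDist m idx Q r₁ v) (pertDist m idx Q r₂ v)

/-- The point `r` lies on the closed walk `c`. -/
def OnWalk {n : ℕ} {H : SimpleGraph (Fin n)} {u : Fin n} (r : Point n) (c : H.Walk u u) : Prop :=
  match r with
  | Sum.inl v => v ∈ c.support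
  | Sum.inr e => e ∈ c.edges

/-- The triplet `(r₁, r₂, Q)` is good. -/
def IsGood {n : ℕ} (G : SimpleGraph (Fin n)) (idx : Sym2 (Fin n) → ℕ) (r₁ r₂ : Point n)
    (Q : SimpleGraph (Fin n)) : Prop :=
  (∀ u v : Fin n, G.Adj u v →
    label G.edgeSet.ncard idx r₁ r₂ Q v ≤
      label G.edgeSet.ncard idx r₁ r₂ Q u + edgeLen G.edgeSet.ncard idx s(u, v)) ∧
  ∀ (w : Fin n) (c : Q.Walk w w), c.IsCycle → OnWalk r₁ c ∧ OnWalk r₂ c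

/-! ## Random access machines

Programs of a random access machine with natural-number registers and a fixed number of arrays,
written with structured control.  The only arithmetic operations are addition and truncated
subtraction, each of unit cost. -/

/-- Arithmetic expressions; `read a i` is the content of cell `i` of array `a`. -/
inductive Expr : Type
  | const (k : ℕ)
  | reg (x : ℕ)
  | read (a : ℕ) (i : Expr)
  | add (e f : Expr)
  | sub (e f : Expr)

/-- Programs.  In a test, a value other than `0` means true. -/
inductive Prog : Type
  | skip
  | assign (x : ℕ) (e : Expr)
  | store (a : ℕ) (i e : Expr)
  | seq (p q : Prog)
  | ite (e : Expr) (p q : Prog)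
  | while (e : Expr) (p : Prog)

/-- The content of the registers and of the arrays. -/
@[ext] structure Store : Type where
  reg : ℕ → ℕ
  arr : ℕ → ℕ → ℕ

/-- The value of an expression. -/
def Expr.eval (s : Store) : Expr → ℕ
  | const k => k
  | reg x => s.reg x
  | read a i => s.arr a (i.eval s)
  | add e f => e.eval s + f.eval s
  | sub e f => e.eval s - f.eval s

/-- The number of steps to evaluate an expression: one for each of its nodes. -/
def Expr.cost : Expr → ℕ
  | const _ => 1
  | reg _ => 1
  | read _ i => i.cost + 1
  | add e f => e.cost + f.cost + 1
  | sub e f => e.cost + f.cost + 1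

/-- Write a register. -/
def Store.setReg (s : Store) (x k : ℕ) : Store where
  reg := Function.update s.reg x k
  arr := s.arr

/-- Write a cell of an array. -/
def Store.setArr (s : Store) (a i k : ℕ) : Store where
  reg := s.reg
  arr := Function.update s.arr a (Function.update (s.arr a) i k)

/-- `Exec p s t s'`: started on `s`, the program `p` halts after exactly `t` steps, on `s'`. -/
inductive Exec : Prog → Store → ℕ → Store → Prop
  | skip (s : Store) : Exec .skip s 1 s
  | assign (s : Store) (x : ℕ) (e : Expr) :
      Exec (.assign x e) s (e.cost + 1) (s.setReg x (e.eval s))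
  | store (s : Store) (a : ℕ) (i e : Expr) :
      Exec (.store a i e) s (i.cost + e.cost + 1) (s.setArr a (i.eval s) (e.eval s))
  | seq {p q : Prog} {s s₁ s₂ : Store} {t₁ t₂ : ℕ} :
      Exec p s t₁ s₁ → Exec q s₁ t₂ s₂ → Exec (.seq p q) s (t₁ + t₂) s₂
  | ite_true {e : Expr} {p q : Prog} {s s₁ : Store} {t : ℕ} :
      e.eval s ≠ 0 → Exec p s t s₁ → Exec (.ite e p q) s (e.cost + 1 + t) s₁
  | ite_false {e : Expr} {p q : Prog} {s s₁ : Store} {t : ℕ} :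
      e.eval s = 0 → Exec q s t s₁ → Exec (.ite e p q) s (e.cost + 1 + t) s₁
  | while_true {e : Expr} {p : Prog} {s s₁ s₂ : Store} {t₁ t₂ : ℕ} :
      e.eval s ≠ 0 → Exec p s t₁ s₁ → Exec (.while e p) s₁ t₂ s₂ →
      Exec (.while e p) s (e.cost + 1 + t₁ + t₂) s₂
  | while_false {e : Expr} {p : Prog} {s : Store} :
      e.eval s = 0 → Exec (.while e p) s (e.cost + 1) s

/-- Programs are deterministic: the number of steps and the result are determined by the input. -/
theorem Exec.deterministic {p : Prog} {s s₁ s₂ : Store} {t₁ t₂ : ℕ} (h₁ : Exec p s t₁ s₁)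
    (h₂ : Exec p s t₂ s₂) : t₁ = t₂ ∧ s₁ = s₂ := by
  induction h₁ generalizing t₂ s₂ with
  | skip | assign | store => cases h₂; exact ⟨rfl, rfl⟩
  | seq _ _ ih₁ ih₂ =>
    cases h₂ with
    | seq a b =>
      obtain ⟨rfl, rfl⟩ := ih₁ a
      obtain ⟨rfl, rfl⟩ := ih₂ b
      exact ⟨rfl, rfl⟩
  | ite_true he _ ih =>
    cases h₂ with
    | ite_true _ a =>
      obtain ⟨rfl, rfl⟩ := ih a
      exact ⟨rfl, rfl⟩
    | ite_false h _ => exact absurd h he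
  | ite_false he _ ih =>
    cases h₂ with
    | ite_false _ a =>
      obtain ⟨rfl, rfl⟩ := ih a
      exact ⟨rfl, rfl⟩
    | ite_true h _ => exact absurd he h
  | while_true he _ _ ih₁ ih₂ =>
    cases h₂ with
    | while_true _ a b =>
      obtain ⟨rfl, rfl⟩ := ih₁ a
      obtain ⟨rfl, rfl⟩ := ih₂ b
      exact ⟨rfl, rfl⟩
    | while_false h => exact absurd h he
  | while_false he =>
    cases h₂ with
    | while_true h _ _ => exact absurd he h
    | while_false _ => exact ⟨rfl, rfl⟩

/-! ## Input and output -/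

/-- A vertex `v` is written as the pair `(v, v)`, and the middle point of the edge `ab` with
`a < b` as the pair `(a, b)`. -/
def pointCode {n : ℕ} : Point n → ℕ × ℕ
  | Sum.inl v => (v, v)
  | Sum.inr e => (e.inf, e.sup)

open Classical in
/-- The input.  Registers `0, …, 5` hold `n`, `d`, and the codes of `r₁` and `r₂`.  Array `0`
holds the adjacency matrix of `G` row by row, with the index of the edge `ij` as the entry `(i, j)`
if `ij` is an edge, and `0` otherwise.  All the rest is `0`. -/
noncomputable def inputStore {n : ℕ} (G : SimpleGraph (Fin n)) (idx : Sym2 (Fin n) → ℕ) (d : ℕ)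
    (r₁ r₂ : Point n) : Store where
  reg := fun x =>
    match x with
    | 0 => n
    | 1 => d
    | 2 => (pointCode r₁).1
    | 3 => (pointCode r₁).2
    | 4 => (pointCode r₂).1
    | 5 => (pointCode r₂).2
    | _ => 0
  arr := fun a k =>
    if h : a = 0 ∧ k < n * n then
      let i : Fin n := Fin.divNat ⟨k, h.2⟩
      let j : Fin n := Fin.modNat ⟨k, h.2⟩
      if G.Adj i j then idx s(i, j) else 0
    else 0

/-- The output "`Q` is found": register `0` holds `1`, and array `1` holds the adjacency matrix of
`Q` row by row. -/
def OutputsGraph {n : ℕ} (s : Store) (Q : SimpleGraph (Fin n)) : Prop :=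
  s.reg 0 = 1 ∧ ∀ i j : Fin n,
    (Q.Adj i j → s.arr 1 ((i : ℕ) * n + j) = 1) ∧ (¬ Q.Adj i j → s.arr 1 ((i : ℕ) * n + j) = 0)

/-- The output "there is none": register `0` holds `0`. -/
def OutputsNone (s : Store) : Prop :=
  s.reg 0 = 0

/-! A good pseudotree `Q` is determined by a bounded number of vertices, and a proposed `Q` can be
tested in polynomial time. The machine therefore runs through all n^506 tuples of guessed vertices,
builds a candidate from each, and keeps a candidate that passes the test.

Perturbed lengths become natural numbers. Every length that occurs is the length of a multiset of
half-edges, and half of the edge e gets the weight 8^(n²) + 8^(n² - idx e). While no half-edge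
occurs more than seven times, nothing is carried in base 8, so comparing the sums is comparing
lexicographically (`IsEdgeIndex.natLen_le_iff`), and equal sums come from equal multisets
(`IsEdgeIndex.count_eq_of_natLen_eq`). By parity, the multiset of a walk with known last vertex also
determines the point where the walk starts (`point_eq_of_count_eq`).

Structure. Write λ for the label, and call an edge uv of G tight (towards v) if λ(v) = λ(u) + ℓ(uv).
Uniqueness of lengths forces a tight edge onto the path of `Q` that realizes λ(v)
(`GoodData.tight_mem_edges`). Hence tight edges belong to `Q`, and at most one of them enters each
vertex. The rest is counting, from the fact that `Q` has at most n edges. Split the vertices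
according to which of the two points is nearer. All but four vertices have a predecessor on a
nearest path in their own cell, so at most 4 edges of `Q` cross between the cells. A vertex entered
by no tight edge (a root) is an end of one of the two points or of a crossing edge, so there are at
most 4 + 2·4 = 12 roots. The other n - 12 or more vertices are entered by different tight edges, so
at most 12 edges of `Q` are not tight (slack).

Reconstruction. Condition 1 makes λ change by at most the distance in G, and descending along tight
edges leads to a root with equality. So λ(v) is the minimum of λ(ρ) + dist_G(ρ, v) over the roots ρ
(`GoodData.natLabel_le`, `GoodData.exists_root`). The label of a root is the length of a path in
`Q`. A stretch of it without slack edges first descends and then ascends along tight edges, because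
only one tight edge enters each vertex, and each monotone run is a shortest path of G. So 12 slack
edges and 13 stretches of two runs give at most 38 shortest paths of G (`GoodData.exists_chain`).
Guessing for each root the starting point and the 39 vertices of this chain takes 12·40 vertices;
the slack edges take 24 more, and two witnesses for condition 2 complete the 506. The edges of G
that are tight for the resulting labels, together with the guessed slack edges, form exactly `Q`
(`GoodData.exists_guess`).

The test is exact for every subgraph of G (`exists_passes_iff`): a connected graph is a pseudotree
iff it has at most n edges, an edge of it is on a cycle iff its deletion preserves connectedness,
and everything else is read off from shortest path matrices. So soundness does not use the structure
theory; only completeness does. The program is written in a language whose loops all run n times, so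
its compiled running time is automatically polynomial in n (`Cmd.exec_compile`). -/

/-! ## A small language with bounded loops, compiled to programs -/

/-- Registers below this bound are program variables; the others are scratch space. -/
def varBound : ℕ := 1000

/-- Expressions with bounded iteration.  `fold x y i e` starts with the value of `i` and replaces
the current value by that of `e` for each value of `x` below the content of register `0`; in `e`
the current value is available as the register `y`. -/
inductive BExpr : Type
  | const (k : ℕ)
  | reg (x : ℕ)
  | read (a : ℕ) (i : BExpr)
  | add (e f : BExpr)
  | sub (e f : BExpr)
  | ite (c e f : BExpr)
  | fold (x y : ℕ) (i e : BExpr)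

namespace BExpr

/-- The value of an expression. -/
def eval : BExpr → Store → ℕ
  | const k, _ => k
  | reg x, s => s.reg x
  | read a i, s => s.arr a (i.eval s)
  | add e f, s => e.eval s + f.eval s
  | sub e f, s => e.eval s - f.eval s
  | ite c e f, s => if c.eval s ≠ 0 then e.eval s else f.eval s
  | fold x y i e, s =>
      Nat.rec (i.eval s) (fun t v => e.eval ((s.setReg x t).setReg y v)) (s.reg 0)

/-- All variables are below `varBound`, and register `0` is not bound. -/
def WF : BExpr → Prop
  | const _ => True
  | reg x => x < varBound
  | read _ i => i.WF
  | add e f => e.WF ∧ f.WF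
  | sub e f => e.WF ∧ f.WF
  | ite c e f => c.WF ∧ e.WF ∧ f.WF
  | fold x y i e => (x ≠ 0 ∧ x < varBound) ∧ (y ≠ 0 ∧ y < varBound) ∧ i.WF ∧ e.WF

/-- The register `z` is not free in the expression. -/
def Fresh (z : ℕ) : BExpr → Prop
  | const _ => True
  | reg x => x ≠ z
  | read _ i => i.Fresh z
  | add e f => e.Fresh z ∧ f.Fresh z
  | sub e f => e.Fresh z ∧ f.Fresh z
  | ite c e f => c.Fresh z ∧ e.Fresh z ∧ f.Fresh z
  | fold x y i e => 0 ≠ z ∧ i.Fresh z ∧ (x = z ∨ y = z ∨ e.Fresh z)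

/-- Compilation: the result is left in register `k`, and only registers from `k` on change. -/
def compile : BExpr → ℕ → Prog
  | const c, k => .assign k (.const c)
  | reg x, k => .assign k (.reg x)
  | read a i, k => .seq (i.compile k) (.assign k (.read a (.reg k)))
  | add e f, k => .seq (e.compile k) (.seq (f.compile (k + 1))
      (.assign k (.add (.reg k) (.reg (k + 1)))))
  | sub e f, k => .seq (e.compile k) (.seq (f.compile (k + 1))
      (.assign k (.sub (.reg k) (.reg (k + 1)))))
  | ite c e f, k => .seq (c.compile k) (.ite (.reg k) (e.compile k) (f.compile k))
  | fold x y i e, k =>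
      .seq (i.compile k) (.seq (.assign (k + 1) (.reg x)) (.seq (.assign (k + 2) (.reg y))
        (.seq (.assign (k + 3) (.const 0))
          (.seq (.while (.sub (.reg 0) (.reg (k + 3)))
            (.seq (.assign x (.reg (k + 3))) (.seq (.assign y (.reg k)) (.seq (e.compile (k + 4))
              (.seq (.assign k (.reg (k + 4)))
                (.assign (k + 3) (.add (.reg (k + 3)) (.const 1))))))))
            (.seq (.assign y (.reg (k + 2))) (.assign x (.reg (k + 1))))))))

end BExpr

/-! ### Correctness and running time of compiled expressions -/

/-- The stores agree on the arrays and on the registers below `k`. -/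
def Store.Agree (k : ℕ) (s s' : Store) : Prop :=
  s.arr = s'.arr ∧ ∀ x < k, s.reg x = s'.reg x

theorem Store.Agree.setReg {k : ℕ} {s s' : Store} (h : s.Agree k s') (x v : ℕ) :
    (s.setReg x v).Agree k (s'.setReg x v) := by
  refine ⟨h.1, fun y hy => ?_⟩
  simp only [Store.setReg, Function.update_apply, h.2 y hy]

theorem Store.Agree.setArr {k : ℕ} {s s' : Store} (h : s.Agree k s') (a i v : ℕ) :
    (s.setArr a i v).Agree k (s'.setArr a i v) := by
  refine ⟨?_, fun y hy => h.2 y hy⟩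
  simp only [Store.setArr, h.1]

theorem Store.Agree.refl (k : ℕ) (s : Store) : s.Agree k s := ⟨rfl, fun _ _ => rfl⟩

theorem Store.Agree.trans {k : ℕ} {s s' s'' : Store} (h : s.Agree k s') (h' : s'.Agree k s'') :
    s.Agree k s'' :=
  ⟨h.1.trans h'.1, fun x hx => (h.2 x hx).trans (h'.2 x hx)⟩

theorem Store.Agree.mono {k l : ℕ} {s s' : Store} (h : s.Agree k s') (hl : l ≤ k) :
    s.Agree l s' :=
  ⟨h.1, fun x hx => h.2 x (hx.trans_le hl)⟩

theorem Store.agree_setReg {k x : ℕ} (s : Store) (v : ℕ) (h : k ≤ x) :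
    s.Agree k (s.setReg x v) := by
  refine ⟨rfl, fun y hy => ?_⟩
  simp [Store.setReg, show y ≠ x by omega]

theorem BExpr.eval_congr {e : BExpr} (he : e.WF) {s s' : Store} (h : s.Agree varBound s') :
    e.eval s = e.eval s' := by
  induction e generalizing s s' with
  | const => rfl
  | reg x => exact h.2 x he
  | read a i ih => simp only [eval, ih he h, h.1]
  | add e f ihe ihf | sub e f ihe ihf => simp only [eval, ihe he.1 h, ihf he.2 h]
  | ite c e f ihc ihe ihf => simp only [eval, ihc he.1 h, ihe he.2.1 h, ihf he.2.2 h]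
  | fold x y i e ihi ihe =>
    obtain ⟨-, -, hi, he⟩ := he
    simp only [eval, ihi hi h]
    rw [h.2 0 (by decide)]
    congr 1
    funext t v
    exact ihe he ((h.setReg x t).setReg y v)

/-- The rule for a loop whose body is executed `n` times, each time in at most `b` steps. -/
theorem exec_while (I : ℕ → Store → Prop) (e : Expr) (p : Prog) (b n : ℕ)
    (hcont : ∀ i < n, ∀ s, I i s → e.eval s ≠ 0) (hend : ∀ s, I n s → e.eval s = 0)
    (hbody : ∀ i < n, ∀ s, I i s → ∃ t s', Exec p s t s' ∧ t ≤ b ∧ I (i + 1) s')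
    (s : Store) (hs : I 0 s) :
    ∃ t s', Exec (.while e p) s t s' ∧ t ≤ n * (e.cost + 1 + b) + (e.cost + 1) ∧ I n s' := by
  have key : ∀ m i, i + m = n → ∀ s, I i s →
      ∃ t s', Exec (.while e p) s t s' ∧ t ≤ m * (e.cost + 1 + b) + (e.cost + 1) ∧ I n s' := by
    intro m
    induction m with
    | zero =>
      intro i hi s hs
      obtain rfl : i = n := by omega
      exact ⟨_, s, .while_false (hend s hs), by omega, hs⟩
    | succ m ih =>
      intro i hi s hs
      obtain ⟨t, s₁, h₁, ht, hI⟩ := hbody i (by omega) s hs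
      obtain ⟨t', s₂, h₂, ht', hI'⟩ := ih (i + 1) (by omega) s₁ hI
      refine ⟨_, s₂, .while_true (hcont i (by omega) s hs) h₁ h₂, ?_, hI'⟩
      rw [Nat.succ_mul]
      omega
  exact key n 0 (by omega) s hs

theorem Store.setReg_reg_self (s : Store) (x v : ℕ) : (s.setReg x v).reg x = v := by
  simp [Store.setReg]

theorem Store.setReg_reg_of_ne (s : Store) {x y : ℕ} (v : ℕ) (h : y ≠ x) :
    (s.setReg x v).reg y = s.reg y := by
  simp [Store.setReg, h]

/-- The only loop bound is register `0`, which no expression binds, so each `fold` multiplies the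
bound for its body by n. The bound variables of a `fold` are saved in scratch registers and
restored, which makes the evaluation free of side effects below `k`. -/
theorem BExpr.exec_compile (e : BExpr) (he : e.WF) :
    ∃ p : Polynomial ℕ, ∀ k, varBound ≤ k → ∀ s : Store, ∃ t s',
      Exec (e.compile k) s t s' ∧ t ≤ p.eval (s.reg 0) ∧ s.Agree k s' ∧ s'.reg k = e.eval s := by
  have hB : (0 : ℕ) < varBound := by decide
  induction e with
  | const c =>
    refine ⟨2, fun k hk s => ⟨_, _, .assign _ _ _, by simp [Expr.cost], s.agree_setReg _ le_rfl, ?_⟩⟩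
    rw [Store.setReg_reg_self]; rfl
  | reg x =>
    refine ⟨2, fun k hk s => ⟨_, _, .assign _ _ _, by simp [Expr.cost], s.agree_setReg _ le_rfl, ?_⟩⟩
    rw [Store.setReg_reg_self]; rfl
  | read a i ih =>
    obtain ⟨p, hp⟩ := ih he
    refine ⟨p + 3, fun k hk s => ?_⟩
    obtain ⟨t, s₁, h, ht, hA, hr⟩ := hp k hk s
    refine ⟨_, _, .seq h (.assign _ _ _), ?_, hA.trans (s₁.agree_setReg _ le_rfl), ?_⟩
    · simp [Expr.cost]; omega
    · simp [Store.setReg, Expr.eval, eval, hr, hA.1]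
  | add e f ihe ihf | sub e f ihe ihf =>
    obtain ⟨p, hp⟩ := ihe he.1
    obtain ⟨q, hq⟩ := ihf he.2
    refine ⟨p + q + 4, fun k hk s => ?_⟩
    obtain ⟨t, s₁, h, ht, hA, hr⟩ := hp k hk s
    obtain ⟨t', s₂, h', ht', hA', hr'⟩ := hq (k + 1) (by omega) s₁
    refine ⟨_, _, .seq h (.seq h' (.assign _ _ _)), ?_,
      (hA.trans (hA'.mono (by omega))).trans (s₂.agree_setReg _ le_rfl), ?_⟩
    · rw [← hA.2 0 (by omega)] at ht'
      simp [Expr.cost]; omega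
    · rw [Store.setReg_reg_self]
      simp only [Expr.eval, eval, hr', ← hA'.2 k (by omega), hr,
        eval_congr he.2 (hA.mono hk)]
  | ite c e f ihc ihe ihf =>
    obtain ⟨pc, hc⟩ := ihc he.1
    obtain ⟨p, hp⟩ := ihe he.2.1
    obtain ⟨q, hq⟩ := ihf he.2.2
    refine ⟨pc + p + q + 2, fun k hk s => ?_⟩
    obtain ⟨t, s₁, h, ht, hA, hr⟩ := hc k hk s
    have h0 := hA.2 0 (by omega)
    by_cases hz : c.eval s = 0
    · obtain ⟨t', s₂, h', ht', hA', hr'⟩ := hq k hk s₁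
      refine ⟨_, s₂, .seq h (.ite_false (hr.trans hz) h'), ?_, hA.trans hA', ?_⟩
      · rw [← h0] at ht'
        simp [Expr.cost]; omega
      · simp only [hr', eval, hz, ← eval_congr he.2.2 (hA.mono hk)]
        simp
    · obtain ⟨t', s₂, h', ht', hA', hr'⟩ := hp k hk s₁
      refine ⟨_, s₂, .seq h (.ite_true (by simpa [Expr.eval, hr] using hz) h'), ?_,
        hA.trans hA', ?_⟩
      · rw [← h0] at ht'
        simp [Expr.cost]; omega
      · simp only [hr', eval, ← eval_congr he.2.1 (hA.mono hk)]
        simp [hz]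
  | fold x y i e ihi ihe =>
    obtain ⟨⟨hx0, hx⟩, ⟨hy0, hy⟩, hi, he⟩ := he
    obtain ⟨p, hp⟩ := ihi hi
    obtain ⟨q, hq⟩ := ihe he
    -- A round costs 4 steps for the test and 10 for moving values around the body.
    refine ⟨p + Polynomial.X * (q + 14) + 20, fun k hk s => ?_⟩
    obtain ⟨t, s₁, h, ht, hA, hr⟩ := hp k hk s
    let v : ℕ → ℕ := fun m =>
      Nat.rec (i.eval s) (fun t v => e.eval ((s.setReg x t).setReg y v)) m
    let s₂ := ((s₁.setReg (k + 1) (s.reg x)).setReg (k + 2) (s.reg y)).setReg (k + 3) 0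
    have hs₂ : ∀ z, z ≠ k + 1 → z ≠ k + 2 → z ≠ k + 3 → s₂.reg z = s₁.reg z := by
      intro z h1 h2 h3
      simp [s₂, Store.setReg, h1, h2, h3]
    let I : ℕ → Store → Prop := fun m s' => s'.arr = s.arr ∧
      (∀ z < k, z ≠ x → z ≠ y → s'.reg z = s.reg z) ∧ s'.reg k = v m ∧
      s'.reg (k + 1) = s.reg x ∧ s'.reg (k + 2) = s.reg y ∧ s'.reg (k + 3) = m
    obtain ⟨t', s₃, h₃, ht', ha₃, hz₃, hk₃, hx₃, hy₃, -⟩ := exec_while I (.sub (.reg 0) (.reg (k + 3)))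
      (.seq (.assign x (.reg (k + 3))) (.seq (.assign y (.reg k)) (.seq (e.compile (k + 4))
              (.seq (.assign k (.reg (k + 4)))
                (.assign (k + 3) (.add (.reg (k + 3)) (.const 1)))))))
      (q.eval (s.reg 0) + 10) (s.reg 0)
      (by
        rintro m hm s' ⟨-, h0, -, -, -, h3⟩
        simp only [Expr.eval, h3, h0 0 (by omega) hx0.symm hy0.symm]
        omega)
      (by
        rintro s' ⟨-, h0, -, -, -, h3⟩
        simp only [Expr.eval, h3, h0 0 (by omega) hx0.symm hy0.symm]
        omega)
      (by
        rintro m hm s' ⟨ha, h0, hk', h1, h2, h3⟩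
        obtain ⟨t₄, s₄, h₄, ht₄, hA₄, hr₄⟩ := hq (k + 4) (by omega) ((s'.setReg x m).setReg y (v m))
        have e1 : (Expr.reg (k + 3)).eval s' = m := h3
        have e2 : (Expr.reg k).eval (s'.setReg x m) = v m := by
          simp only [Expr.eval]
          rw [Store.setReg_reg_of_ne _ _ (by omega), hk']
        have hag : ((s.setReg x m).setReg y (v m)).Agree varBound
            ((s'.setReg x m).setReg y (v m)) := by
          refine ⟨ha.symm, fun z hz => ?_⟩
          by_cases hzy : z = y
          · subst hzy
            simp [Store.setReg]
          by_cases hzx : z = x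
          · subst hzx
            simp [Store.setReg, Function.update_apply]
          simp [Store.setReg, hzx, hzy, h0 z (by omega) hzx hzy]
        have hlow : ∀ z, z ≠ x → z ≠ y → z < k + 4 → s₄.reg z = s'.reg z := by
          intro z hzx hzy hz
          rw [← hA₄.2 z hz]
          simp [Store.setReg, hzx, hzy]
        refine ⟨_, _, .seq (.assign _ _ _) (.seq (.assign _ _ _) (.seq (s₁ := s₄) (t₁ := t₄) ?_
          (.seq (.assign _ _ _) (.assign _ _ _)))), ?_, ?_, ?_, ?_, ?_, ?_, ?_⟩
        · rw [e1, e2]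
          exact h₄
        · have : ((s'.setReg x m).setReg y (v m)).reg 0 = s.reg 0 := by
            simp [Store.setReg, hx0.symm, hy0.symm, h0 0 (by omega) hx0.symm hy0.symm]
          rw [this] at ht₄
          simp [Expr.cost]
          omega
        · exact hA₄.1.symm.trans ha
        · intro z hz hzx hzy
          rw [Store.setReg_reg_of_ne _ _ (by omega), Store.setReg_reg_of_ne _ _ (by omega),
            hlow z hzx hzy (by omega), h0 z hz hzx hzy]
        · rw [Store.setReg_reg_of_ne _ _ (by omega), Store.setReg_reg_self]
          simp only [Expr.eval, hr₄, ← eval_congr he hag]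
          rfl
        · rw [Store.setReg_reg_of_ne _ _ (by omega), Store.setReg_reg_of_ne _ _ (by omega),
            hlow _ (by omega) (by omega) (by omega), h1]
        · rw [Store.setReg_reg_of_ne _ _ (by omega), Store.setReg_reg_of_ne _ _ (by omega),
            hlow _ (by omega) (by omega) (by omega), h2]
        · rw [Store.setReg_reg_self]
          simp only [Expr.eval]
          rw [Store.setReg_reg_of_ne _ _ (by omega),
            hlow _ (by omega) (by omega) (by omega), h3])
      s₂
      (by
        refine ⟨hA.1.symm, fun z hz hzx hzy => ?_, ?_, ?_, ?_, ?_⟩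
        · rw [hs₂ z (by omega) (by omega) (by omega), hA.2 z hz]
        · rw [hs₂ k (by omega) (by omega) (by omega), hr]
          rfl
        · simp [s₂, Store.setReg]
        · simp [s₂, Store.setReg]
        · simp [s₂, Store.setReg])
    have e1 : (Expr.reg x).eval s₁ = s.reg x := (hA.2 x (by omega)).symm
    have e2 : (Expr.reg y).eval (s₁.setReg (k + 1) (s.reg x)) = s.reg y := by
      simp only [Expr.eval]
      rw [Store.setReg_reg_of_ne _ _ (by omega), hA.2 y (by omega)]
    refine ⟨_, _, .seq h (.seq (.assign _ _ _) (.seq (.assign _ _ _) (.seq (.assign _ _ _)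
      (.seq (s₁ := s₃) (t₁ := t') ?_ (.seq (.assign _ _ _) (.assign _ _ _)))))), ?_, ⟨?_, ?_⟩, ?_⟩
    · rw [e1, e2]
      exact h₃
    · simp only [Expr.cost] at ht' ⊢
      have : Polynomial.eval (s.reg 0) (p + Polynomial.X * (q + 14) + 20) =
        p.eval (s.reg 0) + s.reg 0 * (q.eval (s.reg 0) + 14) + 20 := by simp
      rw [this]
      have : s.reg 0 * (1 + 1 + 1 + 1 + (Polynomial.eval (s.reg 0) q + 10)) =
        s.reg 0 * (q.eval (s.reg 0) + 14) := by ring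
      omega
    · exact ha₃.symm
    · intro z hz
      by_cases hzx : z = x
      · subst hzx
        rw [Store.setReg_reg_self]
        simp only [Expr.eval]
        rw [Store.setReg_reg_of_ne _ _ (by omega), hx₃]
      rw [Store.setReg_reg_of_ne _ _ hzx]
      by_cases hzy : z = y
      · subst hzy
        rw [Store.setReg_reg_self]
        exact hy₃.symm
      rw [Store.setReg_reg_of_ne _ _ hzy, hz₃ z hz hzx hzy]
    · rw [Store.setReg_reg_of_ne _ _ (by omega), Store.setReg_reg_of_ne _ _ (by omega), hk₃]
      rfl

theorem Store.setReg_comm (s : Store) {x y : ℕ} (h : x ≠ y) (a b : ℕ) :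
    (s.setReg x a).setReg y b = (s.setReg y b).setReg x a := by
  simp only [Store.setReg, Function.update_comm h]

theorem Store.setReg_setReg (s : Store) (x a b : ℕ) :
    (s.setReg x a).setReg x b = s.setReg x b := by
  simp only [Store.setReg, Function.update_idem]

/-- Lets all folds share one accumulator register: a bound occurrence of `z` is harmless, because
the fold overwrites it. -/
theorem BExpr.eval_setReg_of_fresh {e : BExpr} {z : ℕ} (he : e.Fresh z) (s : Store) (c : ℕ) :
    e.eval (s.setReg z c) = e.eval s := by
  induction e generalizing s with
  | const => rfl
  | reg x => exact s.setReg_reg_of_ne c he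
  | read a i ih => simp only [eval, ih he]; rfl
  | add e f ihe ihf | sub e f ihe ihf => simp only [eval, ihe he.1, ihf he.2]
  | ite c e f ihc ihe ihf => simp only [eval, ihc he.1, ihe he.2.1, ihf he.2.2]
  | fold x y i e ihi ihe =>
    obtain ⟨h0, hi, he⟩ := he
    simp only [eval, ihi hi]
    rw [s.setReg_reg_of_ne c h0]
    congr 1
    funext t v
    by_cases hx : x = z
    · subst hx
      rw [Store.setReg_setReg]
    rw [s.setReg_comm (Ne.symm hx)]
    by_cases hy : y = z
    · subst hy
      rw [Store.setReg_setReg]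
    rw [(s.setReg x t).setReg_comm (Ne.symm hy)]
    exact ihe ((he.resolve_left hx).resolve_left hy) _

/-! ### Commands and their compilation -/

/-- Commands with bounded loops.  `loop x c` executes `c` for each value of `x` below the content
of register `0`. -/
inductive Cmd : Type
  | skip
  | assign (x : ℕ) (e : BExpr)
  | store (a : ℕ) (i e : BExpr)
  | seq (c d : Cmd)
  | ite (e : BExpr) (c d : Cmd)
  | loop (x : ℕ) (c : Cmd)

namespace Cmd

/-- The effect of a command. -/
def run : Cmd → Store → Store
  | skip, s => s
  | assign x e, s => s.setReg x (e.eval s)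
  | store a i e, s => s.setArr a (i.eval s) (e.eval s)
  | seq c d, s => d.run (c.run s)
  | ite e c d, s => if e.eval s ≠ 0 then c.run s else d.run s
  | loop x c, s => Nat.rec s (fun t s' => c.run (s'.setReg x t)) (s.reg 0)

/-- All variables are below `varBound`, and register `0` is not changed. -/
def WF : Cmd → Prop
  | skip => True
  | assign x e => x ≠ 0 ∧ x < varBound ∧ e.WF
  | store _ i e => i.WF ∧ e.WF
  | seq c d => c.WF ∧ d.WF
  | ite e c d => e.WF ∧ c.WF ∧ d.WF
  | loop x c => x ≠ 0 ∧ x < varBound ∧ c.WF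

/-- Compilation, with the registers from `k` on as scratch space. -/
def compile : Cmd → ℕ → Prog
  | skip, _ => .skip
  | assign x e, k => .seq (e.compile k) (.assign x (.reg k))
  | store a i e, k => .seq (i.compile k) (.seq (e.compile (k + 1))
      (.store a (.reg k) (.reg (k + 1))))
  | seq c d, k => .seq (c.compile k) (d.compile k)
  | ite e c d, k => .seq (e.compile k) (.ite (.reg k) (c.compile k) (d.compile k))
  | loop x c, k => .seq (.assign k (.const 0)) (.while (.sub (.reg 0) (.reg k))
      (.seq (.assign x (.reg k)) (.seq (c.compile (k + 1))
        (.assign k (.add (.reg k) (.const 1))))))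

/-- The loop bound stays n throughout, so the costs of consecutive commands are polynomials in the
same number. -/
theorem run_reg_zero {c : Cmd} (hc : c.WF) (s : Store) : (c.run s).reg 0 = s.reg 0 := by
  induction c generalizing s with
  | skip => rfl
  | assign x e => exact s.setReg_reg_of_ne _ hc.1.symm
  | store => rfl
  | seq c d ihc ihd => exact (ihd hc.2 _).trans (ihc hc.1 _)
  | ite e c d ihc ihd =>
    simp only [run]
    split
    · exact ihc hc.2.1 _
    · exact ihd hc.2.2 _
  | loop x c ih =>
    have key : ∀ m, (Nat.rec s (fun t s' => c.run (s'.setReg x t)) m : Store).reg 0 = s.reg 0 := by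
      intro m
      induction m with
      | zero => rfl
      | succ m ih' => exact (ih hc.2.2 _).trans ((Store.setReg_reg_of_ne _ _ hc.1.symm).trans ih')
    exact key _

theorem run_congr {c : Cmd} (hc : c.WF) {s s' : Store} (h : s.Agree varBound s') :
    (c.run s).Agree varBound (c.run s') := by
  induction c generalizing s s' with
  | skip => exact h
  | assign x e => simp only [run, BExpr.eval_congr hc.2.2 h]; exact h.setReg _ _
  | store a i e =>
    simp only [run, BExpr.eval_congr hc.1 h, BExpr.eval_congr hc.2 h]; exact h.setArr _ _ _
  | seq c d ihc ihd => exact ihd hc.2 (ihc hc.1 h)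
  | ite e c d ihc ihd =>
    simp only [run, BExpr.eval_congr hc.1 h]
    split
    · exact ihc hc.2.1 h
    · exact ihd hc.2.2 h
  | loop x c ih =>
    simp only [run, h.2 0 (by decide)]
    generalize s'.reg 0 = m
    induction m with
    | zero => exact h
    | succ m ih' => exact ih hc.2.2 (ih'.setReg _ _)

/-- The last clause protects the counter of an enclosing loop: it sits in a scratch register just
below those given to the body. -/
theorem exec_compile (c : Cmd) (hc : c.WF) :
    ∃ p : Polynomial ℕ, ∀ k, varBound ≤ k → ∀ s : Store, ∃ t s',
      Exec (c.compile k) s t s' ∧ t ≤ p.eval (s.reg 0) ∧ (c.run s).Agree varBound s' ∧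
        ∀ x, varBound ≤ x → x < k → s'.reg x = s.reg x := by
  have hB : (0 : ℕ) < varBound := by decide
  induction c with
  | skip =>
    exact ⟨1, fun k hk s => ⟨_, _, .skip s, by simp, .refl _ _, fun _ _ _ => rfl⟩⟩
  | assign x e =>
    obtain ⟨p, hp⟩ := e.exec_compile hc.2.2
    refine ⟨p + 2, fun k hk s => ?_⟩
    obtain ⟨t, s₁, h, ht, hA, hr⟩ := hp k hk s
    refine ⟨_, _, .seq h (.assign _ _ _), by simp [Expr.cost]; omega, ?_, fun y hy hy' => ?_⟩
    · simp only [run, Expr.eval, hr]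
      exact (hA.mono hk).setReg _ _
    · rw [Store.setReg_reg_of_ne _ _ (by have := hc.2.1; omega), hA.2 y hy']
  | store a i e =>
    obtain ⟨p, hp⟩ := i.exec_compile hc.1
    obtain ⟨q, hq⟩ := e.exec_compile hc.2
    refine ⟨p + q + 3, fun k hk s => ?_⟩
    obtain ⟨t, s₁, h, ht, hA, hr⟩ := hp k hk s
    obtain ⟨t', s₂, h', ht', hA', hr'⟩ := hq (k + 1) (by omega) s₁
    refine ⟨_, _, .seq h (.seq h' (.store _ _ _ _)), ?_, ?_, fun y hy hy' => ?_⟩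
    · rw [← hA.2 0 (by omega)] at ht'
      simp [Expr.cost]; omega
    · simp only [run, Expr.eval, hr', ← hA'.2 k (by omega), hr,
        ← BExpr.eval_congr hc.2 (hA.mono hk)]
      exact ((hA.mono hk).trans (hA'.mono (by omega))).setArr _ _ _
    · exact ((hA.2 y hy').trans (hA'.2 y (by omega))).symm
  | seq c d ihc ihd =>
    obtain ⟨p, hp⟩ := ihc hc.1
    obtain ⟨q, hq⟩ := ihd hc.2
    refine ⟨p + q, fun k hk s => ?_⟩
    obtain ⟨t, s₁, h, ht, hA, hr⟩ := hp k hk s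
    obtain ⟨t', s₂, h', ht', hA', hr'⟩ := hq k hk s₁
    refine ⟨_, _, .seq h h', ?_, (run_congr hc.2 hA).trans hA', fun y hy hy' => ?_⟩
    · rw [← hA.2 0 hB, run_reg_zero hc.1] at ht'
      simp; omega
    · rw [hr' y hy hy', hr y hy hy']
  | ite e c d ihc ihd =>
    obtain ⟨pe, he⟩ := e.exec_compile hc.1
    obtain ⟨p, hp⟩ := ihc hc.2.1
    obtain ⟨q, hq⟩ := ihd hc.2.2
    refine ⟨pe + p + q + 2, fun k hk s => ?_⟩
    obtain ⟨t, s₁, h, ht, hA, hr⟩ := he k hk s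
    by_cases hz : e.eval s = 0
    · obtain ⟨t', s₂, h', ht', hA', hr'⟩ := hq k hk s₁
      refine ⟨_, s₂, .seq h (.ite_false (hr.trans hz) h'), ?_, ?_, fun y hy hy' => ?_⟩
      · rw [← hA.2 0 (by omega)] at ht'
        simp [Expr.cost]; omega
      · simp only [run, hz]
        exact (run_congr hc.2.2 (hA.mono hk)).trans hA'
      · rw [hr' y hy hy', hA.2 y hy']
    · obtain ⟨t', s₂, h', ht', hA', hr'⟩ := hp k hk s₁
      refine ⟨_, s₂, .seq h (.ite_true (by simpa [Expr.eval, hr] using hz) h'), ?_, ?_,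
        fun y hy hy' => ?_⟩
      · rw [← hA.2 0 (by omega)] at ht'
        simp [Expr.cost]; omega
      · simp only [run, if_pos hz]
        exact (run_congr hc.2.1 (hA.mono hk)).trans hA'
      · rw [hr' y hy hy', hA.2 y hy']
  | loop x c ih =>
    obtain ⟨hx0, hx, hc⟩ := hc
    obtain ⟨p, hp⟩ := ih hc
    refine ⟨Polynomial.X * (p + 10) + 6, fun k hk s => ?_⟩
    let S : ℕ → Store := fun m => Nat.rec s (fun t s' => c.run (s'.setReg x t)) m
    have hS0 : ∀ m, (S m).reg 0 = s.reg 0 := by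
      intro m
      induction m with
      | zero => rfl
      | succ m ih' => exact (run_reg_zero hc _).trans ((Store.setReg_reg_of_ne _ _ hx0.symm).trans ih')
    let I : ℕ → Store → Prop := fun m s' => (S m).Agree varBound s' ∧ s'.reg k = m ∧
      ∀ y, varBound ≤ y → y < k → s'.reg y = s.reg y
    have hI0 : ∀ m s', I m s' → s'.reg 0 = s.reg 0 := fun m s' h =>
      (h.1.2 0 hB).symm.trans (hS0 m)
    obtain ⟨t', s₃, h₃, ht', hA₃, -, hz₃⟩ := exec_while I (.sub (.reg 0) (.reg k))
      (.seq (.assign x (.reg k)) (.seq (c.compile (k + 1))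
        (.assign k (.add (.reg k) (.const 1)))))
      (p.eval (s.reg 0) + 6) (s.reg 0)
      (by
        rintro m hm s' h
        simp only [Expr.eval, h.2.1, hI0 m s' h]
        omega)
      (by
        rintro s' h
        simp only [Expr.eval, h.2.1, hI0 _ s' h]
        omega)
      (by
        rintro m hm s' h
        have e1 : (Expr.reg k).eval s' = m := h.2.1
        obtain ⟨t₄, s₄, h₄, ht₄, hA₄, hr₄⟩ := hp (k + 1) (by omega) (s'.setReg x m)
        have hag : (c.run ((S m).setReg x m)).Agree varBound s₄ :=
          (run_congr hc (h.1.setReg x m)).trans hA₄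
        refine ⟨_, _, .seq (.assign _ _ _) (.seq (s₁ := s₄) (t₁ := t₄) ?_ (.assign _ _ _)),
          ?_, ?_, ?_, ?_⟩
        · rw [e1]; exact h₄
        · rw [Store.setReg_reg_of_ne _ _ hx0.symm, hI0 m s' h] at ht₄
          simp [Expr.cost]; omega
        · exact hag.trans (s₄.agree_setReg _ hk)
        · rw [Store.setReg_reg_self]
          simp only [Expr.eval]
          rw [hr₄ k hk (by omega), Store.setReg_reg_of_ne _ _ (by omega), h.2.1]
        · intro y hy hy'
          rw [Store.setReg_reg_of_ne _ _ (by omega), hr₄ y hy (by omega),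
            Store.setReg_reg_of_ne _ _ (by omega), h.2.2 y hy hy'])
      (s.setReg k 0)
      ⟨s.agree_setReg _ hk, s.setReg_reg_self _ _,
        fun y _ hy' => Store.setReg_reg_of_ne _ _ (by omega)⟩
    refine ⟨_, _, .seq (.assign _ _ _) h₃, ?_, hA₃, hz₃⟩
    simp only [Expr.cost] at ht' ⊢
    have : Polynomial.eval (s.reg 0) (Polynomial.X * (p + 10) + 6) =
        s.reg 0 * (p.eval (s.reg 0) + 10) + 6 := by simp
    rw [this]
    have : s.reg 0 * (1 + 1 + 1 + 1 + (Polynomial.eval (s.reg 0) p + 6)) =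
        s.reg 0 * (p.eval (s.reg 0) + 10) := by ring
    omega

end Cmd

/-! ## Perturbed lengths as natural numbers -/

/-- Half of the integral weight of an edge. -/
def halfWeight {n : ℕ} (idx : Sym2 (Fin n) → ℕ) (e : Sym2 (Fin n)) : ℕ :=
  8 ^ (n * n) + 8 ^ (n * n - idx e)

/-- The integral length of a list of half-edges. -/
def natLen {n : ℕ} (idx : Sym2 (Fin n) → ℕ) (L : List (Sym2 (Fin n))) : ℕ :=
  (L.map (halfWeight idx)).sum

/-- The perturbed length of a list of half-edges. -/
noncomputable def pLen {n : ℕ} (m : ℕ) (idx : Sym2 (Fin n) → ℕ) (L : List (Sym2 (Fin n))) :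
    PLen m :=
  (L.map (scaledLen m idx (1 / 2))).sum

section
variable {n : ℕ} {m : ℕ} {idx : Sym2 (Fin n) → ℕ}

@[simp] theorem natLen_nil : natLen idx [] = 0 := rfl

@[simp] theorem natLen_cons (e : Sym2 (Fin n)) (L : List (Sym2 (Fin n))) :
    natLen idx (e :: L) = halfWeight idx e + natLen idx L := by simp [natLen]

@[simp] theorem natLen_append (L L' : List (Sym2 (Fin n))) :
    natLen idx (L ++ L') = natLen idx L + natLen idx L' := by simp [natLen]

theorem pLen_append (L L' : List (Sym2 (Fin n))) :
    pLen m idx (L ++ L') = pLen m idx L + pLen m idx L' := by simp [pLen]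

/-- Counting in half-edges removes the fractions and treats vertices and middle points alike. -/
theorem edgeLen_eq (e : Sym2 (Fin n)) : edgeLen m idx e = pLen m idx [e, e] := by
  simp only [edgeLen, pLen, List.map_cons, List.map_nil, List.sum_cons, List.sum_nil, add_zero,
    scaledLen]
  rw [← toLex_add, Prod.mk_add_mk, ← toLex_add]
  congr 2
  · norm_num
  · congr 1
    funext j
    simp only [Pi.add_apply]
    split <;> norm_num

theorem pLen_fst (L : List (Sym2 (Fin n))) : (ofLex (pLen m idx L)).1 = (L.length : ℝ) / 2 := by
  induction L with
  | nil => simp [pLen]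
  | cons e L ih =>
    have : pLen m idx (e :: L) = scaledLen m idx (1 / 2) e + pLen m idx L := by simp [pLen]
    rw [this, ofLex_add, Prod.fst_add, ih]
    simp [scaledLen]
    ring

theorem pLen_snd (L : List (Sym2 (Fin n))) (j : Fin m) :
    ofLex (ofLex (pLen m idx L)).2 j = (L.countP (fun e => idx e = j + 1) : ℝ) / 2 := by
  induction L with
  | nil => simp [pLen]; rfl
  | cons e L ih =>
    have : pLen m idx (e :: L) = scaledLen m idx (1 / 2) e + pLen m idx L := by simp [pLen]
    rw [this, ofLex_add, Prod.snd_add, ofLex_add, Pi.add_apply, ih, List.countP_cons]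
    simp only [scaledLen, ofLex_toLex]
    split
    · simp_all
      ring
    · simp_all

/-! ### Comparison of numbers by their base-8 digits -/

theorem sum_digits_add_le {N : ℕ} {c : ℕ → ℕ} (hc : ∀ i, c i ≤ 7) :
    ∀ m ≤ N, ∑ i ∈ Finset.range m, c i * 8 ^ (N - 1 - i) + 8 ^ (N - m) ≤ 8 ^ N := by
  intro m
  induction m with
  | zero => simp
  | succ m ih =>
    intro hm
    have h := ih (by omega)
    rw [Finset.sum_range_succ]
    have e : N - m = (N - 1 - m) + 1 := by omega
    rw [e, pow_succ] at h
    rw [show N - (m + 1) = N - 1 - m by omega]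
    nlinarith [hc m, Nat.zero_le (8 ^ (N - 1 - m))]

/-- The first differing digit decides. Only the digits of the smaller number need a bound; the term
8^(N - m) is the slack that carries the induction over the later digits. -/
theorem sum_digits_lt {N : ℕ} {c c' : ℕ → ℕ} (hc : ∀ i, c i ≤ 7) {j : ℕ}
    (heq : ∀ i < j, c i = c' i) (hlt : c j < c' j) :
    ∀ m ≤ N, j < m → ∑ i ∈ Finset.range m, c i * 8 ^ (N - 1 - i) + 8 ^ (N - m) ≤
      ∑ i ∈ Finset.range m, c' i * 8 ^ (N - 1 - i) := by
  intro m
  induction m with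
  | zero => simp
  | succ m ih =>
    intro hm hj
    rw [Finset.sum_range_succ, Finset.sum_range_succ,
      show N - (m + 1) = N - 1 - m by omega]
    rcases Nat.lt_succ_iff_lt_or_eq.1 hj with hj | rfl
    · have h := ih (by omega) hj
      have e : N - m = (N - 1 - m) + 1 := by omega
      rw [e, pow_succ] at h
      nlinarith [hc m, Nat.zero_le (c' m * 8 ^ (N - 1 - m)), Nat.zero_le (8 ^ (N - 1 - m))]
    · rw [Finset.sum_congr rfl fun i hi => by rw [heq i (Finset.mem_range.1 hi)]]
      nlinarith [Nat.zero_le (8 ^ (N - 1 - j))]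

/-- The number of half-edges is the leading part, and the multiplicities are the digits below it. A
smaller index gets a higher power, as the lexicographic order requires. -/
theorem natLen_eq {N : ℕ} (hN : N = n * n) {L : List (Sym2 (Fin n))} (hm : m ≤ N)
    (hL : ∀ e ∈ L, 1 ≤ idx e ∧ idx e ≤ m) :
    natLen idx L = L.length * 8 ^ N +
      ∑ i ∈ Finset.range m, L.countP (fun e => idx e = i + 1) * 8 ^ (N - 1 - i) := by
  induction L with
  | nil => simp
  | cons e L ih =>
    rw [natLen_cons, ih fun e he => hL e (by simp [he])]
    obtain ⟨h1, h2⟩ := hL e (by simp)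
    have : ∑ i ∈ Finset.range m, (e :: L).countP (fun e => idx e = i + 1) * 8 ^ (N - 1 - i) =
        ∑ i ∈ Finset.range m, L.countP (fun e => idx e = i + 1) * 8 ^ (N - 1 - i) +
        ∑ i ∈ Finset.range m, if idx e - 1 = i then 8 ^ (N - 1 - i) else 0 := by
      rw [← Finset.sum_add_distrib]
      refine Finset.sum_congr rfl fun i _ => ?_
      rw [List.countP_cons, add_mul]
      congr 1
      by_cases h : idx e = i + 1
      · simp [h]
      · simp [h, show idx e - 1 ≠ i by omega]
    rw [this, Finset.sum_ite_eq, if_pos (by simp; omega), halfWeight, ← hN,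
      show N - 1 - (idx e - 1) = N - idx e by omega, List.length_cons]
    ring

end

/-! ### Natural lengths order half-edge lists as perturbed lengths do -/

section
variable {n : ℕ} {G : SimpleGraph (Fin n)} {idx : Sym2 (Fin n) → ℕ}

theorem ncard_edgeSet_le (G : SimpleGraph (Fin n)) : G.edgeSet.ncard ≤ n * n := by
  classical
  rw [← SimpleGraph.coe_edgeFinset, Set.ncard_coe_finset]
  refine G.card_edgeFinset_le_card_choose_two.trans ?_
  rw [Fintype.card_fin, Nat.choose_two_right]
  exact (Nat.div_le_self _ _).trans (Nat.mul_le_mul_left _ (Nat.sub_le _ _))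

theorem IsEdgeIndex.bounds (h : IsEdgeIndex G idx) {e : Sym2 (Fin n)} (he : e ∈ G.edgeSet) :
    1 ≤ idx e ∧ idx e ≤ G.edgeSet.ncard := h.mapsTo he

theorem IsEdgeIndex.countP_eq (h : IsEdgeIndex G idx) {e : Sym2 (Fin n)} (he : e ∈ G.edgeSet)
    {L : List (Sym2 (Fin n))} (hL : ∀ e ∈ L, e ∈ G.edgeSet) :
    L.countP (fun f => idx f = idx e) = L.count e := by
  rw [List.count]
  refine List.countP_congr fun f hf => ?_
  simp only [decide_eq_true_eq, beq_iff_eq]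
  exact ⟨fun h' => h.injOn (hL f hf) he h', fun h' => h' ▸ rfl⟩

theorem IsEdgeIndex.countP_le (h : IsEdgeIndex G idx) {L : List (Sym2 (Fin n))} {k : ℕ}
    (hL : ∀ e ∈ L, e ∈ G.edgeSet) (hc : ∀ e, L.count e ≤ k) (i : ℕ) :
    L.countP (fun f => idx f = i) ≤ k := by
  by_cases hi : ∃ e ∈ L, idx e = i
  · obtain ⟨e, he, rfl⟩ := hi
    rw [h.countP_eq (hL e he) hL]
    exact hc e
  · rw [List.countP_eq_zero.2]
    · exact Nat.zero_le _
    · intro e he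
      simpa using fun h' => hi ⟨e, he, h'⟩

theorem IsEdgeIndex.natLen_bounds (h : IsEdgeIndex G idx) {L : List (Sym2 (Fin n))}
    (hL : ∀ e ∈ L, e ∈ G.edgeSet) (hc : ∀ e, L.count e ≤ 7) :
    L.length * 8 ^ (n * n) ≤ natLen idx L ∧ natLen idx L < (L.length + 1) * 8 ^ (n * n) := by
  have hm := ncard_edgeSet_le G
  rw [natLen_eq rfl hm fun e he => h.bounds (hL e he)]
  have := sum_digits_add_le (fun i => h.countP_le hL hc (i + 1)) _ hm
  have h8 : 0 < 8 ^ (n * n - G.edgeSet.ncard) := by positivity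
  rw [add_mul, one_mul]
  omega

theorem IsEdgeIndex.natLen_lt (h : IsEdgeIndex G idx) {L L' : List (Sym2 (Fin n))}
    (hL : ∀ e ∈ L, e ∈ G.edgeSet) (hc : ∀ e, L.count e ≤ 7)
    (hL' : ∀ e ∈ L', e ∈ G.edgeSet) (hc' : ∀ e, L'.count e ≤ 7)
    (hlt : pLen G.edgeSet.ncard idx L < pLen G.edgeSet.ncard idx L') :
    natLen idx L < natLen idx L' := by
  rw [Prod.Lex.lt_iff, pLen_fst, pLen_fst] at hlt
  rcases hlt with hlt | ⟨heq, hlt⟩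
  · have h1 : L.length + 1 ≤ L'.length := by
      have : (L.length : ℝ) < L'.length := by linarith
      exact_mod_cast this
    exact (h.natLen_bounds hL hc).2.trans_le
      ((Nat.mul_le_mul_right _ h1).trans (h.natLen_bounds hL' hc').1)
  · have h1 : L.length = L'.length := by
      have : (L.length : ℝ) = L'.length := by linarith
      exact_mod_cast this
    obtain ⟨j, hj, hlt⟩ := hlt
    change ∀ i < j, ofLex (ofLex (pLen _ idx L)).2 i = ofLex (ofLex (pLen _ idx L')).2 i at hj
    change ofLex (ofLex (pLen _ idx L)).2 j < ofLex (ofLex (pLen _ idx L')).2 j at hlt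
    rw [pLen_snd, pLen_snd] at hlt
    have hm := ncard_edgeSet_le G
    rw [natLen_eq rfl hm fun e he => h.bounds (hL e he),
      natLen_eq rfl hm fun e he => h.bounds (hL' e he), h1]
    have := sum_digits_lt (N := n * n) (c := fun i => L.countP (fun e => idx e = i + 1))
      (c' := fun i => L'.countP (fun e => idx e = i + 1)) (j := j)
      (fun i => h.countP_le hL hc (i + 1))
      (fun i hi => by
        have h2 := hj ⟨i, hi.trans j.2⟩ hi
        rw [pLen_snd, pLen_snd] at h2
        have : ((L.countP (fun e => idx e = i + 1) : ℕ) : ℝ) =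
          (L'.countP (fun e => idx e = i + 1) : ℕ) := by
            simp only at h2
            linarith
        exact_mod_cast this)
      (by
        have : ((L.countP (fun e => idx e = j + 1) : ℕ) : ℝ) <
          (L'.countP (fun e => idx e = j + 1) : ℕ) := by linarith
        exact_mod_cast this) _ hm j.2
    have h8 : 0 < 8 ^ (n * n - G.edgeSet.ncard) := by positivity
    omega

/-- The coordinate belonging to the index of an edge is half of its multiplicity, and different
edges have different indices. -/
theorem IsEdgeIndex.count_eq_of_pLen_eq (h : IsEdgeIndex G idx) {L L' : List (Sym2 (Fin n))}
    (hL : ∀ e ∈ L, e ∈ G.edgeSet) (hL' : ∀ e ∈ L', e ∈ G.edgeSet)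
    (heq : pLen G.edgeSet.ncard idx L = pLen G.edgeSet.ncard idx L') (e : Sym2 (Fin n)) :
    L.count e = L'.count e := by
  by_cases he : e ∈ G.edgeSet
  · obtain ⟨h1, h2⟩ := h.bounds he
    have h3 := pLen_snd (m := G.edgeSet.ncard) (idx := idx) L ⟨idx e - 1, by omega⟩
    rw [heq, pLen_snd] at h3
    simp only [show idx e - 1 + 1 = idx e by omega] at h3
    have : ((L.countP (fun f => idx f = idx e) : ℕ) : ℝ) =
          (L'.countP (fun f => idx f = idx e) : ℕ) := by linarith
    rw [← h.countP_eq he hL, ← h.countP_eq he hL']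
    exact_mod_cast this
  · rw [List.count_eq_zero_of_not_mem fun h' => he (hL e h'),
      List.count_eq_zero_of_not_mem fun h' => he (hL' e h')]

theorem natLen_eq_of_count_eq {L L' : List (Sym2 (Fin n))} (h : ∀ e, L.count e = L'.count e) :
    natLen idx L = natLen idx L' :=
  ((List.perm_iff_count.2 h).map _).sum_eq

theorem IsEdgeIndex.natLen_le_iff (h : IsEdgeIndex G idx) {L L' : List (Sym2 (Fin n))}
    (hL : ∀ e ∈ L, e ∈ G.edgeSet) (hc : ∀ e, L.count e ≤ 7)
    (hL' : ∀ e ∈ L', e ∈ G.edgeSet) (hc' : ∀ e, L'.count e ≤ 7) :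
    natLen idx L ≤ natLen idx L' ↔
      pLen G.edgeSet.ncard idx L ≤ pLen G.edgeSet.ncard idx L' := by
  rcases lt_trichotomy (pLen G.edgeSet.ncard idx L) (pLen G.edgeSet.ncard idx L') with h1 | h1 | h1
  · exact iff_of_true (h.natLen_lt hL hc hL' hc' h1).le h1.le
  · exact iff_of_true (natLen_eq_of_count_eq (h.count_eq_of_pLen_eq hL hL' h1)).le h1.le
  · exact iff_of_false (h.natLen_lt hL' hc' hL hc h1).not_ge h1.not_ge

theorem IsEdgeIndex.count_eq_of_natLen_eq (h : IsEdgeIndex G idx) {L L' : List (Sym2 (Fin n))}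
    (hL : ∀ e ∈ L, e ∈ G.edgeSet) (hc : ∀ e, L.count e ≤ 7)
    (hL' : ∀ e ∈ L', e ∈ G.edgeSet) (hc' : ∀ e, L'.count e ≤ 7)
    (heq : natLen idx L = natLen idx L') (e : Sym2 (Fin n)) : L.count e = L'.count e :=
  h.count_eq_of_pLen_eq hL hL' (le_antisymm ((h.natLen_le_iff hL hc hL' hc').1 heq.le)
    ((h.natLen_le_iff hL' hc' hL hc).1 heq.ge)) e

end

/-! ### Distances and labels as natural numbers -/

/-- The half-edge at a point: half of `e` for the middle point of `e`. -/
def Point.half {n : ℕ} : Point n → List (Sym2 (Fin n))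
  | Sum.inl _ => []
  | Sum.inr e => [e]

/-- `a` is the vertex `r`, or an end of the edge whose middle point is `r`. -/
def Point.IsEnd {n : ℕ} (r : Point n) (a : Fin n) : Prop :=
  match r with
  | Sum.inl v => a = v
  | Sum.inr e => a ∈ e

/-- The half-edges of a path from the point `r`. -/
def halfEdges {n : ℕ} {H : SimpleGraph (Fin n)} (r : Point n) {a v : Fin n} (p : H.Walk a v) :
    List (Sym2 (Fin n)) :=
  r.half ++ (p.edges ++ p.edges)

/-- The integral distance from the point `r` to the vertex `v`. -/
noncomputable def natDist {n : ℕ} (idx : Sym2 (Fin n) → ℕ) (H : SimpleGraph (Fin n))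
    (r : Point n) (v : Fin n) : ℕ :=
  sInf {k | ∃ a, r.IsEnd a ∧ ∃ p : H.Walk a v, k = natLen idx (halfEdges r p)}

section
variable {n : ℕ} {G H : SimpleGraph (Fin n)} {idx : Sym2 (Fin n) → ℕ} {r : Point n} {v : Fin n}

theorem Point.exists_isEnd (r : Point n) : ∃ a, r.IsEnd a := by
  rcases r with v | e
  · exact ⟨v, rfl⟩
  · induction e with
    | _ a b => exact ⟨a, Sym2.mem_mk_left a b⟩

theorem walkLen_eq {m : ℕ} {u : Fin n} (p : H.Walk u v) :
    walkLen m idx p = pLen m idx (p.edges ++ p.edges) := by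
  rw [walkLen]
  induction p.edges with
  | nil => simp [pLen]
  | cons e L ih =>
    rw [List.map_cons, List.sum_cons, ih, edgeLen_eq]
    simp only [pLen, List.map_append, List.sum_append, List.map_cons, List.sum_cons, List.map_nil,
      List.sum_nil]
    abel

theorem mem_pathLens {m : ℕ} {x : PLen m} : x ∈ pathLens m idx H r v ↔
    ∃ a, r.IsEnd a ∧ ∃ p : H.Walk a v, p.IsPath ∧ x = pLen m idx (halfEdges r p) := by
  rcases r with u | e
  · simp only [pathLens, Set.mem_ofPred_eq, Point.IsEnd, exists_eq_left, halfEdges, Point.half,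
      walkLen_eq, List.nil_append]
  · simp only [pathLens, Set.mem_ofPred_eq, Point.IsEnd, halfEdges, Point.half,
      walkLen_eq, pLen_append]
    simp [pLen]

theorem halfEdges_mem (hr : r ∈ points G) (hH : H ≤ G) {a : Fin n} (p : H.Walk a v) :
    ∀ e ∈ halfEdges r p, e ∈ G.edgeSet := by
  intro e he
  simp only [halfEdges, List.mem_append] at he
  rcases he with he | he | he
  · rcases r with u | f
    · simp [Point.half] at he
    · simp only [Point.half, List.mem_singleton] at he
      subst he
      simpa [points] using hr
  all_goals exact SimpleGraph.edgeSet_mono hH (p.edges_subset_edgeSet he)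

theorem Point.count_half_le (r : Point n) (e : Sym2 (Fin n)) : r.half.count e ≤ 1 := by
  rcases r with u | f
  · simp [half]
  · exact List.count_le_length

/-- At most one half-edge at the start and two from the path. Adding one more edge gives 5, still
below the limit 7 for digits. -/
theorem count_halfEdges_le {a : Fin n} {p : H.Walk a v} (hp : p.IsPath) (e : Sym2 (Fin n)) :
    (halfEdges r p).count e ≤ 3 := by
  have := List.nodup_iff_count_le_one.1 hp.isTrail.edges_nodup e
  have := r.count_half_le e
  simp only [halfEdges, List.count_append]
  omega

theorem natLen_mono_sublist {L L' : List (Sym2 (Fin n))} (h : L.Sublist L') :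
    natLen idx L ≤ natLen idx L' :=
  (h.map _).sum_le_sum fun _ _ => Nat.zero_le _

theorem natDist_le {a : Fin n} (ha : r.IsEnd a) (p : H.Walk a v) :
    natDist idx H r v ≤ natLen idx (halfEdges r p) :=
  Nat.sInf_le ⟨a, ha, p, rfl⟩

theorem exists_natDist_eq (hH : H.Connected) (idx : Sym2 (Fin n) → ℕ) (r : Point n) (v : Fin n) :
    ∃ a, r.IsEnd a ∧ ∃ p : H.Walk a v, p.IsPath ∧ natDist idx H r v = natLen idx (halfEdges r p) := by
  obtain ⟨a₀, ha₀⟩ := r.exists_isEnd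
  obtain ⟨p₀⟩ := hH.preconnected a₀ v
  have hne : {k | ∃ a, r.IsEnd a ∧ ∃ p : H.Walk a v, k = natLen idx (halfEdges r p)}.Nonempty :=
    ⟨_, a₀, ha₀, p₀, rfl⟩
  obtain ⟨a, ha, p, hp⟩ := Nat.sInf_mem hne
  refine ⟨a, ha, p.bypass, p.bypass_isPath, le_antisymm (natDist_le ha _) ?_⟩
  rw [natDist, hp]
  refine natLen_mono_sublist (List.Sublist.append_left (List.Sublist.append ?_ ?_) _) <;>
  exact p.edges_bypass_sublist_edges

/-- A single path realizes both minima, since the two lengths order paths in the same way. This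
transfers statements about labels to natural numbers. -/
theorem IsEdgeIndex.exists_path_natDist_pertDist (h : IsEdgeIndex G idx) (hH : H.Connected)
    (hHG : H ≤ G) (hr : r ∈ points G) (v : Fin n) :
    ∃ a, r.IsEnd a ∧ ∃ p : H.Walk a v, p.IsPath ∧ natDist idx H r v = natLen idx (halfEdges r p) ∧
      pertDist G.edgeSet.ncard idx H r v = pLen G.edgeSet.ncard idx (halfEdges r p) := by
  obtain ⟨hmem, hmin⟩ := pertDist_isLeast G.edgeSet.ncard idx hH r v
  obtain ⟨a, ha, p, hp, hx⟩ := mem_pathLens.1 hmem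
  refine ⟨a, ha, p, hp, le_antisymm (natDist_le ha _) ?_, hx⟩
  obtain ⟨b, hb, q, hq, hy⟩ := exists_natDist_eq hH idx r v
  have h7 : ∀ {a : Fin n} {p : H.Walk a v}, p.IsPath → ∀ e, (halfEdges r p).count e ≤ 7 :=
    fun hp e => (count_halfEdges_le hp e).trans (by norm_num)
  rw [hy, h.natLen_le_iff (halfEdges_mem hr hHG p) (h7 hp) (halfEdges_mem hr hHG q) (h7 hq), ← hx]
  exact hmin (mem_pathLens.2 ⟨b, hb, q, hq, rfl⟩)

/-- The integral label of a vertex. -/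
noncomputable def natLabel (idx : Sym2 (Fin n) → ℕ) (H : SimpleGraph (Fin n)) (r₁ r₂ : Point n)
    (v : Fin n) : ℕ :=
  max (natDist idx H r₁ v) (natDist idx H r₂ v)

theorem IsEdgeIndex.exists_label_eq (h : IsEdgeIndex G idx) (hH : H.Connected)
    (hHG : H ≤ G) {r₁ r₂ : Point n} (hr₁ : r₁ ∈ points G) (hr₂ : r₂ ∈ points G) (v : Fin n) :
    ∃ L : List (Sym2 (Fin n)), (∀ e ∈ L, e ∈ G.edgeSet) ∧ (∀ e, L.count e ≤ 3) ∧
      natLabel idx H r₁ r₂ v = natLen idx L ∧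
      label G.edgeSet.ncard idx r₁ r₂ H v = pLen G.edgeSet.ncard idx L := by
  obtain ⟨a, -, p, hp, h1, h2⟩ := h.exists_path_natDist_pertDist hH hHG hr₁ v
  obtain ⟨b, -, q, hq, h3, h4⟩ := h.exists_path_natDist_pertDist hH hHG hr₂ v
  have key := h.natLen_le_iff (halfEdges_mem hr₁ hHG p)
    (fun e => (count_halfEdges_le hp e).trans (by norm_num)) (halfEdges_mem hr₂ hHG q)
    (fun e => (count_halfEdges_le hq e).trans (by norm_num))
  rw [natLabel, label, h1, h2, h3, h4]
  by_cases hle : natLen idx (halfEdges r₁ p) ≤ natLen idx (halfEdges r₂ q)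
  · exact ⟨_, halfEdges_mem hr₂ hHG q, count_halfEdges_le hq, max_eq_right hle,
      max_eq_right (key.1 hle)⟩
  · exact ⟨_, halfEdges_mem hr₁ hHG p, count_halfEdges_le hp, max_eq_left (not_le.1 hle).le,
      max_eq_left (not_le.1 (mt key.2 hle)).le⟩

theorem IsEdgeIndex.label_le_iff (h : IsEdgeIndex G idx) (hH : H.Connected)
    (hHG : H ≤ G) {r₁ r₂ : Point n} (hr₁ : r₁ ∈ points G) (hr₂ : r₂ ∈ points G) {u v : Fin n}
    (huv : G.Adj u v) :
    label G.edgeSet.ncard idx r₁ r₂ H v ≤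
        label G.edgeSet.ncard idx r₁ r₂ H u + edgeLen G.edgeSet.ncard idx s(u, v) ↔
      natLabel idx H r₁ r₂ v ≤ natLabel idx H r₁ r₂ u + 2 * halfWeight idx s(u, v) := by
  obtain ⟨L, hL, hc, h1, h2⟩ := h.exists_label_eq hH hHG hr₁ hr₂ v
  obtain ⟨L', hL', hc', h1', h2'⟩ := h.exists_label_eq hH hHG hr₁ hr₂ u
  rw [h1, h2, h1', h2', edgeLen_eq, ← pLen_append]
  have : natLen idx L' + 2 * halfWeight idx s(u, v) = natLen idx (L' ++ [s(u, v), s(u, v)]) := by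
    simp; ring
  rw [this]
  refine (h.natLen_le_iff hL (fun e => (hc e).trans (by norm_num)) ?_ fun e => ?_).symm
  · intro e he
    rcases List.mem_append.1 he with he | he
    · exact hL' e he
    · simp at he
      subst he
      exact huv
  · rw [List.count_append]
    have := hc' e
    have : [s(u, v), s(u, v)].count e ≤ 2 := List.count_le_length
    omega

end

/-! ## Pseudotrees, cycles and center points -/

section
variable {n : ℕ} {G Q : SimpleGraph (Fin n)}

/-- Turns lying on a cycle into a connectedness test, which distance matrices can decide. -/
theorem connected_deleteEdges_iff_exists_cycle (hQ : Q.Connected) {x y : Fin n} (h : Q.Adj x y) :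
    (Q.deleteEdges {s(x, y)}).Connected ↔
      ∃ (u : Fin n) (c : Q.Walk u u), c.IsCycle ∧ s(x, y) ∈ c.edges := by
  rw [← SimpleGraph.adj_and_reachable_delete_edges_iff_exists_cycle]
  refine ⟨fun hc => ⟨h, hc.preconnected x y⟩, fun hc => ?_⟩
  exact hQ.connected_delete_edge_of_not_isBridge (by rw [SimpleGraph.isBridge_iff]; exact not_not.2 hc.2)

theorem ncard_edgeSet_deleteEdges {e : Sym2 (Fin n)} (he : e ∈ Q.edgeSet) :
    (Q.deleteEdges {e}).edgeSet.ncard + 1 = Q.edgeSet.ncard := by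
  rw [SimpleGraph.edgeSet_deleteEdges, Set.ncard_sdiff_singleton_add_one he (Set.toFinite _)]

theorem le_ncard_edgeSet_add_one (hQ : Q.Connected) : n ≤ Q.edgeSet.ncard + 1 := by
  have := hQ.card_vert_le_card_edgeSet_add_one
  rwa [Nat.card_fin] at this

theorem isAcyclic_iff_ncard_lt (hQ : Q.Connected) : Q.IsAcyclic ↔ Q.edgeSet.ncard < n := by
  have h := SimpleGraph.isTree_iff_connected_and_card (G := Q)
  have h' := le_ncard_edgeSet_add_one hQ
  rw [Nat.card_fin] at h
  change _ ↔ Q.Connected ∧ Q.edgeSet.ncard + 1 = n at h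
  constructor
  · intro ha
    have := (h.1 ⟨hQ, ha⟩).2
    omega
  · intro hlt
    exact (h.2 ⟨hQ, by omega⟩).isAcyclic

/-- Any two cycles have the same edges. -/
def CyclesAgree (Q : SimpleGraph (Fin n)) : Prop :=
  ∀ (u v : Fin n) (c : Q.Walk u u) (c' : Q.Walk v v), c.IsCycle → c'.IsCycle →
    ∀ e, e ∈ c.edges ↔ e ∈ c'.edges

theorem exists_mem_edges_of_isCycle {u : Fin n} {c : Q.Walk u u} (hc : c.IsCycle) :
    ∃ e, e ∈ c.edges := by
  cases c with
  | nil => exact absurd rfl hc.ne_nil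
  | cons h p => exact ⟨_, List.mem_cons_self⟩

/-- If all cycles agree, deleting an edge of one leaves a tree. Conversely, if an edge of one cycle
is missing from another, it can be deleted, and then an edge of the other cycle too, without
disconnecting the graph; this is impossible with at most n - 2 edges left. -/
theorem cyclesAgree_iff_ncard_le (hQ : Q.Connected) : CyclesAgree Q ↔ Q.edgeSet.ncard ≤ n := by
  constructor
  · intro h
    by_cases ha : Q.IsAcyclic
    · exact ((isAcyclic_iff_ncard_lt hQ).1 ha).le
    simp only [SimpleGraph.IsAcyclic, not_forall, not_not] at ha
    obtain ⟨u, c, hc⟩ := ha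
    obtain ⟨e, he⟩ := exists_mem_edges_of_isCycle hc
    induction e with
    | _ x y =>
    have hxy : Q.Adj x y := c.adj_of_mem_edges he
    have hconn := (connected_deleteEdges_iff_exists_cycle hQ hxy).2 ⟨u, c, hc, he⟩
    have hac : (Q.deleteEdges {s(x, y)}).IsAcyclic := by
      intro w c' hc'
      have := (h u w c (c'.mapLe (SimpleGraph.deleteEdges_le _)) hc
        (hc'.mapLe (SimpleGraph.deleteEdges_le _)) _).1 he
      rw [SimpleGraph.Walk.edges_mapLe_eq_edges] at this
      simpa using c'.edges_subset_edgeSet this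
    have := (isAcyclic_iff_ncard_lt hconn).1 hac
    have := ncard_edgeSet_deleteEdges (e := s(x, y)) hxy
    omega
  · intro h
    have key : ∀ (u v : Fin n) (c : Q.Walk u u) (c' : Q.Walk v v), c.IsCycle → c'.IsCycle →
        ∀ e, e ∈ c.edges → e ∈ c'.edges := by
      intro u v c c' hc hc' e he
      by_contra hne
      induction e with
      | _ x y =>
      have hxy : Q.Adj x y := c.adj_of_mem_edges he
      have hconn := (connected_deleteEdges_iff_exists_cycle hQ hxy).2 ⟨u, c, hc, he⟩
      have hsub : ∀ e ∈ c'.edges, e ∈ (Q.deleteEdges {s(x, y)}).edgeSet := by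
        intro e he'
        rw [SimpleGraph.edgeSet_deleteEdges]
        exact ⟨c'.edges_subset_edgeSet he', fun h' => hne (h' ▸ he')⟩
      obtain ⟨f, hf⟩ := exists_mem_edges_of_isCycle hc'
      have hf' := hsub f hf
      have h2 := ncard_edgeSet_deleteEdges (e := s(x, y)) hxy
      induction f with
      | _ a b =>
      have hconn' := (connected_deleteEdges_iff_exists_cycle hconn (x := a) (y := b) hf').2
        ⟨v, c'.transfer _ hsub, hc'.transfer hsub, by simpa using hf⟩
      have h1 := ncard_edgeSet_deleteEdges (e := s(a, b)) hf'
      have h3 := le_ncard_edgeSet_add_one hconn'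
      omega
    exact fun u v c c' hc hc' e => ⟨key u v c c' hc hc' e, key v u c' c hc' hc e⟩

theorem isPseudotree_iff : IsPseudotree G Q ↔ Q ≤ G ∧ Q.Connected ∧ Q.edgeSet.ncard ≤ n := by
  constructor
  · rintro ⟨h1, h2, h3⟩
    exact ⟨h1, h2, (cyclesAgree_iff_ncard_le h2).1 h3⟩
  · rintro ⟨h1, h2, h3⟩
    exact ⟨h1, h2, (cyclesAgree_iff_ncard_le h2).2 h3⟩

/-- The code of a point as a pair of vertices. -/
def Point.code : Point n → Fin n × Fin n
  | Sum.inl v => (v, v)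
  | Sum.inr e => (e.inf, e.sup)

theorem pointCode_eq (r : Point n) : pointCode r = ((r.code.1 : ℕ), (r.code.2 : ℕ)) := by
  rcases r with v | e <;> rfl

theorem mk_inf_sup (e : Sym2 (Fin n)) : s(e.inf, e.sup) = e := by
  induction e with
  | _ a b =>
    rcases le_total a b with h | h
    · simp [h]
    · simp [h, Sym2.eq_swap]

theorem Point.isEnd_iff (r : Point n) (a : Fin n) : r.IsEnd a ↔ a = r.code.1 ∨ a = r.code.2 := by
  rcases r with v | e
  · simp [IsEnd, code]
  · simp only [IsEnd, code]
    conv_lhs => rw [← mk_inf_sup e]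
    simp

theorem Point.code_inr_ne {e : Sym2 (Fin n)} (he : (Sum.inr e : Point n) ∈ points Q) :
    (Point.code (Sum.inr e)).1 ≠ (Point.code (Sum.inr e)).2 := by
  have : e ∈ Q.edgeSet := by simpa [points] using he
  rw [← mk_inf_sup e] at this
  exact SimpleGraph.Adj.ne this

theorem mem_points_iff {r : Point n} (hr : r ∈ points G) :
    r ∈ points Q ↔ r.code.1 = r.code.2 ∨ Q.Adj r.code.1 r.code.2 := by
  rcases r with v | e
  · simp [points, Point.code]
  · have hne := Point.code_inr_ne hr
    simp only [hne, false_or]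
    have : Q.Adj (Point.code (Sum.inr e)).1 (Point.code (Sum.inr e)).2 ↔ e ∈ Q.edgeSet := by
      conv_rhs => rw [← mk_inf_sup e]
      rfl
    rw [this]
    simp [points]

theorem onWalk_iff {r : Point n} (hr : r ∈ points Q) {u : Fin n} {c : Q.Walk u u}
    (hc : c.IsCycle) : OnWalk r c ↔
      ∃ y, s(r.code.1, y) ∈ c.edges ∧ (r.code.1 = r.code.2 ∨ y = r.code.2) := by
  rcases r with v | e
  · simp only [OnWalk, Point.code, true_or, and_true]
    constructor
    · intro hv
      obtain ⟨e, he, hve⟩ := (SimpleGraph.Walk.mem_support_iff_exists_mem_edges_of_not_nil hc.not_nil).1 hv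
      obtain ⟨y, rfl⟩ := Sym2.mem_iff_exists.1 hve
      exact ⟨y, he⟩
    · rintro ⟨y, hy⟩
      exact c.fst_mem_support_of_mem_edges hy
  · have hne := Point.code_inr_ne hr
    simp only [hne, false_or, exists_eq_right, OnWalk]
    simp only [Point.code, mk_inf_sup]

/-- The point `r` lies on a cycle of `Q`, witnessed by the vertex `y`. -/
def CycleWitness (Q : SimpleGraph (Fin n)) (r : Point n) (y : Fin n) : Prop :=
  Q.Adj r.code.1 y ∧ (r.code.1 = r.code.2 ∨ y = r.code.2) ∧
    (Q.deleteEdges {s(r.code.1, y)}).Connected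

/-- There is at most one cycle, so an edge on some cycle is on every cycle. A vertex is on the cycle
if one of its edges is, and the witness `y` names the other end of that edge. -/
theorem forall_onWalk_iff (hQ : Q.Connected) (hn : Q.edgeSet.ncard ≤ n) {r₁ r₂ : Point n}
    (hr₁ : r₁ ∈ points Q) (hr₂ : r₂ ∈ points Q) :
    (∀ (w : Fin n) (c : Q.Walk w w), c.IsCycle → OnWalk r₁ c ∧ OnWalk r₂ c) ↔
      Q.edgeSet.ncard < n ∨ ((∃ y, CycleWitness Q r₁ y) ∧ ∃ y, CycleWitness Q r₂ y) := by
  rw [← isAcyclic_iff_ncard_lt hQ]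
  have hagree := (cyclesAgree_iff_ncard_le hQ).2 hn
  have key : ∀ {r : Point n}, r ∈ points Q → ∀ (w : Fin n) (c : Q.Walk w w), c.IsCycle →
      (OnWalk r c ↔ ∃ y, CycleWitness Q r y) := by
    intro r hr w c hc
    rw [onWalk_iff hr hc]
    refine exists_congr fun y => ?_
    constructor
    · rintro ⟨h1, h2⟩
      have := c.adj_of_mem_edges h1
      exact ⟨this, h2, (connected_deleteEdges_iff_exists_cycle hQ this).2 ⟨w, c, hc, h1⟩⟩
    · rintro ⟨h1, h2, h3⟩
      obtain ⟨u, c', hc', he⟩ := (connected_deleteEdges_iff_exists_cycle hQ h1).1 h3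
      exact ⟨(hagree _ _ c c' hc hc' _).2 he, h2⟩
  by_cases ha : Q.IsAcyclic
  · simp only [ha, true_or, iff_true]
    exact fun w c hc => absurd hc (ha c)
  · simp only [ha, false_or]
    simp only [SimpleGraph.IsAcyclic, not_forall, not_not] at ha
    obtain ⟨u, c, hc⟩ := ha
    rw [← key hr₁ u c hc, ← key hr₂ u c hc]
    refine ⟨fun h => h u c hc, fun h w c' hc' => ?_⟩
    rwa [key hr₁ w c' hc', key hr₂ w c' hc', ← key hr₁ u c hc, ← key hr₂ u c hc]

/-! ### Center points in terms of natural distances -/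

theorem subdivision_adj_iff {H : SimpleGraph (Fin n)} {u : Fin n} {e : Sym2 (Fin n)} :
    (subdivision H).Adj (Sum.inl u) (Sum.inr e) ↔ e ∈ H.edgeSet ∧ u ∈ e := by
  simp [subdivision]

theorem exists_subdivision_walk {H : SimpleGraph (Fin n)} {a v : Fin n} (p : H.Walk a v) :
    ∃ W : (subdivision H).Walk (Sum.inl a) (Sum.inl v), W.length = 2 * p.length := by
  induction p with
  | nil => exact ⟨.nil, rfl⟩
  | @cons a b v h p ih =>
    obtain ⟨W, hW⟩ := ih
    have h1 : (subdivision H).Adj (Sum.inl a) (Sum.inr s(a, b)) :=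
      subdivision_adj_iff.2 ⟨h, Sym2.mem_mk_left a b⟩
    have h2 : (subdivision H).Adj (Sum.inl b) (Sum.inr s(a, b)) :=
      subdivision_adj_iff.2 ⟨h, Sym2.mem_mk_right a b⟩
    exact ⟨.cons h1 (.cons h2.symm W), by simp [hW]; ring⟩

theorem length_halfEdges {H : SimpleGraph (Fin n)} (r : Point n) {a v : Fin n} (p : H.Walk a v) :
    (halfEdges r p).length = r.half.length + 2 * p.length := by
  simp [halfEdges]; ring

/-- Induction along the walk: a step from a vertex to a middle point either uses that edge or turns
back, and a step from a middle point enters one of the ends of its edge. One step is one half-edge.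
-/
theorem exists_walk_of_subdivision_walk {H : SimpleGraph (Fin n)} {x y : Point n}
    (W : (subdivision H).Walk x y) (v : Fin n) (hy : y = Sum.inl v) :
    ∃ a, x.IsEnd a ∧ ∃ p : H.Walk a v, (halfEdges x p).length ≤ W.length := by
  simp only [length_halfEdges]
  induction W with
  | nil =>
    subst hy
    exact ⟨v, rfl, .nil, by simp [Point.half]⟩
  | @cons x x' y h W ih =>
    obtain ⟨a, ha, p, hp⟩ := ih hy
    rcases x with u | e <;> rcases x' with u' | e'
    · simp [subdivision] at h
    · obtain ⟨he, hu⟩ := subdivision_adj_iff.1 h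
      simp only [Point.half, List.length_singleton] at hp
      by_cases hau : a = u
      · subst hau
        exact ⟨a, rfl, p, by simp [Point.half]; omega⟩
      · have hadj : H.Adj u a := by
          rwa [(Sym2.mem_and_mem_iff (Ne.symm hau)).1 ⟨hu, ha⟩] at he
        exact ⟨u, rfl, .cons hadj p, by simp [Point.half]; omega⟩
    · obtain ⟨he, hu⟩ := subdivision_adj_iff.1 h.symm
      have : a = u' := ha
      subst this
      simp only [Point.half, List.length_nil] at hp
      exact ⟨a, hu, p, by simp [Point.half]; omega⟩
    · simp [subdivision] at h

theorem subdivision_dist_le_iff {H : SimpleGraph (Fin n)} (hH : H.Connected) {r : Point n}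
    (hr : r ∈ points H) (v : Fin n) (d : ℕ) :
    (subdivision H).dist r (Sum.inl v) ≤ d ↔
      ∃ a, r.IsEnd a ∧ ∃ p : H.Walk a v, (halfEdges r p).length ≤ d := by
  have lift : ∀ a, r.IsEnd a → ∀ p : H.Walk a v,
      ∃ W : (subdivision H).Walk r (Sum.inl v), W.length = (halfEdges r p).length := by
    intro a ha p
    obtain ⟨W, hW⟩ := exists_subdivision_walk p
    rcases r with u | e
    · have : a = u := ha
      subst this
      exact ⟨W, by rw [hW, length_halfEdges]; simp [Point.half]⟩
    · have he : e ∈ H.edgeSet := by simpa [points] using hr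
      refine ⟨.cons (subdivision_adj_iff.2 ⟨he, ha⟩).symm W, ?_⟩
      rw [SimpleGraph.Walk.length_cons, hW, length_halfEdges]
      simp [Point.half]; ring
  constructor
  · intro h
    obtain ⟨a, ha⟩ := r.exists_isEnd
    obtain ⟨p⟩ := hH.preconnected a v
    obtain ⟨W, -⟩ := lift a ha p
    obtain ⟨W', hW'⟩ := SimpleGraph.Reachable.exists_walk_length_eq_dist ⟨W⟩
    obtain ⟨b, hb, q, hq⟩ := exists_walk_of_subdivision_walk W' v rfl
    exact ⟨b, hb, q, by omega⟩
  · rintro ⟨a, ha, p, hp⟩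
    obtain ⟨W, hW⟩ := lift a ha p
    exact (SimpleGraph.dist_le W).trans (by omega)

/-- With l half-edges, the length lies between l·8^(n²) and (l+1)·8^(n²), the upper bound excluded.
So a threshold on the natural distance recovers the unperturbed one. -/
theorem IsEdgeIndex.natDist_lt_iff {idx : Sym2 (Fin n) → ℕ} (h : IsEdgeIndex G idx)
    {H : SimpleGraph (Fin n)} (hH : H.Connected) (hHG : H ≤ G) {r : Point n} (hr : r ∈ points G)
    (v : Fin n) (d : ℕ) :
    natDist idx H r v < (d + 1) * 8 ^ (n * n) ↔
      ∃ a, r.IsEnd a ∧ ∃ p : H.Walk a v, (halfEdges r p).length ≤ d := by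
  have h7 : ∀ {a : Fin n} {p : H.Walk a v}, p.IsPath → ∀ e, (halfEdges r p).count e ≤ 7 :=
    fun hp e => (count_halfEdges_le hp e).trans (by norm_num)
  constructor
  · intro hlt
    obtain ⟨a, ha, p, hp, heq⟩ := exists_natDist_eq hH idx r v
    refine ⟨a, ha, p, ?_⟩
    have := (h.natLen_bounds (halfEdges_mem hr hHG p) (h7 hp)).1
    rw [← heq] at this
    exact Nat.lt_succ_iff.1 (Nat.lt_of_mul_lt_mul_right (this.trans_lt hlt))
  · rintro ⟨a, ha, p, hp⟩
    refine (natDist_le ha p.bypass).trans_lt ((h.natLen_bounds (halfEdges_mem hr hHG _)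
      (h7 p.bypass_isPath)).2.trans_le (Nat.mul_le_mul_right _ ?_))
    have := p.length_bypass_le_length
    rw [length_halfEdges] at *
    omega

theorem IsEdgeIndex.isCenter_iff {idx : Sym2 (Fin n) → ℕ} (h : IsEdgeIndex G idx)
    {H : SimpleGraph (Fin n)} (hH : H.Connected) (hHG : H ≤ G) {r : Point n} (hr : r ∈ points G)
    (d : ℕ) :
    IsCenter d H r ↔ r ∈ points H ∧ ∀ v, natDist idx H r v < (d + 1) * 8 ^ (n * n) := by
  refine and_congr_right fun hr' => ?_
  have : ∀ v, natDist idx H r v < (d + 1) * 8 ^ (n * n) ↔ pointDist H r (Sum.inl v) ≤ d / 2 := by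
    intro v
    rw [h.natDist_lt_iff hH hHG hr, ← subdivision_dist_le_iff hH hr', pointDist,
      div_le_div_iff_of_pos_right two_pos, Nat.cast_le]
  simp only [this, ecc]
  have := hH.nonempty
  exact ciSup_le_iff (Set.finite_range _).bddAbove

end

/-! ## Distances -/

/-- The integral distance between two vertices. -/
noncomputable abbrev vertexDist {n : ℕ} (idx : Sym2 (Fin n) → ℕ) (H : SimpleGraph (Fin n))
    (u v : Fin n) : ℕ :=
  natDist idx H (Sum.inl u) v

section
variable {n : ℕ} {G H : SimpleGraph (Fin n)} {idx : Sym2 (Fin n) → ℕ}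

theorem natLen_halfEdges {r : Point n} {a v : Fin n} (p : H.Walk a v) :
    natLen idx (halfEdges r p) = natLen idx r.half + 2 * natLen idx p.edges := by
  simp [halfEdges]; ring

theorem vertexDist_le {u v : Fin n} (p : H.Walk u v) :
    vertexDist idx H u v ≤ 2 * natLen idx p.edges := by
  have := natDist_le (idx := idx) (r := Sum.inl u) rfl p
  rw [natLen_halfEdges] at this
  simpa [Point.half] using this

theorem exists_vertexDist_eq (hH : H.Connected) (idx : Sym2 (Fin n) → ℕ) (u v : Fin n) :
    ∃ p : H.Walk u v, p.IsPath ∧ vertexDist idx H u v = 2 * natLen idx p.edges := by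
  obtain ⟨a, ha, p, hp, h⟩ := exists_natDist_eq hH idx (Sum.inl u) v
  obtain rfl : a = u := ha
  exact ⟨p, hp, by rw [vertexDist, h, natLen_halfEdges]; simp [Point.half]⟩

theorem natDist_eq_min (hH : H.Connected) (r : Point n) (v : Fin n) :
    natDist idx H r v = natLen idx r.half +
      min (vertexDist idx H r.code.1 v) (vertexDist idx H r.code.2 v) := by
  apply le_antisymm
  · rcases min_choice (vertexDist idx H r.code.1 v) (vertexDist idx H r.code.2 v) with h | h
    · rw [h]
      obtain ⟨p, -, hp⟩ := exists_vertexDist_eq hH idx r.code.1 v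
      rw [hp, ← natLen_halfEdges]
      exact natDist_le ((r.isEnd_iff _).2 (.inl rfl)) p
    · rw [h]
      obtain ⟨p, -, hp⟩ := exists_vertexDist_eq hH idx r.code.2 v
      rw [hp, ← natLen_halfEdges]
      exact natDist_le ((r.isEnd_iff _).2 (.inr rfl)) p
  · obtain ⟨a, ha, p, -, hp⟩ := exists_natDist_eq hH idx r v
    rw [hp, natLen_halfEdges]
    have := vertexDist_le (idx := idx) p
    rcases (r.isEnd_iff a).1 ha with rfl | rfl
    · have := min_le_left (vertexDist idx H r.code.1 v) (vertexDist idx H r.code.2 v)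
      omega
    · have := min_le_right (vertexDist idx H r.code.1 v) (vertexDist idx H r.code.2 v)
      omega

theorem vertexDist_self (u : Fin n) : vertexDist idx H u u = 0 := by
  have := vertexDist_le (idx := idx) (.nil : H.Walk u u)
  simpa using this

theorem vertexDist_triangle (hH : H.Connected) (u v w : Fin n) :
    vertexDist idx H u w ≤ vertexDist idx H u v + vertexDist idx H v w := by
  obtain ⟨p, -, hp⟩ := exists_vertexDist_eq hH idx u v
  obtain ⟨q, -, hq⟩ := exists_vertexDist_eq hH idx v w
  rw [hp, hq]
  refine (vertexDist_le (p.append q)).trans ?_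
  simp; omega

theorem natLen_reverse (L : List (Sym2 (Fin n))) : natLen idx L.reverse = natLen idx L := by
  simp [natLen]

theorem vertexDist_comm (hH : H.Connected) (u v : Fin n) :
    vertexDist idx H u v = vertexDist idx H v u := by
  have : ∀ u v, vertexDist idx H u v ≤ vertexDist idx H v u := by
    intro u v
    obtain ⟨p, -, hp⟩ := exists_vertexDist_eq hH idx v u
    rw [hp]
    refine (vertexDist_le p.reverse).trans ?_
    rw [SimpleGraph.Walk.edges_reverse, natLen_reverse]
  exact le_antisymm (this u v) (this v u)

theorem halfWeight_le (e : Sym2 (Fin n)) : halfWeight idx e ≤ 2 * 8 ^ (n * n) := by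
  have : 8 ^ (n * n - idx e) ≤ 8 ^ (n * n) := Nat.pow_le_pow_right (by norm_num) (Nat.sub_le _ _)
  rw [halfWeight]; omega

theorem halfWeight_ge (e : Sym2 (Fin n)) : 8 ^ (n * n) ≤ halfWeight idx e :=
  Nat.le_add_right _ _

theorem halfWeight_pos (e : Sym2 (Fin n)) : 0 < halfWeight idx e :=
  (by positivity : 0 < 8 ^ (n * n)).trans_le (halfWeight_ge e)

theorem vertexDist_adj_le {u v : Fin n} (h : H.Adj u v) :
    vertexDist idx H u v ≤ 2 * halfWeight idx s(u, v) := by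
  have := vertexDist_le (idx := idx) (.cons h .nil : H.Walk u v)
  simpa using this

/-- An edge is a shortest path: no weight is more than twice another, so a detour of two or more
edges is not shorter. -/
theorem vertexDist_adj (hH : H.Connected) {u v : Fin n} (h : H.Adj u v) :
    vertexDist idx H u v = 2 * halfWeight idx s(u, v) := by
  refine le_antisymm (vertexDist_adj_le h) ?_
  obtain ⟨p, -, hp⟩ := exists_vertexDist_eq hH idx u v
  rw [hp]
  refine Nat.mul_le_mul_left _ ?_
  cases p with
  | nil => exact absurd h (SimpleGraph.irrefl _)
  | cons h₁ p =>
    cases p with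
    | nil => simp
    | @cons _ w _ h₂ p =>
      simp only [SimpleGraph.Walk.edges_cons, natLen_cons]
      have h1 := halfWeight_le (idx := idx) s(u, v)
      have h2 := halfWeight_ge (idx := idx) s(u, w)
      rename_i x
      have h3 := halfWeight_ge (idx := idx) s(x, w)
      have h4 := halfWeight_ge (idx := idx) s(u, x)
      omega

/-- The handshake argument for a walk: a vertex is incident to an odd number of traversed edges iff
it is exactly one of the two ends. So the edges and the last vertex of a walk determine the first
vertex. -/
theorem even_countP_edges {a v : Fin n} (p : H.Walk a v) (x : Fin n) :
    Even (p.edges.countP (fun e => x ∈ e) + ((if x = a then 1 else 0) + if x = v then 1 else 0)) := by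
  induction p with
  | nil => simp [← two_mul]; split_ifs <;> decide
  | @cons a b v h p ih =>
    have hab := h.ne
    rw [SimpleGraph.Walk.edges_cons, List.countP_cons]
    simp only [Sym2.mem_iff, decide_eq_true_eq] at ih ⊢
    rw [Nat.even_iff] at ih ⊢
    by_cases h1 : x = a
    · have h2 : x ≠ b := fun h => hab (h1.symm.trans h)
      simp only [h1, hab, if_true, if_false, true_or] at ih ⊢
      omega
    · by_cases h2 : x = b
      · simp only [h2, hab.symm, if_true, if_false, or_true] at ih ⊢
        omega
      · simp only [h1, h2, if_false, or_self] at ih ⊢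
        omega

/-- A point is determined by the other end of a walk and its half-edges. -/
theorem point_eq_of_count_eq {r r' : Point n} {a b v : Fin n} (ha : r.IsEnd a) (hb : r'.IsEnd b)
    {p q : H.Walk _ v} (h : ∀ e, (halfEdges (a := a) r p).count e = (halfEdges (a := b) r' q).count e) :
    r = r' := by
  simp only [halfEdges, List.count_append] at h
  rcases r with u | e <;> rcases r' with u' | e'
  · obtain rfl : a = u := ha
    obtain rfl : b = u' := hb
    simp only [Point.half, List.count_nil] at h
    have hperm : p.edges.Perm q.edges := List.perm_iff_count.2 fun e => by have := h e; omega
    have h1 := even_countP_edges p a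
    have h2 := even_countP_edges q a
    rw [hperm.countP_eq] at h1
    rw [Nat.even_iff] at h1 h2
    by_contra hne
    have hab : a ≠ b := fun h' => hne (by rw [h'])
    simp only [hab, if_true, if_false] at h1 h2
    omega
  -- The multiplicity of an edge is odd iff the start is its middle point, which also separates
  -- vertices from middle points.
  · have := h e'
    simp only [Point.half, List.count_nil, List.count_singleton_self] at this
    omega
  · have := h e
    simp only [Point.half, List.count_nil, List.count_singleton_self] at this
    omega
  · have := h e
    simp only [Point.half, List.count_singleton_self, List.count_singleton, beq_iff_eq] at this
    by_contra hne
    have hne' : e' ≠ e := fun h' => hne (by rw [h'])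
    simp only [hne', if_false] at this
    omega

end

/-! ## The structure of good triplets -/

/-- A connected spanning subgraph with at most `n` edges, together with two points such that the
labels change along each edge of `G` by at most the length of the edge. -/
structure GoodData {n : ℕ} (G Q : SimpleGraph (Fin n)) (idx : Sym2 (Fin n) → ℕ)
    (r : Bool → Point n) : Prop where
  index : IsEdgeIndex G idx
  conn : Q.Connected
  le : Q ≤ G
  mem : ∀ i, r i ∈ points G
  ne : r false ≠ r true
  card : Q.edgeSet.ncard ≤ n
  lip : ∀ u v, G.Adj u v → natLabel idx Q (r false) (r true) v ≤
    natLabel idx Q (r false) (r true) u + 2 * halfWeight idx s(u, v)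

/-- The label of `v` is attained along the edge `uv` of `G`. -/
def Tight {n : ℕ} (G : SimpleGraph (Fin n)) (idx : Sym2 (Fin n) → ℕ) (lab : Fin n → ℕ)
    (u v : Fin n) : Prop :=
  G.Adj u v ∧ lab v = lab u + 2 * halfWeight idx s(u, v)

/-- If each vertex `v` of a finite set has an edge `s(π v, v)` in `F` along which `μ` increases,
then the set has at most as many elements as `F`. -/
theorem card_le_ncard_of_descent {n : ℕ} {F : Set (Sym2 (Fin n))} {S : Finset (Fin n)}
    {π : Fin n → Fin n} {μ : Fin n → ℕ} (hF : ∀ v ∈ S, s(π v, v) ∈ F)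
    (hμ : ∀ v ∈ S, μ (π v) < μ v) : S.card ≤ F.ncard := by
  rw [← Set.ncard_coe_finset]
  refine Set.ncard_le_ncard_of_injOn (fun v => s(π v, v)) hF ?_ (Set.toFinite _)
  intro v hv u hu h
  simp only [Sym2.eq_iff] at h
  rcases h with h | ⟨h1, h2⟩
  · exact h.2
  · have := hμ v hv
    have := hμ u hu
    rw [h1] at *
    rw [← h2] at *
    omega

namespace GoodData

variable {n : ℕ} {G Q : SimpleGraph (Fin n)} {idx : Sym2 (Fin n) → ℕ} {r : Bool → Point n}

theorem conn_sup (h : GoodData G Q idx r) : G.Connected := h.conn.mono h.le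

/-- Uniqueness applied to a path to `v` and a path to `u` prolonged by `uv`. The comparison takes
place in `G`, since `uv` is not yet known to be an edge of `Q`. -/
theorem halfEdges_count_eq (h : GoodData G Q idx r) {i j : Bool} {a b u v : Fin n}
    {p : Q.Walk a v} {q : Q.Walk b u} (hp : p.IsPath) (hq : q.IsPath) (huv : G.Adj u v)
    (heq : natLen idx (halfEdges (r i) p) =
      natLen idx (halfEdges (r j) q) + 2 * halfWeight idx s(u, v)) (e : Sym2 (Fin n)) :
    (halfEdges (r i) (p.mapLe h.le)).count e =
      (halfEdges (r j) ((q.mapLe h.le).concat huv)).count e := by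
  have hc : (halfEdges (r i) (p.mapLe h.le)) = halfEdges (r i) p := by
    simp [halfEdges]
  have hc' : ∀ e, (halfEdges (r j) ((q.mapLe h.le).concat huv)).count e =
      (halfEdges (r j) q).count e + 2 * [s(u, v)].count e := by
    intro e
    simp only [halfEdges, List.count_append, SimpleGraph.Walk.edges_concat,
      SimpleGraph.Walk.edges_mapLe_eq_edges, List.concat_eq_append]
    ring
  refine h.index.count_eq_of_natLen_eq (halfEdges_mem (h.mem i) le_rfl _) (fun e => ?_)
    (halfEdges_mem (h.mem j) le_rfl _) (fun e => ?_) ?_ e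
  · rw [hc]
    exact (count_halfEdges_le hp e).trans (by norm_num)
  · rw [hc']
    have := count_halfEdges_le (r := r j) hq e
    have : [s(u, v)].count e ≤ 1 := List.count_le_length
    omega
  · rw [hc, heq, natLen_halfEdges, natLen_halfEdges]
    simp
    ring

/-! ### Tight edges lie in the pseudotree -/

theorem natDist_ne (h : GoodData G Q idx r) (v : Fin n) :
    natDist idx Q (r false) v ≠ natDist idx Q (r true) v := by
  intro heq
  obtain ⟨a, ha, p, hp, h1⟩ := exists_natDist_eq h.conn idx (r false) v
  obtain ⟨b, hb, q, hq, h2⟩ := exists_natDist_eq h.conn idx (r true) v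
  refine h.ne (point_eq_of_count_eq ha hb (p := p) (q := q) ?_)
  refine h.index.count_eq_of_natLen_eq (halfEdges_mem (h.mem _) h.le p)
    (fun e => (count_halfEdges_le hp e).trans (by norm_num)) (halfEdges_mem (h.mem _) h.le q)
    (fun e => (count_halfEdges_le hq e).trans (by norm_num)) (by omega)

theorem exists_far (r : Bool → Point n) (v : Fin n) :
    ∃ i, natLabel idx Q (r false) (r true) v = natDist idx Q (r i) v := by
  rcases max_choice (natDist idx Q (r false) v) (natDist idx Q (r true) v) with h | h
  · exact ⟨false, h⟩
  · exact ⟨true, h⟩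

/-- The path realizing the label of `u`, prolonged by `uv`, has the length of `p`. So the two have
the same half-edges and the same starting point, and the two halves of `uv` must occur in `p`. -/
theorem tight_mem_edges (h : GoodData G Q idx r) {u v : Fin n}
    (ht : Tight G idx (natLabel idx Q (r false) (r true)) u v) {i : Bool} {a : Fin n}
    (ha : (r i).IsEnd a) {p : Q.Walk a v} (hp : p.IsPath)
    (hv : natLabel idx Q (r false) (r true) v = natLen idx (halfEdges (r i) p)) :
    s(u, v) ∈ p.edges := by
  obtain ⟨huv, ht⟩ := ht
  obtain ⟨j, hj⟩ := exists_far (idx := idx) (Q := Q) r u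
  obtain ⟨b, hb, q, hq, h2⟩ := exists_natDist_eq h.conn idx (r j) u
  have hc := h.halfEdges_count_eq (i := i) (j := j) hp hq huv (by omega)
  have hr := point_eq_of_count_eq ha hb hc
  have := hc s(u, v)
  rw [hr] at this
  simp only [halfEdges, List.count_append, SimpleGraph.Walk.edges_concat,
    SimpleGraph.Walk.edges_mapLe_eq_edges, List.concat_eq_append, List.count_singleton_self] at this
  exact List.count_pos_iff.1 (by omega)

theorem tight_adj (h : GoodData G Q idx r) {u v : Fin n}
    (ht : Tight G idx (natLabel idx Q (r false) (r true)) u v) : Q.Adj u v := by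
  obtain ⟨i, hi⟩ := exists_far (idx := idx) (Q := Q) r v
  obtain ⟨a, ha, p, hp, h1⟩ := exists_natDist_eq h.conn idx (r i) v
  exact p.adj_of_mem_edges (h.tight_mem_edges ht ha hp (hi.trans h1))

theorem eq_of_mem_edges_isPath {H : SimpleGraph (Fin n)} {a v u w : Fin n} {p : H.Walk v a}
    (hp : p.IsPath) (hu : s(u, v) ∈ p.edges) (hw : s(w, v) ∈ p.edges) : u = w := by
  cases p with
  | nil => simp at hu
  | @cons _ b _ hb p =>
    rw [SimpleGraph.Walk.cons_isPath_iff] at hp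
    have : ∀ x, s(x, v) ∈ (SimpleGraph.Walk.cons hb p).edges → x = b := by
      intro x hx
      rw [SimpleGraph.Walk.edges_cons, List.mem_cons] at hx
      rcases hx with hx | hx
      · rw [Sym2.eq_swap, Sym2.congr_right] at hx
        exact hx
      · exact absurd (p.snd_mem_support_of_mem_edges hx) hp.2
    rw [this u hu, this w hw]

/-- Both edges lie on one path ending at `v`, and a path has only one edge at its end. -/
theorem tight_unique (h : GoodData G Q idx r) {u v w : Fin n}
    (hu : Tight G idx (natLabel idx Q (r false) (r true)) u v)
    (hw : Tight G idx (natLabel idx Q (r false) (r true)) w v) : u = w := by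
  obtain ⟨i, hi⟩ := exists_far (idx := idx) (Q := Q) r v
  obtain ⟨a, ha, p, hp, h1⟩ := exists_natDist_eq h.conn idx (r i) v
  have h2 := h.tight_mem_edges hu ha hp (hi.trans h1)
  have h3 := h.tight_mem_edges hw ha hp (hi.trans h1)
  exact eq_of_mem_edges_isPath hp.reverse (by simpa using h2) (by simpa using h3)

theorem natDist_adj_le (h : GoodData G Q idx r) (i : Bool) {u v : Fin n} (huv : Q.Adj u v) :
    natDist idx Q (r i) v ≤ natDist idx Q (r i) u + 2 * halfWeight idx s(u, v) := by
  obtain ⟨a, ha, p, hp, h1⟩ := exists_natDist_eq h.conn idx (r i) u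
  rw [h1]
  refine (natDist_le ha (p.concat huv)).trans ?_
  rw [natLen_halfEdges, natLen_halfEdges]
  simp
  omega

theorem exists_pred (h : GoodData G Q idx r) (i : Bool) (v : Fin n) : (r i).IsEnd v ∨
    ∃ u, Q.Adj u v ∧ natDist idx Q (r i) v = natDist idx Q (r i) u + 2 * halfWeight idx s(u, v) := by
  obtain ⟨a, ha, p, hp, h1⟩ := exists_natDist_eq h.conn idx (r i) v
  by_cases hnil : p.Nil
  · exact .inl (hnil.eq ▸ ha)
  · right
    refine ⟨p.penultimate, p.adj_penultimate hnil,
      le_antisymm (h.natDist_adj_le i (p.adj_penultimate hnil)) ?_⟩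
    have h2 := natDist_le (idx := idx) ha p.dropLast
    have h3 : p.edges = p.dropLast.edges ++ [s(p.penultimate, v)] := by
      have := congrArg SimpleGraph.Walk.edges (p.concat_dropLast (p.adj_penultimate hnil))
      rw [SimpleGraph.Walk.edges_concat, List.concat_eq_append] at this
      exact this.symm
    rw [h1, natLen_halfEdges, h3]
    rw [natLen_halfEdges] at h2
    simp only [natLen_append, natLen_cons, natLen_nil]
    omega

/-! ### Counting crossing edges, roots and slack edges -/

open Classical in
/-- The ends of the two points. -/
noncomputable def ends (r : Bool → Point n) : Finset (Fin n) :=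
  {(r false).code.1, (r false).code.2, (r true).code.1, (r true).code.2}

theorem card_ends_le (r : Bool → Point n) : (ends r).card ≤ 4 := Finset.card_le_four

theorem mem_ends {i : Bool} {v : Fin n} (h : (r i).IsEnd v) : v ∈ ends r := by
  rw [Point.isEnd_iff] at h
  cases i <;> rcases h with h | h <;> simp [ends, h]

/-- Whether the second point is nearer than the first one. -/
noncomputable def near (idx : Sym2 (Fin n) → ℕ) (Q : SimpleGraph (Fin n)) (r : Bool → Point n)
    (v : Fin n) : Bool :=
  decide (natDist idx Q (r true) v < natDist idx Q (r false) v)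

theorem near_eq_iff (h : GoodData G Q idx r) {v : Fin n} {i : Bool} :
    near idx Q r v = i ↔ natDist idx Q (r i) v < natDist idx Q (r (!i)) v := by
  have := h.natDist_ne v
  cases i
  · simp [near]; omega
  · simp [near]

theorem near_lt (h : GoodData G Q idx r) (v : Fin n) :
    natDist idx Q (r (near idx Q r v)) v < natDist idx Q (r (!near idx Q r v)) v :=
  h.near_eq_iff.1 rfl

theorem natLabel_eq (h : GoodData G Q idx r) (v : Fin n) :
    natLabel idx Q (r false) (r true) v = natDist idx Q (r (!near idx Q r v)) v := by
  have := h.near_lt v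
  rw [natLabel]
  cases hv : near idx Q r v <;> rw [hv] at this <;> simp only [Bool.not_false, Bool.not_true] at *
  · exact max_eq_right this.le
  · exact max_eq_left this.le

/-- The edges between the two cells. -/
def crossing (idx : Sym2 (Fin n) → ℕ) (Q : SimpleGraph (Fin n)) (r : Bool → Point n) :
    Set (Sym2 (Fin n)) :=
  {e ∈ Q.edgeSet | ∃ u v, e = s(u, v) ∧ near idx Q r u ≠ near idx Q r v}

/-- On the way to the nearer point, the distance to that point drops by the full edge length, while
the distance to the other one drops by at most as much. So the predecessor is in the same cell, and
all vertices but the at most 4 ends use up different non-crossing edges, of at most n edges in all.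
-/
theorem ncard_crossing_le (h : GoodData G Q idx r) : (crossing idx Q r).ncard ≤ 4 := by
  have hpred : ∀ v, ∃ u, v ∉ ends r → Q.Adj u v ∧ natDist idx Q (r (near idx Q r v)) v =
      natDist idx Q (r (near idx Q r v)) u + 2 * halfWeight idx s(u, v) := by
    intro v
    by_cases hv : v ∈ ends r
    · exact ⟨v, fun h => absurd hv h⟩
    · rcases h.exists_pred (near idx Q r v) v with h' | ⟨u, hu⟩
      · exact absurd (mem_ends h') hv
      · exact ⟨u, fun _ => hu⟩
  choose π hπ using hpred
  have hnear : ∀ v ∉ ends r, near idx Q r (π v) = near idx Q r v := by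
    intro v hv
    obtain ⟨h1, h2⟩ := hπ v hv
    rw [h.near_eq_iff]
    have := h.near_lt v
    have := h.natDist_adj_le (!near idx Q r v) h1
    omega
  have key := card_le_ncard_of_descent (F := Q.edgeSet \ crossing idx Q r) (S := (ends r)ᶜ) (π := π)
    (μ := fun v => natDist idx Q (r (near idx Q r v)) v) ?_ ?_
  · rw [Finset.card_compl, Fintype.card_fin] at key
    have h1 := card_ends_le r
    have h2 := Set.ncard_sdiff_add_ncard_of_subset (s := crossing idx Q r) (t := Q.edgeSet)
      (fun e he => he.1) (Set.toFinite _)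
    have h3 := h.card
    omega
  · intro v hv
    rw [Finset.mem_compl] at hv
    refine ⟨(hπ v hv).1, ?_⟩
    rintro ⟨-, a, b, hab, hne⟩
    rcases Sym2.eq_iff.1 hab with ⟨rfl, rfl⟩ | ⟨rfl, rfl⟩
    · exact hne (hnear _ hv)
    · exact hne (hnear _ hv).symm
  · intro v hv
    rw [Finset.mem_compl] at hv
    have h1 := (hπ v hv).2
    have h2 := halfWeight_pos (idx := idx) s(π v, v)
    simp only [hnear v hv]
    omega

open Classical in
/-- The vertices whose label is not attained along an edge. -/
noncomputable def roots (G Q : SimpleGraph (Fin n)) (idx : Sym2 (Fin n) → ℕ) (r : Bool → Point n) :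
    Finset (Fin n) :=
  {v | ¬ ∃ u, Tight G idx (natLabel idx Q (r false) (r true)) u v}

theorem mem_roots {v : Fin n} : v ∈ roots G Q idx r ↔
    ¬ ∃ u, Tight G idx (natLabel idx Q (r false) (r true)) u v := by
  simp [roots]

/-- The label is the distance from the farther point. If the predecessor on a path from that point
is in the same cell, its label is measured from the same point and the edge is tight. So a root is
one of 4 ends or one of the 2·4 ends of crossing edges. -/
theorem card_roots_le (h : GoodData G Q idx r) : (roots G Q idx r).card ≤ 12 := by
  classical
  have hsub : roots G Q idx r ⊆
      ends r ∪ (Set.toFinite (crossing idx Q r)).toFinset.biUnion fun e => e.toFinset := by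
    intro v hv
    rw [mem_roots] at hv
    rw [Finset.mem_union]
    rcases h.exists_pred (!near idx Q r v) v with h' | ⟨u, hu, heq⟩
    · exact .inl (mem_ends h')
    · right
      rw [Finset.mem_biUnion]
      refine ⟨s(u, v), ?_, by simp⟩
      rw [Set.Finite.mem_toFinset]
      refine ⟨hu, u, v, rfl, fun hne => hv ⟨u, h.le hu, ?_⟩⟩
      rw [h.natLabel_eq, h.natLabel_eq, hne, heq]
  refine (Finset.card_le_card hsub).trans ((Finset.card_union_le _ _).trans ?_)
  have h1 := card_ends_le r
  have h2 := Finset.card_biUnion_le_card_mul (Set.toFinite (crossing idx Q r)).toFinset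
    (fun e => e.toFinset) 2 (fun e _ => by
      induction e with
      | _ a b => rw [Sym2.toFinset_mk_eq]; exact Finset.card_le_two)
  rw [← Set.ncard_eq_toFinset_card _ (Set.toFinite _)] at h2
  have h3 := h.ncard_crossing_le
  omega

/-- The edges of `Q` along which no label is attained. -/
def slack (G Q : SimpleGraph (Fin n)) (idx : Sym2 (Fin n) → ℕ) (r : Bool → Point n) :
    Set (Sym2 (Fin n)) :=
  {e ∈ Q.edgeSet | ¬ ∃ u v, e = s(u, v) ∧ Tight G idx (natLabel idx Q (r false) (r true)) u v}

/-- The tight edges entering the at least n - 12 other vertices are distinct, as labels increase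
along them. -/
theorem ncard_slack_le (h : GoodData G Q idx r) : (slack G Q idx r).ncard ≤ 12 := by
  have hpred : ∀ v, ∃ u, v ∉ roots G Q idx r →
      Tight G idx (natLabel idx Q (r false) (r true)) u v := by
    intro v
    by_cases hv : v ∈ roots G Q idx r
    · exact ⟨v, fun h => absurd hv h⟩
    · obtain ⟨u, hu⟩ := not_not.1 (mt mem_roots.2 hv)
      exact ⟨u, fun _ => hu⟩
  choose π hπ using hpred
  have key := card_le_ncard_of_descent (F := Q.edgeSet \ slack G Q idx r) (S := (roots G Q idx r)ᶜ)
    (π := π) (μ := natLabel idx Q (r false) (r true)) ?_ ?_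
  · rw [Finset.card_compl, Fintype.card_fin] at key
    have h1 := h.card_roots_le
    have h2 := Set.ncard_sdiff_add_ncard_of_subset (s := slack G Q idx r) (t := Q.edgeSet)
      (fun e he => he.1) (Set.toFinite _)
    have h3 := h.card
    omega
  · intro v hv
    have ht := hπ v (Finset.mem_compl.1 hv)
    exact ⟨h.tight_adj ht, fun hs => hs.2 ⟨_, _, rfl, ht⟩⟩
  · intro v hv
    have ht := hπ v (Finset.mem_compl.1 hv)
    have h2 := halfWeight_pos (idx := idx) s(π v, v)
    rw [ht.2]
    omega

/-! ### Labels from roots and chains of shortest paths -/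

theorem natLabel_le (h : GoodData G Q idx r) (x y : Fin n) :
    natLabel idx Q (r false) (r true) y ≤
      natLabel idx Q (r false) (r true) x + vertexDist idx G x y := by
  obtain ⟨p, -, hp⟩ := exists_vertexDist_eq h.conn_sup idx x y
  rw [hp]
  clear hp
  induction p with
  | nil => simp
  | @cons x x' y hx p ih =>
    have := h.lip _ _ hx
    simp only [SimpleGraph.Walk.edges_cons, natLen_cons]
    omega

/-- Descend along tight edges. The increments add up to at least the distance in `G`, and the
Lipschitz bound gives the reverse inequality. -/
theorem exists_root (h : GoodData G Q idx r) (v : Fin n) : ∃ ρ ∈ roots G Q idx r,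
    natLabel idx Q (r false) (r true) v =
      natLabel idx Q (r false) (r true) ρ + vertexDist idx G ρ v := by
  induction hk : natLabel idx Q (r false) (r true) v using Nat.strong_induction_on generalizing v with
  | _ k ih =>
    by_cases hv : v ∈ roots G Q idx r
    · exact ⟨v, hv, by rw [vertexDist_self, hk, add_zero]⟩
    · obtain ⟨u, hu⟩ := not_not.1 (mt mem_roots.2 hv)
      have h2 := halfWeight_pos (idx := idx) s(u, v)
      have hu2 := hu.2
      obtain ⟨ρ, hρ, h3⟩ := ih _ (by omega) u rfl
      refine ⟨ρ, hρ, ?_⟩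
      have h4 := h.natLabel_le ρ v
      have h5 := vertexDist_triangle (idx := idx) h.conn_sup ρ u v
      have h6 := vertexDist_adj_le (idx := idx) hu.1
      omega

/-- `w` is the length of a chain of `k` shortest paths of `G` from `x` to `y`. -/
def IsChainLength (idx : Sym2 (Fin n) → ℕ) (G : SimpleGraph (Fin n)) (k : ℕ) (x y : Fin n)
    (w : ℕ) : Prop :=
  ∃ z : ℕ → Fin n, z 0 = x ∧ z k = y ∧
    w = ∑ j ∈ Finset.range k, vertexDist idx G (z j) (z (j + 1))

theorem IsChainLength.cons {k : ℕ} {x y : Fin n} {w : ℕ} (h : IsChainLength idx G k x y w)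
    (x' : Fin n) : IsChainLength idx G (k + 1) x' y (vertexDist idx G x' x + w) := by
  obtain ⟨z, h0, hk, hw⟩ := h
  refine ⟨fun j => Nat.casesOn j x' z, rfl, hk, ?_⟩
  rw [Finset.sum_range_succ', hw, add_comm]
  simp [h0]

theorem IsChainLength.mono {k l : ℕ} {x y : Fin n} {w : ℕ} (h : IsChainLength idx G k x y w)
    (hkl : k ≤ l) : IsChainLength idx G l x y w := by
  induction l, hkl using Nat.le_induction with
  | base => exact h
  | succ l _ ih =>
    have := ih.cons x
    rwa [vertexDist_self, zero_add] at this

-- Simultaneous induction. In the first claim the path starts with a possibly trivial descending run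
-- to `z`; in the second it does not start by descending, so its first run ascends. After an
-- ascending edge the path cannot descend, since the only tight edge into the vertex reached has
-- just been used and the path is simple. A slack edge, the descent after it and an ascent are the
-- three pieces per slack edge.
open Classical in
theorem exists_chain (h : GoodData G Q idx r) {x y : Fin n} (p : Q.Walk x y) (hp : p.IsPath) :
    (∃ z w, natLabel idx Q (r false) (r true) x =
        natLabel idx Q (r false) (r true) z + vertexDist idx G x z ∧
      IsChainLength idx G (3 * p.edges.countP (· ∈ slack G Q idx r) + 1) z y w ∧
      2 * natLen idx p.edges = vertexDist idx G x z + w) ∧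
    ((∀ x', Tight G idx (natLabel idx Q (r false) (r true)) x' x → s(x', x) ∉ p.edges) →
      ∃ z w, natLabel idx Q (r false) (r true) z =
        natLabel idx Q (r false) (r true) x + vertexDist idx G x z ∧
      IsChainLength idx G (3 * p.edges.countP (· ∈ slack G Q idx r)) z y w ∧
      2 * natLen idx p.edges = vertexDist idx G x z + w) := by
  induction p with
  | @nil x =>
    have h0 : IsChainLength idx G 0 x x 0 := ⟨fun _ => x, rfl, rfl, by simp⟩
    exact ⟨⟨x, 0, by rw [vertexDist_self, add_zero], h0.mono (by omega),
      by simp [vertexDist_self]⟩, fun _ => ⟨x, 0, by rw [vertexDist_self, add_zero],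
      by simpa using h0, by simp [vertexDist_self]⟩⟩
  | @cons x x' y hx p ih =>
    rw [SimpleGraph.Walk.cons_isPath_iff] at hp
    obtain ⟨hA, hB⟩ := ih hp.1
    have hG := h.conn_sup
    have hadj := vertexDist_adj (idx := idx) hG (h.le hx)
    simp only [SimpleGraph.Walk.edges_cons, natLen_cons, List.countP_cons, decide_eq_true_eq]
    by_cases hs : s(x, x') ∈ slack G Q idx r
    · simp only [hs, if_true]
      obtain ⟨z, w, -, h2, h3⟩ := hA
      have h4 := (h2.cons x').cons x
      have h5 : 2 * (halfWeight idx s(x, x') + natLen idx p.edges) =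
          vertexDist idx G x x' + (vertexDist idx G x' z + w) := by omega
      rw [← h5] at h4
      exact ⟨⟨x, _, by rw [vertexDist_self, add_zero], h4.mono (by omega),
          by rw [vertexDist_self, zero_add]⟩,
        fun _ => ⟨x, _, by rw [vertexDist_self, add_zero], h4.mono (by omega),
          by rw [vertexDist_self, zero_add]⟩⟩
    · simp only [hs, if_false, add_zero]
      have : ∃ u v, s(x, x') = s(u, v) ∧ Tight G idx (natLabel idx Q (r false) (r true)) u v := by
        by_contra hc
        exact hs ⟨hx, hc⟩
      obtain ⟨u, v, huv, ht⟩ := this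
      rcases Sym2.eq_iff.1 huv with ⟨rfl, rfl⟩ | ⟨rfl, rfl⟩
      -- Ascending edge: the tight edge into `x'` comes from `x`, which the rest of the path avoids.
      · obtain ⟨z, w, h1, h2, h3⟩ := hB fun w hw hmem => by
          obtain rfl := h.tight_unique hw ht
          exact hp.2 (p.fst_mem_support_of_mem_edges hmem)
        have h4 := h.natLabel_le x z
        have h5 := vertexDist_triangle (idx := idx) hG x x' z
        have h6 := ht.2
        have hB' : ∃ z w, natLabel idx Q (r false) (r true) z =
            natLabel idx Q (r false) (r true) x + vertexDist idx G x z ∧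
            IsChainLength idx G (3 * p.edges.countP (· ∈ slack G Q idx r)) z y w ∧
            2 * (halfWeight idx s(x, x') + natLen idx p.edges) = vertexDist idx G x z + w :=
          ⟨z, w, by omega, h2, by omega⟩
        refine ⟨?_, fun _ => hB'⟩
        obtain ⟨z, w, -, h2, h3⟩ := hB'
        exact ⟨x, _, by rw [vertexDist_self, add_zero], h2.cons x,
          by rw [vertexDist_self, zero_add, h3]⟩
      -- Descending edge: it prolongs the descending run, and the second claim is vacuous.
      · obtain ⟨z, w, h1, h2, h3⟩ := hA
        have h4 := h.natLabel_le z x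
        have h5 := vertexDist_triangle (idx := idx) hG x x' z
        have h6 := ht.2
        have h7 := vertexDist_comm (idx := idx) hG z x
        rw [Sym2.eq_swap] at h6
        exact ⟨⟨z, w, by omega, h2, by omega⟩,
          fun hn => absurd (List.mem_cons.2 (.inl Sym2.eq_swap)) (hn x' ht)⟩

open Classical in
theorem exists_root_chain (h : GoodData G Q idx r) (v : Fin n) :
    ∃ i a w, IsChainLength idx G 38 a v w ∧
      natLabel idx Q (r false) (r true) v = natLen idx (r i).half + w := by
  obtain ⟨i, hi⟩ := exists_far (idx := idx) (Q := Q) r v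
  obtain ⟨a, ha, p, hp, h1⟩ := exists_natDist_eq h.conn idx (r i) v
  obtain ⟨⟨z, w, -, h3, h4⟩, -⟩ := h.exists_chain p hp
  -- The first descending run and 3·12 + 1 further pieces make 38.
  refine ⟨i, a, _, (h3.cons a).mono ?_, by rw [hi, h1, natLen_halfEdges, h4]⟩
  have : p.edges.countP (· ∈ slack G Q idx r) ≤ (slack G Q idx r).ncard := by
    rw [List.countP_eq_length_filter,
      ← List.toFinset_card_of_nodup (hp.isTrail.edges_nodup.filter _), ← Set.ncard_coe_finset]
    refine Set.ncard_le_ncard (fun e he => ?_) (Set.toFinite _)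
    simpa using (List.mem_filter.1 (List.mem_toFinset.1 he)).2
  have := h.ncard_slack_le
  omega

end GoodData

/-! ## Candidates -/

/-- The minimum of `f 0, …, f k`. -/
def minUpTo (f : ℕ → ℕ) : ℕ → ℕ
  | 0 => f 0
  | k + 1 => min (minUpTo f k) (f (k + 1))

theorem minUpTo_le (f : ℕ → ℕ) {j k : ℕ} (h : j ≤ k) : minUpTo f k ≤ f j := by
  induction k with
  | zero => rw [Nat.le_zero.1 h]; exact le_rfl
  | succ k ih =>
    rcases Nat.le_succ_iff.1 h with h | rfl
    · exact (min_le_left _ _).trans (ih h)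
    · exact min_le_right _ _

theorem exists_minUpTo_eq (f : ℕ → ℕ) (k : ℕ) : ∃ j ≤ k, minUpTo f k = f j := by
  induction k with
  | zero => exact ⟨0, le_rfl, rfl⟩
  | succ k ih =>
    obtain ⟨j, hj, h⟩ := ih
    rcases min_choice (minUpTo f k) (f (k + 1)) with h' | h'
    · exact ⟨j, by omega, h'.trans h⟩
    · exact ⟨k + 1, le_rfl, h'⟩

section
variable {n : ℕ}

/-- The label of the `k`-th guessed root. -/
def guessValue (D : Fin n → Fin n → ℕ) (o : Bool → ℕ) (g : ℕ → Fin n) (k : ℕ) : ℕ :=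
  (if (g (40 * k) : ℕ) = 0 then o false else o true) +
    ∑ j ∈ Finset.range 38, D (g (40 * k + 1 + j)) (g (40 * k + 2 + j))

/-- The labels determined by the guessed roots. -/
def guessLabel (D : Fin n → Fin n → ℕ) (o : Bool → ℕ) (g : ℕ → Fin n) (v : Fin n) : ℕ :=
  minUpTo (fun k => guessValue D o g k + D (g (40 * k + 39)) v) 11

/-- The subgraph of the edges of `G` that are tight for the guessed labels or are guessed. -/
def guessGraph (G : SimpleGraph (Fin n)) (idx : Sym2 (Fin n) → ℕ) (D : Fin n → Fin n → ℕ)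
    (o : Bool → ℕ) (g : ℕ → Fin n) : SimpleGraph (Fin n) where
  Adj i j := G.Adj i j ∧
    (guessLabel D o g j = guessLabel D o g i + 2 * halfWeight idx s(i, j) ∨
      guessLabel D o g i = guessLabel D o g j + 2 * halfWeight idx s(i, j) ∨
      ∃ k < 12, (g (480 + 2 * k) = i ∧ g (481 + 2 * k) = j) ∨
        (g (480 + 2 * k) = j ∧ g (481 + 2 * k) = i))
  symm := ⟨by
    rintro i j ⟨h1, h2⟩
    rw [Sym2.eq_swap]
    refine ⟨h1.symm, ?_⟩
    rcases h2 with h2 | h2 | ⟨k, hk, h2⟩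
    · exact .inr (.inl h2)
    · exact .inl h2
    · exact .inr (.inr ⟨k, hk, h2.symm⟩)⟩
  loopless := ⟨fun i h => G.irrefl h.1⟩

theorem guessGraph_le (G : SimpleGraph (Fin n)) (idx : Sym2 (Fin n) → ℕ) (D : Fin n → Fin n → ℕ)
    (o : Bool → ℕ) (g : ℕ → Fin n) : guessGraph G idx D o g ≤ G := fun _ _ h => h.1

theorem exists_enum {α : Type*} {S : Finset α} {k : ℕ} (hk : S.card ≤ k) {a : α} (ha : a ∈ S) :
    ∃ f : ℕ → α, (∀ i, f i ∈ S) ∧ ∀ x ∈ S, ∃ i < k, f i = x := by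
  let e := S.equivFin
  refine ⟨fun i => if h : i < S.card then (e.symm ⟨i, h⟩ : α) else a, fun i => ?_, fun x hx => ?_⟩
  · dsimp only
    split
    · exact Subtype.coe_prop _
    · exact ha
  · refine ⟨e ⟨x, hx⟩, (e ⟨x, hx⟩).2.trans_le hk, ?_⟩
    simp

/-- A guessed vertex can encode a bit only if there are two vertices. -/
theorem two_le_of_points {G : SimpleGraph (Fin n)} {r₁ r₂ : Point n} (h₁ : r₁ ∈ points G)
    (h₂ : r₂ ∈ points G) (h : r₁ ≠ r₂) : 2 ≤ n := by
  by_contra hn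
  have : Subsingleton (Fin n) := ⟨fun a b => Fin.ext (by omega)⟩
  rcases r₁ with u | e
  · rcases r₂ with v | f
    · exact h (by rw [Subsingleton.elim u v])
    · exact Point.code_inr_ne h₂ (Subsingleton.elim _ _)
  · exact Point.code_inr_ne h₁ (Subsingleton.elim _ _)

theorem GoodData.exists_guess {G Q : SimpleGraph (Fin n)} {idx : Sym2 (Fin n) → ℕ}
    {r : Bool → Point n} (h : GoodData G Q idx r) (y : Bool → Fin n) :
    ∃ g : ℕ → Fin n, g 504 = y false ∧ g 505 = y true ∧
      guessGraph G idx (vertexDist idx G) (fun i => natLen idx (r i).half) g = Q := by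
  classical
  have hn := two_le_of_points (h.mem false) (h.mem true) h.ne
  obtain ⟨ρ₀, hρ₀, -⟩ := h.exists_root ⟨0, by omega⟩
  obtain ⟨ρ, hρ, hρ'⟩ := exists_enum h.card_roots_le hρ₀
  choose i a w hc hw using fun k => h.exists_root_chain (ρ k)
  choose z hz0 hz38 hzw using hc
  have hpairs : ∃ f : ℕ → Fin n × Fin n, (∀ k, s((f k).1, (f k).2) ∈ slack G Q idx r ∨
      (f k).1 = (f k).2) ∧ ∀ e ∈ slack G Q idx r, ∃ k < 12, s((f k).1, (f k).2) = e := by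
    by_cases he : ∃ e, e ∈ slack G Q idx r
    · obtain ⟨e, he⟩ := he
      have hcard := h.ncard_slack_le
      rw [Set.ncard_eq_toFinset_card _ (Set.toFinite _)] at hcard
      obtain ⟨f, hf, hf'⟩ := exists_enum hcard (a := e) (by simpa using he)
      refine ⟨fun k => ((f k).inf, (f k).sup), fun k => .inl ?_, fun e he => ?_⟩
      · rw [mk_inf_sup]
        simpa using hf k
      · obtain ⟨k, hk, hke⟩ := hf' e (by simpa using he)
        exact ⟨k, hk, by rw [mk_inf_sup, hke]⟩
    -- Without slack edges, guess loops, which never are edges of `G`.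
    · exact ⟨fun _ => (ρ₀, ρ₀), fun _ => .inr rfl, fun e he' => absurd ⟨e, he'⟩ he⟩
  obtain ⟨f, hf, hf'⟩ := hpairs
  -- Layout: twelve blocks of 40 entries, each a bit for the starting point and the 39 vertices of
  -- the chain, with the root last; then twelve pairs for the slack edges; then the two witnesses.
  let g : ℕ → Fin n := fun m =>
    if m < 480 then
      if m % 40 = 0 then bif i (m / 40) then ⟨1, by omega⟩ else ⟨0, by omega⟩
      else z (m / 40) (m % 40 - 1)
    else if m < 504 then
      if m % 2 = 0 then (f ((m - 480) / 2)).1 else (f ((m - 480) / 2)).2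
    else if m = 504 then y false else y true
  have hg1 : ∀ k < 12, g (40 * k) = bif i k then ⟨1, by omega⟩ else ⟨0, by omega⟩ := by
    intro k hk
    simp only [g]
    rw [if_pos (by omega), if_pos (by omega), show 40 * k / 40 = k by omega]
  have hg2 : ∀ k < 12, ∀ m, ∀ j < 39, m = 40 * k + 1 + j → g m = z k j := by
    intro k hk m j hj hm
    simp only [g]
    rw [if_pos (by omega), if_neg (by omega), show m / 40 = k by omega,
      show m % 40 - 1 = j by omega]
  have hg3 : ∀ k < 12, g (480 + 2 * k) = (f k).1 := by
    intro k hk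
    simp only [g]
    rw [if_neg (by omega), if_pos (by omega), if_pos (by omega),
      show (480 + 2 * k - 480) / 2 = k by omega]
  have hg4 : ∀ k < 12, g (481 + 2 * k) = (f k).2 := by
    intro k hk
    simp only [g]
    rw [if_neg (by omega), if_pos (by omega), if_neg (by omega),
      show (481 + 2 * k - 480) / 2 = k by omega]
  have hg5 : g 504 = y false := by simp [g]
  have hg6 : g 505 = y true := by simp [g]
  clear_value g
  have hval : ∀ k < 12, guessValue (vertexDist idx G) (fun i => natLen idx (r i).half) g k =
      natLabel idx Q (r false) (r true) (ρ k) := by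
    intro k hk
    rw [guessValue, hw, hg1 k hk, hzw]
    refine congrArg₂ (· + ·) ?_ ?_
    · cases i k <;> simp
    · refine Finset.sum_congr rfl fun j hj => ?_
      have := Finset.mem_range.1 hj
      rw [hg2 k hk _ j (by omega) rfl, hg2 k hk _ (j + 1) (by omega) (by omega)]
  have hlab : ∀ v, guessLabel (vertexDist idx G) (fun i => natLen idx (r i).half) g v =
      natLabel idx Q (r false) (r true) v := by
    intro v
    -- The root of `v` is in the list, which bounds the minimum from above; every listed vertex has
    -- its correct label, so the Lipschitz bound gives the other direction.
    apply le_antisymm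
    · obtain ⟨x, hx, hv⟩ := h.exists_root v
      obtain ⟨k, hk, rfl⟩ := hρ' x hx
      rw [hv]
      refine (minUpTo_le _ (show k ≤ 11 by omega)).trans ?_
      rw [hval k hk, hg2 k hk _ 38 (by omega) (by omega), hz38]
    · obtain ⟨k, hk, heq⟩ := exists_minUpTo_eq (fun k => guessValue (vertexDist idx G)
        (fun i => natLen idx (r i).half) g k + vertexDist idx G (g (40 * k + 39)) v) 11
      rw [guessLabel, heq, hval k (by omega), hg2 k (by omega) _ 38 (by omega) (by omega), hz38]
      exact h.natLabel_le _ _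
  refine ⟨g, hg5, hg6, ?_⟩
  ext u v
  simp only [guessGraph, hlab]
  constructor
  · rintro ⟨hG, ht | ht | ⟨k, hk, hp⟩⟩
    · exact h.tight_adj ⟨hG, ht⟩
    · rw [Sym2.eq_swap] at ht
      exact (h.tight_adj ⟨hG.symm, ht⟩).symm
    · rw [hg3 k hk, hg4 k hk] at hp
      have hne := hG.ne
      have : s((f k).1, (f k).2) = s(u, v) := Sym2.eq_iff.2 hp
      rcases hf k with h' | h'
      · rw [this] at h'
        exact h'.1
      · rcases hp with ⟨h1, h2⟩ | ⟨h1, h2⟩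
        · exact absurd (h1.symm.trans (h'.trans h2)) hne
        · exact absurd (h2.symm.trans (h'.symm.trans h1)) hne
  · intro hQ
    refine ⟨h.le hQ, ?_⟩
    by_cases hs : s(u, v) ∈ slack G Q idx r
    · obtain ⟨k, hk, hke⟩ := hf' _ hs
      refine .inr (.inr ⟨k, hk, ?_⟩)
      rw [hg3 k hk, hg4 k hk]
      exact Sym2.eq_iff.1 hke
    · have : ∃ a b, s(u, v) = s(a, b) ∧ Tight G idx (natLabel idx Q (r false) (r true)) a b := by
        by_contra hc
        exact hs ⟨hQ, hc⟩
      obtain ⟨a, b, hab, ht⟩ := this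
      rcases Sym2.eq_iff.1 hab with ⟨rfl, rfl⟩ | ⟨rfl, rfl⟩
      · exact .inl ht.2
      · rw [Sym2.eq_swap]
        exact .inr (.inl ht.2)

/-! ## All-pairs shortest paths -/

/-- One round of the min-plus squaring of a matrix. -/
def relax (D : Fin n → Fin n → ℕ) (i j : Fin n) : ℕ :=
  Finset.univ.fold min (D i j) fun k => D i k + D k j

/-- A number larger than the length of any path. -/
def infWeight (n : ℕ) : ℕ := n * (4 * 8 ^ (n * n))

open Classical in
/-- The matrix of the edge lengths. -/
noncomputable def weightMatrix (idx : Sym2 (Fin n) → ℕ) (H : SimpleGraph (Fin n))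
    (i j : Fin n) : ℕ :=
  if i = j then 0 else if H.Adj i j then 2 * halfWeight idx s(i, j) else infWeight n

/-- The matrix of the distances. -/
noncomputable def allDist (idx : Sym2 (Fin n) → ℕ) (H : SimpleGraph (Fin n)) :
    Fin n → Fin n → ℕ :=
  relax^[n] (weightMatrix idx H)

variable {H : SimpleGraph (Fin n)} {idx : Sym2 (Fin n) → ℕ}

theorem relax_le (D : Fin n → Fin n → ℕ) (i j : Fin n) : relax D i j ≤ D i j :=
  Finset.fold_min_le _ |>.2 (.inl le_rfl)

theorem relax_le_add (D : Fin n → Fin n → ℕ) (i k j : Fin n) : relax D i j ≤ D i k + D k j :=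
  Finset.fold_min_le _ |>.2 (.inr ⟨k, Finset.mem_univ k, le_rfl⟩)

theorem relax_eq (D : Fin n → Fin n → ℕ) (i j : Fin n) :
    relax D i j = D i j ∨ ∃ k, relax D i j = D i k + D k j := by
  rcases (Finset.fold_min_le _).1 (le_refl (relax D i j)) with h | ⟨k, -, h⟩
  · exact .inl (le_antisymm (relax_le D i j) h)
  · exact .inr ⟨k, le_antisymm (relax_le_add D i k j) h⟩

/-- A sum below the infinite value has both summands below it, so entries below that value always
come from walks. -/
theorem exists_walk_of_relax_lt (t : ℕ) (i j : Fin n)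
    (h : relax^[t] (weightMatrix idx H) i j < infWeight n) :
    ∃ p : H.Walk i j, 2 * natLen idx p.edges = relax^[t] (weightMatrix idx H) i j := by
  induction t generalizing i j with
  | zero =>
    simp only [Function.iterate_zero, id] at h ⊢
    rw [weightMatrix] at h ⊢
    by_cases hij : i = j
    · subst hij
      exact ⟨.nil, by simp⟩
    · rw [if_neg hij] at h ⊢
      by_cases hadj : H.Adj i j
      · rw [if_pos hadj]
        exact ⟨.cons hadj .nil, by simp⟩
      · rw [if_neg hadj] at h
        exact absurd h (lt_irrefl _)
  | succ t ih =>
    rw [Function.iterate_succ_apply'] at h ⊢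
    rcases relax_eq (relax^[t] (weightMatrix idx H)) i j with h' | ⟨k, h'⟩
    · rw [h'] at h ⊢
      exact ih i j h
    · rw [h'] at h ⊢
      obtain ⟨p, hp⟩ := ih i k (by omega)
      obtain ⟨q, hq⟩ := ih k j (by omega)
      exact ⟨p.append q, by simp; omega⟩

/-- Splitting off the first edge gains one edge per round. Squaring gains more, but n rounds suffice
and are a single loop. -/
theorem relax_le_of_walk (t : ℕ) {i j : Fin n} (p : H.Walk i j) (hp : p.length ≤ t + 1) :
    relax^[t] (weightMatrix idx H) i j ≤ 2 * natLen idx p.edges := by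
  induction t generalizing i j with
  | zero =>
    simp only [Function.iterate_zero, id]
    cases p with
    | nil => simp [weightMatrix]
    | cons h p =>
      cases p with
      | nil => simp [weightMatrix, h, h.ne]
      | cons h' p => simp at hp
  | succ t ih =>
    rw [Function.iterate_succ_apply']
    cases p with
    | nil => exact (relax_le _ _ _).trans (ih .nil (by simp))
    | @cons _ k _ h p =>
      refine (relax_le_add _ i k j).trans ?_
      have h1 := ih (.cons h .nil) (by simp)
      have h2 := ih p (by simpa using hp)
      simp at h1 ⊢
      omega

theorem natLen_le_length_mul (L : List (Sym2 (Fin n))) :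
    natLen idx L ≤ L.length * (2 * 8 ^ (n * n)) := by
  induction L with
  | nil => simp
  | cons e L ih =>
    rw [natLen_cons, List.length_cons, add_mul, one_mul]
    have := halfWeight_le (idx := idx) e
    omega

theorem allDist_lt_of_connected (hH : H.Connected) (i j : Fin n) :
    allDist idx H i j < infWeight n := by
  obtain ⟨p, hp⟩ := hH.exists_isPath i j
  have hl : p.length < n := by simpa using hp.length_lt
  refine (relax_le_of_walk n p (by omega)).trans_lt ?_
  have h1 := natLen_le_length_mul (idx := idx) p.edges
  rw [SimpleGraph.Walk.length_edges] at h1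
  have h2 : (p.length + 1) * (4 * 8 ^ (n * n)) ≤ infWeight n := Nat.mul_le_mul_right _ hl
  have h3 : 0 < 8 ^ (n * n) := by positivity
  rw [add_mul, one_mul] at h2
  rw [show p.length * (4 * 8 ^ (n * n)) = 2 * (p.length * (2 * 8 ^ (n * n))) by ring] at h2
  omega

theorem allDist_eq (hH : H.Connected) (i j : Fin n) : allDist idx H i j = vertexDist idx H i j := by
  apply le_antisymm
  · obtain ⟨p, hp, h⟩ := exists_vertexDist_eq hH idx i j
    have hl : p.length < n := by simpa using hp.length_lt
    rw [h]
    exact relax_le_of_walk n p (by omega)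
  · obtain ⟨p, hp⟩ := exists_walk_of_relax_lt n i j (allDist_lt_of_connected (idx := idx) hH i j)
    exact (vertexDist_le p).trans hp.le

theorem connected_iff_allDist_lt (hn : 0 < n) :
    H.Connected ↔ ∀ i j, allDist idx H i j < infWeight n := by
  refine ⟨fun h => allDist_lt_of_connected h, fun h => ?_⟩
  have : Nonempty (Fin n) := ⟨⟨0, hn⟩⟩
  refine ⟨fun i j => ?_⟩
  obtain ⟨p, -⟩ := exists_walk_of_relax_lt n i j (h i j)
  exact ⟨p⟩

/-! ## The test of a candidate -/

/-- The distance from a point, in terms of a matrix of the distances between vertices. -/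
def codeDist (idx : Sym2 (Fin n) → ℕ) (D : Fin n → Fin n → ℕ) (r : Point n) (v : Fin n) : ℕ :=
  natLen idx r.half + min (D r.code.1 v) (D r.code.2 v)

open Classical in
/-- The number of the ordered pairs of adjacent vertices. -/
noncomputable def adjCount (Q : SimpleGraph (Fin n)) : ℕ :=
  ∑ i : Fin n, ∑ j : Fin n, if Q.Adj i j then 1 else 0

/-- The properties that are tested for a candidate `Q`, with two vertices `y` as witnesses for the
points being on a cycle. -/
structure Passes (G : SimpleGraph (Fin n)) (idx : Sym2 (Fin n) → ℕ) (d : ℕ) (r : Bool → Point n)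
    (Q : SimpleGraph (Fin n)) (y : Bool → Fin n) : Prop where
  conn : ∀ i j, allDist idx Q i j < infWeight n
  count : adjCount Q ≤ n + n
  mem : ∀ b, (r b).code.1 = (r b).code.2 ∨ Q.Adj (r b).code.1 (r b).code.2
  center : ∀ b v, codeDist idx (allDist idx Q) (r b) v < (d + 1) * 8 ^ (n * n)
  lip : ∀ u v, G.Adj u v →
    max (codeDist idx (allDist idx Q) (r false) v) (codeDist idx (allDist idx Q) (r true) v) ≤
      max (codeDist idx (allDist idx Q) (r false) u) (codeDist idx (allDist idx Q) (r true) u) +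
        2 * halfWeight idx s(u, v)
  cycle : adjCount Q < n + n ∨ ∀ b, Q.Adj (r b).code.1 (y b) ∧
    ((r b).code.1 = (r b).code.2 ∨ y b = (r b).code.2) ∧
    ∀ i j, allDist idx (Q.deleteEdges {s((r b).code.1, y b)}) i j < infWeight n

theorem adjCount_eq (Q : SimpleGraph (Fin n)) : adjCount Q = 2 * Q.edgeSet.ncard := by
  classical
  rw [← SimpleGraph.coe_edgeFinset, Set.ncard_coe_finset, ← SimpleGraph.sum_degrees_eq_twice_card_edges,
    adjCount]
  refine Finset.sum_congr rfl fun i _ => ?_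
  rw [Finset.sum_boole, ← SimpleGraph.card_neighborFinset_eq_degree,
    SimpleGraph.neighborFinset_eq_filter]
  simp

/-- The matrix entries are distances only if `Q` is connected, so that case is separated first; both
sides fail otherwise. -/
theorem exists_passes_iff {G : SimpleGraph (Fin n)} (h : IsEdgeIndex G idx) {d : ℕ}
    {r : Bool → Point n} (hr : ∀ b, r b ∈ points G) (hne : r false ≠ r true)
    {Q : SimpleGraph (Fin n)} (hQG : Q ≤ G) :
    (∃ y, Passes G idx d r Q y) ↔
      Reconf G d (r false) (r true) Q ∧ IsGood G idx (r false) (r true) Q := by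
  have hn := two_le_of_points (hr false) (hr true) hne
  rw [Reconf, isPseudotree_iff]
  by_cases hconn : Q.Connected
  swap
  · refine iff_of_false ?_ fun h' => hconn h'.1.1.2.1
    rintro ⟨y, hy⟩
    exact hconn ((connected_iff_allDist_lt (by omega)).2 hy.conn)
  rw [h.isCenter_iff hconn hQG (hr _), h.isCenter_iff hconn hQG (hr _)]
  have hcd : ∀ b v, codeDist idx (allDist idx Q) (r b) v = natDist idx Q (r b) v := by
    intro b v
    rw [natDist_eq_min hconn, codeDist, allDist_eq hconn, allDist_eq hconn]
  have hlip : (∀ u v : Fin n, G.Adj u v → label G.edgeSet.ncard idx (r false) (r true) Q v ≤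
      label G.edgeSet.ncard idx (r false) (r true) Q u + edgeLen G.edgeSet.ncard idx s(u, v)) ↔
      ∀ u v : Fin n, G.Adj u v → natLabel idx Q (r false) (r true) v ≤
        natLabel idx Q (r false) (r true) u + 2 * halfWeight idx s(u, v) :=
    forall_congr' fun u => forall_congr' fun v => forall_congr' fun huv =>
      h.label_le_iff hconn hQG (hr _) (hr _) huv
  constructor
  · rintro ⟨y, hy⟩
    have hmem : ∀ b, r b ∈ points Q := fun b => (mem_points_iff (hr b)).2 (hy.mem b)
    have hcount := hy.count
    rw [adjCount_eq] at hcount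
    have hle : Q.edgeSet.ncard ≤ n := by omega
    refine ⟨⟨⟨hQG, hconn, hle⟩, ⟨hmem _, fun v => ?_⟩, ⟨hmem _, fun v => ?_⟩, hne⟩, hlip.2 ?_,
      (forall_onWalk_iff hconn hle (hmem _) (hmem _)).2 ?_⟩
    · rw [← hcd]; exact hy.center _ v
    · rw [← hcd]; exact hy.center _ v
    · intro u v huv
      have := hy.lip u v huv
      simpa only [hcd, natLabel] using this
    · rcases hy.cycle with hc | hc
      · rw [adjCount_eq] at hc
        exact .inl (by omega)
      · have : ∀ b, ∃ z, CycleWitness Q (r b) z := fun b =>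
          ⟨y b, (hc b).1, (hc b).2.1, (connected_iff_allDist_lt (by omega)).2 (hc b).2.2⟩
        exact .inr ⟨this _, this _⟩
  · rintro ⟨⟨⟨-, -, hle⟩, ⟨hm1, hc1⟩, ⟨hm2, hc2⟩, -⟩, hl, hcyc⟩
    have hmem : ∀ b, r b ∈ points Q := fun b => by cases b <;> assumption
    have hcyc' : ∃ y : Bool → Fin n, Q.edgeSet.ncard < n ∨ ∀ b, CycleWitness Q (r b) (y b) := by
      rcases (forall_onWalk_iff hconn hle hm1 hm2).1 hcyc with h' | ⟨⟨y₁, h₁⟩, ⟨y₂, h₂⟩⟩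
      · exact ⟨fun _ => ⟨0, by omega⟩, .inl h'⟩
      · exact ⟨fun b => bif b then y₂ else y₁, .inr fun b => by cases b <;> assumption⟩
    obtain ⟨y, hy⟩ := hcyc'
    refine ⟨y, allDist_lt_of_connected hconn, by rw [adjCount_eq]; omega,
      fun b => (mem_points_iff (hr b)).1 (hmem b), fun b v => ?_, fun u v huv => ?_, ?_⟩
    · rw [hcd]
      cases b
      · exact hc1 v
      · exact hc2 v
    · have := hlip.1 hl u v huv
      simpa only [hcd, natLabel] using this
    · rcases hy with hy | hy
      · exact .inl (by rw [adjCount_eq]; omega)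
      · exact .inr fun b => ⟨(hy b).1, (hy b).2.1, allDist_lt_of_connected (hy b).2.2⟩

/-- A good triplet exists if and only if some guess passes the test. -/
theorem exists_guess_passes {G : SimpleGraph (Fin n)} (h : IsEdgeIndex G idx) {d : ℕ}
    {r : Bool → Point n} (hr : ∀ b, r b ∈ points G) (hne : r false ≠ r true)
    {Q : SimpleGraph (Fin n)}
    (hQ : Reconf G d (r false) (r true) Q ∧ IsGood G idx (r false) (r true) Q) :
    ∃ g : ℕ → Fin n, Passes G idx d r
      (guessGraph G idx (allDist idx G) (fun b => natLen idx (r b).half) g)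
      (fun b => bif b then g 505 else g 504) := by
  have hps := isPseudotree_iff.1 hQ.1.1
  obtain ⟨y, hy⟩ := (exists_passes_iff h hr hne hps.1).2 hQ
  have hgood : GoodData G Q idx r := ⟨h, hps.2.1, hps.1, hr, hne, hps.2.2, fun u v huv =>
    (h.label_le_iff hps.2.1 hps.1 (hr _) (hr _) huv).1 (hQ.2.1 u v huv)⟩
  obtain ⟨g, h1, h2, h3⟩ := hgood.exists_guess y
  have hG : allDist idx G = vertexDist idx G := by
    funext i j
    exact allDist_eq hgood.conn_sup i j
  refine ⟨g, ?_⟩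
  rw [hG, h3, h1, h2]
  convert hy using 2 with b
  cases b <;> rfl

end

/-! ## Derived expressions -/

/-- The value after `m` rounds of an iteration whose `t`-th round is `f t`. -/
def iterVal (f : ℕ → ℕ → ℕ) (v : ℕ) : ℕ → ℕ
  | 0 => v
  | m + 1 => f m (iterVal f v m)

/-- The expression, read as a test, is true. -/
def BExpr.Holds (e : BExpr) (s : Store) : Prop := e.eval s ≠ 0

namespace BExpr

def notE (e : BExpr) : BExpr := ite e (const 0) (const 1)
def andE (e f : BExpr) : BExpr := ite e f (const 0)
def orE (e f : BExpr) : BExpr := ite e (const 1) f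
def leE (e f : BExpr) : BExpr := sub (const 1) (sub e f)
def ltE (e f : BExpr) : BExpr := sub f e
def eqE (x y : ℕ) : BExpr := andE (leE (reg x) (reg y)) (leE (reg y) (reg x))
def minE (e f : BExpr) : BExpr := sub e (sub e f)
def maxE (e f : BExpr) : BExpr := add e (sub f e)

/-- Bounded quantification over register `x`; register `6` is the accumulator of all folds. -/
def allE (x : ℕ) (e : BExpr) : BExpr := fold x 6 (const 1) (ite (reg 6) e (const 0))
def sumE (x : ℕ) (e : BExpr) : BExpr := fold x 6 (const 0) (add (reg 6) e)
def foldMinE (x : ℕ) (i e : BExpr) : BExpr := fold x 6 i (minE (reg 6) e)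

/-- The product of register `x` and register `0`, if the former is at most the latter. -/
def mulE (x : ℕ) : BExpr :=
  fold 17 6 (const 0) (ite (ltE (reg 17) (reg x)) (add (reg 6) (reg 0)) (reg 6))

/-- The entry of a matrix in the row and column given by two registers. -/
def entry (a x y : ℕ) : BExpr := read a (add (mulE x) (reg y))

/-- Eight times the accumulator. -/
def octE : BExpr :=
  add (add (add (reg 6) (reg 6)) (add (reg 6) (reg 6)))
    (add (add (reg 6) (reg 6)) (add (reg 6) (reg 6)))

/-- The product of `i` and a power of `8`, whose exponent is the number of pairs for which `c` is
true. -/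
def powE (c i : BExpr) : BExpr := fold 10 6 i (fold 11 6 (reg 6) (ite c octE (reg 6)))

section
variable {e f c i : BExpr} {s : Store} {n x y z a : ℕ}

@[simp] theorem holds_notE : (notE e).Holds s ↔ ¬ e.Holds s := by
  simp [Holds, notE, eval]

@[simp] theorem holds_andE : (andE e f).Holds s ↔ e.Holds s ∧ f.Holds s := by
  simp [Holds, andE, eval]

@[simp] theorem holds_orE : (orE e f).Holds s ↔ e.Holds s ∨ f.Holds s := by
  simp only [Holds, orE, eval]
  split_ifs with h <;> simp [h]

@[simp] theorem holds_leE : (leE e f).Holds s ↔ e.eval s ≤ f.eval s := by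
  simp only [Holds, leE, eval]
  omega

@[simp] theorem holds_ltE : (ltE e f).Holds s ↔ e.eval s < f.eval s := by
  simp only [Holds, ltE, eval]
  omega

@[simp] theorem holds_eqE : (eqE x y).Holds s ↔ s.reg x = s.reg y := by
  rw [eqE, holds_andE, holds_leE, holds_leE]
  exact le_antisymm_iff.symm

@[simp] theorem eval_minE : (minE e f).eval s = min (e.eval s) (f.eval s) := by
  simp only [minE, eval]
  omega

@[simp] theorem eval_maxE : (maxE e f).eval s = max (e.eval s) (f.eval s) := by
  simp only [maxE, eval]
  omega

open Classical in
theorem eval_ite : (ite c e f).eval s = if c.Holds s then e.eval s else f.eval s := by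
  by_cases h : c.eval s = 0 <;> simp [eval, Holds, h]

theorem holds_setReg_of_fresh (he : e.Fresh z) (v : ℕ) : e.Holds (s.setReg z v) ↔ e.Holds s := by
  rw [Holds, eval_setReg_of_fresh he, Holds]

theorem eval_fold : (fold x y i e).eval s =
    iterVal (fun t v => e.eval ((s.setReg x t).setReg y v)) (i.eval s) (s.reg 0) := by
  rw [eval]
  generalize s.reg 0 = m
  induction m with
  | zero => rfl
  | succ m ih => rw [iterVal, ← ih]

/-- Freshness only forbids free occurrences of the accumulator, so quantifiers can be nested. -/
theorem holds_allE (he : e.Fresh 6) (h0 : s.reg 0 = n) :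
    (allE x e).Holds s ↔ ∀ i : Fin n, e.Holds (s.setReg x i) := by
  have key : ∀ m : ℕ, iterVal (fun t v =>
      (ite (reg 6) e (const 0)).eval ((s.setReg x t).setReg 6 v)) 1 m ≠ 0 ↔
      ∀ i < m, e.Holds (s.setReg x i) := by
    intro m
    induction m with
    | zero => simp [iterVal]
    | succ m ih =>
      rw [Nat.forall_lt_succ_right, ← ih, iterVal]
      generalize iterVal (fun t v =>
        (ite (reg 6) e (const 0)).eval ((s.setReg x t).setReg 6 v)) 1 m = w
      simp only [eval, eval_setReg_of_fresh he, Store.setReg_reg_self, Holds]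
      split_ifs with h <;> simp [h]
  rw [Holds, allE, eval_fold, h0]
  exact (key n).trans (Fin.forall_iff (p := fun i : Fin n => e.Holds (s.setReg x i))).symm

theorem eval_sumE (he : e.Fresh 6) (h0 : s.reg 0 = n) :
    (sumE x e).eval s = ∑ i : Fin n, e.eval (s.setReg x i) := by
  have key : ∀ m : ℕ, iterVal (fun t v =>
      (add (reg 6) e).eval ((s.setReg x t).setReg 6 v)) 0 m =
      ∑ i ∈ Finset.range m, e.eval (s.setReg x i) := by
    intro m
    induction m with
    | zero => simp [iterVal]
    | succ m ih =>
      rw [Finset.sum_range_succ, ← ih, iterVal]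
      simp only [eval, eval_setReg_of_fresh he, Store.setReg_reg_self]
  rw [sumE, eval_fold, h0]
  exact (key n).trans (Fin.sum_univ_eq_sum_range (fun i => e.eval (s.setReg x i)) n).symm

theorem eval_foldMinE (he : e.Fresh 6) (h0 : s.reg 0 = n) :
    (foldMinE x i e).eval s =
      Finset.univ.fold min (i.eval s) fun k : Fin n => e.eval (s.setReg x k) := by
  have key : ∀ m c : ℕ, c ≤ iterVal (fun t v =>
      (minE (reg 6) e).eval ((s.setReg x t).setReg 6 v)) (i.eval s) m ↔
      c ≤ i.eval s ∧ ∀ k < m, c ≤ e.eval (s.setReg x k) := by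
    intro m
    induction m with
    | zero => simp [iterVal]
    | succ m ih =>
      intro c
      rw [Nat.forall_lt_succ_right, ← and_assoc, ← ih, iterVal, eval_minE, le_min_iff,
        eval_setReg_of_fresh he, eval, Store.setReg_reg_self]
  rw [foldMinE, eval_fold, h0]
  refine eq_of_forall_le_iff fun c => (key n c).trans ?_
  rw [Finset.le_fold_min]
  simp [Fin.forall_iff]

theorem eval_mulE (h0 : s.reg 0 = n) (hx : x ≠ 6) (hx' : x ≠ 17) (hn : s.reg x ≤ n) :
    (mulE x).eval s = s.reg x * n := by
  have key : ∀ m : ℕ, iterVal (fun t v =>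
      (ite (ltE (reg 17) (reg x)) (add (reg 6) (reg 0)) (reg 6)).eval
        ((s.setReg 17 t).setReg 6 v)) 0 m = min (s.reg x) m * n := by
    intro m
    induction m with
    | zero => simp [iterVal]
    | succ m ih =>
      rw [iterVal, ih, eval_ite, holds_ltE]
      simp only [eval, Store.setReg, Function.update_apply, hx, hx', if_false, if_true,
        show (17 : ℕ) ≠ 6 by decide, show (0 : ℕ) ≠ 6 by decide,
        show (0 : ℕ) ≠ 17 by decide, h0]
      split_ifs with h
      · rw [min_eq_right h.le, min_eq_right h, Nat.succ_mul]
      · rw [min_eq_left (by omega), min_eq_left (by omega)]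
  rw [mulE, eval_fold, h0]
  exact (key n).trans (by rw [min_eq_left hn])

theorem eval_entry {i j : Fin n} (a : ℕ) (h0 : s.reg 0 = n) (hx : x ≠ 6) (hx' : x ≠ 17)
    (hi : s.reg x = i) (hj : s.reg y = j) :
    (entry a x y).eval s = s.arr a (i * n + j) := by
  have := i.2
  rw [entry, eval, eval, eval_mulE h0 hx hx' (by omega), eval, hi, hj]

-- The accumulator is multiplied by eight, using additions only, once for each pair satisfying `c`.
-- The double loop reaches exponents up to n².
open Classical in
theorem eval_powE (hc : c.Fresh 6) (h0 : s.reg 0 = n) :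
    (powE c i).eval s = i.eval s * 8 ^ ∑ u ∈ Finset.range n, ∑ v ∈ Finset.range n,
      if c.Holds ((s.setReg 10 u).setReg 11 v) then 1 else 0 := by
  have inner : ∀ (s : Store) (m w : ℕ), iterVal (fun t v =>
      (ite c octE (reg 6)).eval ((s.setReg 11 t).setReg 6 v)) w m =
      w * 8 ^ ∑ v ∈ Finset.range m, if c.Holds (s.setReg 11 v) then 1 else 0 := by
    intro s m w
    induction m with
    | zero => simp [iterVal]
    | succ m ih =>
      rw [Finset.sum_range_succ, pow_add, ← mul_assoc, ← ih, iterVal, eval_ite]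
      generalize iterVal (fun t v => (ite c octE (reg 6)).eval ((s.setReg 11 t).setReg 6 v)) w m = w'
      by_cases h : c.Holds (s.setReg 11 m)
      · rw [if_pos h, if_pos ((holds_setReg_of_fresh hc _).2 h)]
        simp only [octE, eval, Store.setReg_reg_self]
        ring
      · rw [if_neg h, if_neg (mt (holds_setReg_of_fresh hc _).1 h)]
        simp only [eval, Store.setReg_reg_self]
        ring
  have outer : ∀ m : ℕ, iterVal (fun t v =>
      (fold 11 6 (reg 6) (ite c octE (reg 6))).eval ((s.setReg 10 t).setReg 6 v)) (i.eval s) m =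
      i.eval s * 8 ^ ∑ u ∈ Finset.range m, ∑ v ∈ Finset.range n,
        if c.Holds ((s.setReg 10 u).setReg 11 v) then 1 else 0 := by
    intro m
    induction m with
    | zero => simp [iterVal]
    | succ m ih =>
      rw [Finset.sum_range_succ, pow_add, ← mul_assoc, ← ih, iterVal]
      generalize iterVal (fun t v => (fold 11 6 (reg 6) (ite c octE (reg 6))).eval
        ((s.setReg 10 t).setReg 6 v)) (i.eval s) m = w
      have h0' : ((s.setReg 10 m).setReg 6 w).reg 0 = n := by simpa [Store.setReg] using h0
      rw [eval_fold, inner, h0', eval, Store.setReg_reg_self]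
      congr 2
      refine Finset.sum_congr rfl fun v _ => ?_
      rw [Store.setReg_comm _ (by decide : (6 : ℕ) ≠ 11)]
      exact if_congr (holds_setReg_of_fresh hc _) rfl rfl
  rw [powE, eval_fold, h0]
  exact outer n

end

/-- The numbers u·n + v run through 0, …, n² - 1 once each. This yields the exponent n² - idx e of
the weights. -/
theorem sum_sum_lt (n k : ℕ) : (∑ u ∈ Finset.range n, ∑ v ∈ Finset.range n,
    if u * n + v + k < n * n then 1 else 0) = n * n - k := by
  have inner : ∀ a b N : ℕ, (∑ v ∈ Finset.range b, if a + v + k < N then 1 else 0) =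
      min (N - k - a) b := by
    intro a b N
    induction b with
    | zero => simp
    | succ b ih =>
      rw [Finset.sum_range_succ, ih]
      split_ifs <;> omega
  have outer : ∀ m, (∑ u ∈ Finset.range m, ∑ v ∈ Finset.range n,
      if u * n + v + k < n * n then 1 else 0) = min (n * n - k) (m * n) := by
    intro m
    induction m with
    | zero => simp
    | succ m ih =>
      rw [Finset.sum_range_succ, ih, inner, Nat.succ_mul]
      omega
  rw [outer]
  omega

end BExpr

/-! ## Matrices -/

/-- The stores agree outside the registers `R` and the arrays `A`. -/
def Frame (R A : List ℕ) (s s' : Store) : Prop :=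
  (∀ x, x ∉ R → s'.reg x = s.reg x) ∧ ∀ a, a ∉ A → s'.arr a = s.arr a

theorem Frame.refl (R A : List ℕ) (s : Store) : Frame R A s s := ⟨fun _ _ => rfl, fun _ _ => rfl⟩

theorem Frame.trans {R A : List ℕ} {s s' s'' : Store} (h : Frame R A s s') (h' : Frame R A s' s'') :
    Frame R A s s'' :=
  ⟨fun x hx => (h'.1 x hx).trans (h.1 x hx), fun a ha => (h'.2 a ha).trans (h.2 a ha)⟩

theorem Frame.mono {R A R' A' : List ℕ} {s s' : Store} (h : Frame R A s s') (hR : R ⊆ R')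
    (hA : A ⊆ A') : Frame R' A' s s' :=
  ⟨fun x hx => h.1 x fun h' => hx (hR h'), fun a ha => h.2 a fun h' => ha (hA h')⟩

theorem Frame.setReg {R A : List ℕ} {s s' : Store} (h : Frame R A s s') {x : ℕ} (hx : x ∈ R)
    (v : ℕ) : Frame R A s (s'.setReg x v) :=
  ⟨fun y hy => (Store.setReg_reg_of_ne _ _ fun h' => hy (by rw [h']; exact hx)).trans (h.1 y hy), h.2⟩

theorem Frame.setArr {R A : List ℕ} {s s' : Store} (h : Frame R A s s') {a : ℕ} (ha : a ∈ A)
    (i v : ℕ) : Frame R A s (s'.setArr a i v) :=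
  ⟨h.1, fun b hb => by
    have : b ≠ a := fun h' => hb (h' ▸ ha)
    simp [Store.setArr, this, h.2 b hb]⟩

/-- Array `a` holds the matrix `F`. -/
def Store.Mat {n : ℕ} (s : Store) (a : ℕ) (F : Fin n → Fin n → ℕ) : Prop :=
  ∀ i j : Fin n, s.arr a (i * n + j) = F i j

theorem Frame.mat {n : ℕ} {R A : List ℕ} {s s' : Store} (h : Frame R A s s') {a : ℕ} (ha : a ∉ A)
    {F : Fin n → Fin n → ℕ} (hF : s.Mat a F) : s'.Mat a F := by
  intro i j
  rw [h.2 a ha]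
  exact hF i j

theorem row_col_eq {n i i' j j' : ℕ} (hj : j < n) (hj' : j' < n)
    (h : i * n + j = i' * n + j') : i = i' ∧ j = j' := by
  have h1 : i = i' := by
    rcases lt_trichotomy i i' with hlt | h' | hlt
    · have := Nat.mul_le_mul_right n (Nat.succ_le_iff.2 hlt)
      rw [Nat.succ_mul] at this
      omega
    · exact h'
    · have := Nat.mul_le_mul_right n (Nat.succ_le_iff.2 hlt)
      rw [Nat.succ_mul] at this
      omega
  subst h1
  exact ⟨rfl, by omega⟩

namespace Cmd
open BExpr

theorem run_loop_induct (I : ℕ → Store → Prop) {n x : ℕ} {c : Cmd} {s : Store} (hn : s.reg 0 = n)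
    (h0 : I 0 s) (hstep : ∀ t < n, ∀ s', I t s' → I (t + 1) (c.run (s'.setReg x t))) :
    I n ((loop x c).run s) := by
  have key : ∀ m ≤ n, I m (Nat.rec s (fun t s' => c.run (s'.setReg x t)) m : Store) := by
    intro m
    induction m with
    | zero => exact fun _ => h0
    | succ m ih => exact fun hm => hstep m (by omega) _ (ih (by omega))
  rw [run, hn]
  exact key n le_rfl

/-- Fill a matrix with the values of an expression in the row `7` and the column `8`. -/
def fill (a : ℕ) (e : BExpr) : Cmd :=
  loop 7 (loop 8 (store a (add (mulE 7) (reg 8)) e))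

/-- The expression must have the right value while array `a` is partially overwritten; in practice
it does not read `a`. -/
theorem fill_spec {n a : ℕ} {e : BExpr} {s : Store} (h0 : s.reg 0 = n) (F : Fin n → Fin n → ℕ)
    (he : ∀ s', Frame [7, 8] [a] s s' → ∀ i j : Fin n, s'.reg 7 = i → s'.reg 8 = j →
      e.eval s' = F i j) :
    Frame [7, 8] [a] s ((fill a e).run s) ∧ ((fill a e).run s).Mat a F := by
  have key := run_loop_induct (s := s) (x := 7)
    (c := loop 8 (store a (add (mulE 7) (reg 8)) e))
    (fun t s' => Frame [7, 8] [a] s s' ∧ ∀ i j : Fin n, (i : ℕ) < t → s'.arr a (i * n + j) = F i j)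
    h0 ⟨Frame.refl _ _ _, fun i j h => absurd h (Nat.not_lt_zero _)⟩ ?_
  · exact ⟨key.1, fun i j => key.2 i j i.2⟩
  rintro t ht s' ⟨hf, hI⟩
  have hf1 : Frame [7, 8] [a] s (s'.setReg 7 t) := hf.setReg (by simp) _
  have hs0 : (s'.setReg 7 t).reg 0 = n := (hf1.1 0 (by simp)).trans h0
  have key := run_loop_induct (s := s'.setReg 7 t) (x := 8)
    (c := store a (add (mulE 7) (reg 8)) e)
    (fun u s'' => Frame [7, 8] [a] s s'' ∧ s''.reg 7 = t ∧
      (∀ i j : Fin n, (i : ℕ) < t → s''.arr a (i * n + j) = F i j) ∧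
      ∀ i j : Fin n, (i : ℕ) = t → (j : ℕ) < u → s''.arr a (i * n + j) = F i j)
    hs0 ⟨hf1, Store.setReg_reg_self _ _ _, hI, fun i j _ h => absurd h (Nat.not_lt_zero _)⟩ ?_
  · refine ⟨key.1, fun i j hi => ?_⟩
    rcases Nat.lt_succ_iff_lt_or_eq.1 hi with hi | hi
    · exact key.2.2.1 i j hi
    · exact key.2.2.2 i j hi j.2
  rintro u hu s'' ⟨hf2, h7, hJ, hK⟩
  have hf3 : Frame [7, 8] [a] s (s''.setReg 8 u) := hf2.setReg (by simp) _
  have hs0' : (s''.setReg 8 u).reg 0 = n := (hf3.1 0 (by simp)).trans h0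
  have h7' : (s''.setReg 8 u).reg 7 = t := (Store.setReg_reg_of_ne _ _ (by decide)).trans h7
  have h8' : (s''.setReg 8 u).reg 8 = u := Store.setReg_reg_self _ _ _
  have hidx : (add (mulE 7) (reg 8)).eval (s''.setReg 8 u) = t * n + u := by
    rw [eval, eval_mulE hs0' (by decide) (by decide) (by omega), eval, h7', h8']
  have hval := he _ hf3 ⟨t, ht⟩ ⟨u, hu⟩ h7' h8'
  have harr : ∀ i j : Fin n, ((store a (add (mulE 7) (reg 8)) e).run (s''.setReg 8 u)).arr a
      (i * n + j) = if (i : ℕ) = t ∧ (j : ℕ) = u then F i j else s''.arr a (i * n + j) := by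
    intro i j
    rw [run, hidx, hval]
    simp only [Store.setArr, Function.update_self, Function.update_apply]
    by_cases hij : (i : ℕ) = t ∧ (j : ℕ) = u
    · rw [if_pos hij, if_pos (by rw [hij.1, hij.2])]
      exact congrArg₂ F (Fin.ext hij.1.symm) (Fin.ext hij.2.symm)
    · rw [if_neg hij, if_neg fun h' => hij (row_col_eq j.2 hu h')]
      rfl
  refine ⟨?_, ?_, fun i j hi => ?_, fun i j hi hj => ?_⟩
  · rw [run]
    exact hf3.setArr (by simp) _ _
  · rw [run]
    exact h7'
  · rw [harr, if_neg (by omega)]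
    exact hJ i j hi
  · rw [harr]
    split_ifs with h
    · rfl
    · exact hK i j hi (by omega)

/-- Compute all distances for the edge lengths given by an expression. -/
def apsp (a : ℕ) (e : BExpr) : Cmd :=
  seq (fill a e) (loop 9 (seq
    (fill 8 (foldMinE 10 (entry a 7 8) (add (entry a 7 10) (entry a 10 8))))
    (fill a (entry 8 7 8))))

/-- Each round is computed into the auxiliary array `8` and copied back, so that a round reads only
values of the previous one. -/
theorem apsp_spec {n a : ℕ} (ha : a ≠ 8) {e : BExpr} {s : Store} (h0 : s.reg 0 = n)
    (W : Fin n → Fin n → ℕ)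
    (he : ∀ s', Frame [7, 8] [a] s s' → ∀ i j : Fin n, s'.reg 7 = i → s'.reg 8 = j →
      e.eval s' = W i j) :
    Frame [7, 8, 9] [a, 8] s ((apsp a e).run s) ∧ ((apsp a e).run s).Mat a (relax^[n] W) := by
  obtain ⟨hf, hM⟩ := fill_spec h0 W he
  rw [apsp, run]
  have hf' : Frame [7, 8, 9] [a, 8] s ((fill a e).run s) := hf.mono (by simp) (by simp)
  refine run_loop_induct (n := n) (fun t s' => Frame [7, 8, 9] [a, 8] s s' ∧ s'.Mat a (relax^[t] W))
    ((hf.1 0 (by simp)).trans h0) ⟨hf', hM⟩ ?_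
  rintro t ht s' ⟨hf1, hM1⟩
  have hf2 : Frame [7, 8, 9] [a, 8] s (s'.setReg 9 t) := hf1.setReg (by simp) _
  have hs0 : (s'.setReg 9 t).reg 0 = n := (hf2.1 0 (by simp)).trans h0
  have hM2 : (s'.setReg 9 t).Mat a (relax^[t] W) := hM1
  rw [run]
  generalize s'.setReg 9 t = s₁ at *
  obtain ⟨hf3, hM3⟩ := fill_spec (a := 8)
    (e := foldMinE 10 (entry a 7 8) (add (entry a 7 10) (entry a 10 8))) hs0
    (relax (relax^[t] W)) (by
      intro s'' hf4 i j hi hj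
      have h0' : s''.reg 0 = n := (hf4.1 0 (by simp)).trans hs0
      have hM4 : s''.Mat a (relax^[t] W) := hf4.mat (by simpa using ha) hM2
      rw [eval_foldMinE (n := n) (by simp [Fresh, entry, mulE, ltE]) h0', relax,
        eval_entry a h0' (by decide) (by decide) hi hj, hM4]
      refine congrArg (fun f => Finset.univ.fold min _ f) ?_
      funext k
      have e0 : (s''.setReg 10 k).reg 0 = n := by simpa [Store.setReg] using h0'
      have e7 : (s''.setReg 10 k).reg 7 = i := by simpa [Store.setReg] using hi
      have e8 : (s''.setReg 10 k).reg 8 = j := by simpa [Store.setReg] using hj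
      have e10 : (s''.setReg 10 k).reg 10 = k := Store.setReg_reg_self _ _ _
      rw [eval, eval_entry a e0 (by decide) (by decide) e7 e10,
        eval_entry a e0 (by decide) (by decide) e10 e8]
      exact congrArg₂ _ (hM4 i k) (hM4 k j))
  generalize (fill 8 (foldMinE 10 (entry a 7 8) (add (entry a 7 10) (entry a 10 8)))).run s₁ = s₂ at *
  have hs0' : s₂.reg 0 = n := (hf3.1 0 (by simp)).trans hs0
  obtain ⟨hf5, hM5⟩ := fill_spec (a := a) (e := entry 8 7 8) hs0' (relax (relax^[t] W)) (by
      intro s'' hf4 i j hi hj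
      have h0' : s''.reg 0 = n := (hf4.1 0 (by simp)).trans hs0'
      rw [eval_entry 8 h0' (by decide) (by decide) hi hj]
      exact hf4.mat (by simpa using ha.symm) hM3 i j)
  refine ⟨(hf2.trans (hf3.mono (by simp) (by simp))).trans (hf5.mono (by simp) (by simp)), ?_⟩
  rw [Function.iterate_succ_apply']
  exact hM5

end Cmd

/-! ## The algorithm -/

/-- The registers of the code of a point, of the witness for its being on a cycle, and the array of
the distances after deletion of the witnessed edge. -/
def regA (b : Bool) : ℕ := bif b then 4 else 2
def regB (b : Bool) : ℕ := bif b then 5 else 3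
def regY (b : Bool) : ℕ := bif b then 525 else 524
def arrY (b : Bool) : ℕ := bif b then 7 else 6

namespace BExpr

def eqB (e f : BExpr) : BExpr := andE (leE e f) (leE f e)

/-- The length of an edge, for the graph whose edges are tested by `c`. -/
def weightE (c : BExpr) : BExpr :=
  ite (eqE 7 8) (const 0) (ite c (add (entry 2 7 8) (entry 2 7 8)) (reg 14))

/-- Half the weight of an edge. -/
def halfWeightE : BExpr :=
  add (reg 13) (powE (ltE (add (add (mulE 10) (reg 11)) (entry 0 7 8)) (mulE 0)) (const 1))

/-- The length of the half-edge at a point. -/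
def offsetE (b : Bool) : BExpr :=
  ite (eqE (regA b) (regB b)) (const 0) (entry 2 (regA b) (regB b))

/-- The length of the first `m` segments of the chain of the `k`-th guessed root. -/
def chainE (k : ℕ) : ℕ → BExpr
  | 0 => const 0
  | m + 1 => add (chainE k m) (entry 3 (20 + (40 * k + 1 + m)) (20 + (40 * k + 2 + m)))

/-- The label of the `k`-th guessed root. -/
def valueE (k : ℕ) : BExpr :=
  add (ite (reg (20 + 40 * k)) (offsetE true) (offsetE false)) (chainE k 38)

/-- The label of the vertex in register `x`, as far as it is determined by the first `k + 1`
guessed roots. -/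
def labelE (x : ℕ) : ℕ → BExpr
  | 0 => add (valueE 0) (entry 3 (20 + (40 * 0 + 39)) x)
  | k + 1 => minE (labelE x k) (add (valueE (k + 1)) (entry 3 (20 + (40 * (k + 1) + 39)) x))

/-- The edge is among the first `k` guessed ones. -/
def pairE : ℕ → BExpr
  | 0 => const 0
  | k + 1 => orE (pairE k) (orE
      (andE (eqE (20 + (480 + 2 * k)) 7) (eqE (20 + (481 + 2 * k)) 8))
      (andE (eqE (20 + (480 + 2 * k)) 8) (eqE (20 + (481 + 2 * k)) 7)))

/-- The adjacency matrix of the candidate. -/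
def candidateE : BExpr :=
  ite (andE (entry 0 7 8) (orE
    (eqB (labelE 8 11) (add (labelE 7 11) (add (entry 2 7 8) (entry 2 7 8))))
    (orE (eqB (labelE 7 11) (add (labelE 8 11) (add (entry 2 7 8) (entry 2 7 8)))) (pairE 12))))
    (const 1) (const 0)

/-- The edge belongs to the candidate and is not the witnessed one. -/
def deletedE (b : Bool) : BExpr :=
  andE (entry 4 7 8) (notE (orE (andE (eqE 7 (regA b)) (eqE 8 (regY b)))
    (andE (eqE 7 (regY b)) (eqE 8 (regA b)))))

/-- All the distances in array `a` are finite. -/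
def connE (a : ℕ) : BExpr := allE 10 (allE 11 (ltE (entry a 10 11) (reg 14)))

def countE : BExpr := sumE 10 (sumE 11 (entry 4 10 11))

def memE (b : Bool) : BExpr := orE (eqE (regA b) (regB b)) (entry 4 (regA b) (regB b))

def distE (b : Bool) (x : ℕ) : BExpr :=
  add (offsetE b) (minE (entry 5 (regA b) x) (entry 5 (regB b) x))

def centerE (b : Bool) : BExpr := allE 10 (ltE (distE b 10) (reg 15))

def lipE : BExpr :=
  allE 10 (allE 11 (orE (notE (entry 0 10 11)) (leE (maxE (distE false 11) (distE true 11))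
    (add (maxE (distE false 10) (distE true 10)) (add (entry 2 10 11) (entry 2 10 11))))))

def cycleE (b : Bool) : BExpr :=
  andE (entry 4 (regA b) (regY b)) (andE (orE (eqE (regA b) (regB b)) (eqE (regY b) (regB b)))
    (connE (arrY b)))

/-- The test of the candidate. -/
def testE : BExpr :=
  andE (connE 5) (andE (leE countE (add (reg 0) (reg 0))) (andE (andE (memE false) (memE true))
    (andE (andE (centerE false) (centerE true)) (andE lipE
      (orE (ltE countE (add (reg 0) (reg 0))) (andE (cycleE false) (cycleE true)))))))

end BExpr

namespace Cmd
open BExpr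

/-- The computations before the guesses. -/
def prelude : Cmd :=
  seq (assign 13 (powE (const 1) (const 1))) (seq
    (assign 14 (sumE 10 (add (add (reg 13) (reg 13)) (add (reg 13) (reg 13))))) (seq
    (assign 15 (powE (const 1) (add (reg 1) (const 1)))) (seq
    (fill 2 halfWeightE)
    (apsp 3 (weightE (entry 0 7 8))))))

/-- Test one guess, and write the candidate to array `1` if it passes. -/
def testGuess : Cmd :=
  seq (fill 4 candidateE) (seq (apsp 5 (weightE (entry 4 7 8))) (seq
    (apsp (arrY false) (weightE (deletedE false))) (seq
    (apsp (arrY true) (weightE (deletedE true)))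
    (ite testE (seq (fill 1 (entry 4 7 8)) (assign 16 (const 1))) skip))))

/-- Go through all values of the first `k` guessed vertices. -/
def search : ℕ → Cmd
  | 0 => testGuess
  | k + 1 => loop (20 + k) (search k)

end Cmd

/-- The algorithm. -/
def algorithm : Prog :=
  .seq ((Cmd.seq Cmd.prelude (Cmd.search 506)).compile varBound) (.assign 0 (.reg 16))

/-! ### Well-formedness -/

namespace BExpr

theorem wf_entry_iff {a x y : ℕ} : (entry a x y).WF ↔ x < varBound ∧ y < varBound := by
  have h : 17 < varBound ∧ 6 < varBound ∧ 0 < varBound := by decide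
  simp [entry, mulE, ltE, WF, h]

theorem wf_entry {a x y : ℕ} (hx : x < varBound) (hy : y < varBound) : (entry a x y).WF :=
  wf_entry_iff.2 ⟨hx, hy⟩

theorem wf_chainE {k m : ℕ} (hk : k < 12) (hm : m ≤ 38) : (chainE k m).WF := by
  induction m with
  | zero => trivial
  | succ m ih =>
    exact ⟨ih (by omega), wf_entry (by rw [varBound]; omega) (by rw [varBound]; omega)⟩

theorem wf_offsetE (b : Bool) : (offsetE b).WF := by
  cases b <;> simp [offsetE, eqE, andE, leE, WF, regA, regB, wf_entry_iff, varBound]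

theorem wf_valueE {k : ℕ} (hk : k < 12) : (valueE k).WF :=
  ⟨⟨by simp only [WF, varBound]; omega, wf_offsetE _, wf_offsetE _⟩, wf_chainE hk le_rfl⟩

theorem wf_labelE {x k : ℕ} (hx : x < varBound) (hk : k < 12) : (labelE x k).WF := by
  induction k with
  | zero => exact ⟨wf_valueE hk, wf_entry (by rw [varBound]; omega) hx⟩
  | succ k ih =>
    have h1 := ih (by omega)
    have h2 := wf_valueE hk
    have h3 : (entry 3 (20 + (40 * (k + 1) + 39)) x).WF := wf_entry (by rw [varBound]; omega) hx
    exact ⟨h1, h1, h2, h3⟩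

theorem wf_pairE {k : ℕ} (hk : k ≤ 12) : (pairE k).WF := by
  induction k with
  | zero => trivial
  | succ k ih =>
    have h1 := ih (by omega)
    simp [pairE, orE, andE, eqE, leE, WF, h1, varBound]
    omega

end BExpr

namespace Cmd
open BExpr

theorem wf_fill {a : ℕ} {e : BExpr} (he : e.WF) : (fill a e).WF := by
  refine ⟨by decide, by decide, by decide, by decide, ?_, he⟩
  simp [mulE, ltE, BExpr.WF, varBound]

theorem wf_apsp {a : ℕ} {e : BExpr} (he : e.WF) : (apsp a e).WF := by
  refine ⟨wf_fill he, by decide, by decide, wf_fill ?_, wf_fill (wf_entry (by decide) (by decide))⟩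
  simp [foldMinE, minE, BExpr.WF, wf_entry_iff, varBound]

theorem wf_weightE {c : BExpr} (hc : c.WF) : (weightE c).WF := by
  simp [weightE, eqE, andE, leE, BExpr.WF, wf_entry_iff, varBound, hc]

theorem wf_prelude : prelude.WF := by
  refine ⟨?_, ?_, ?_, wf_fill ?_, wf_apsp (wf_weightE (wf_entry (by decide) (by decide)))⟩
  · simp [WF, powE, octE, BExpr.WF, varBound]
  · simp [WF, sumE, BExpr.WF, varBound]
  · simp [WF, powE, octE, BExpr.WF, varBound]
  · simp [halfWeightE, powE, octE, ltE, mulE, BExpr.WF, wf_entry_iff, varBound]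

theorem wf_testGuess : testGuess.WF := by
  have hl7 : (labelE 7 11).WF := wf_labelE (by decide) (by decide)
  have hl8 : (labelE 8 11).WF := wf_labelE (by decide) (by decide)
  have hp : (pairE 12).WF := wf_pairE le_rfl
  have hd : ∀ b x, x < varBound → (distE b x).WF := by
    intro b x hx
    have := wf_offsetE b
    rw [varBound] at hx
    cases b <;> simp [distE, minE, BExpr.WF, wf_entry_iff, varBound, this, regA, regB, hx]
  have hd10 := fun b => hd b 10 (by decide)
  have hd11 := fun b => hd b 11 (by decide)
  have hdel : ∀ b, (deletedE b).WF := by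
    intro b
    cases b <;>
      simp [deletedE, andE, notE, orE, eqE, leE, BExpr.WF, wf_entry_iff, varBound, regA, regY]
  refine ⟨wf_fill ?_, wf_apsp (wf_weightE (wf_entry (by decide) (by decide))),
    wf_apsp (wf_weightE (hdel _)), wf_apsp (wf_weightE (hdel _)), ?_,
    ⟨wf_fill (wf_entry (by decide) (by decide)), by decide, by decide, trivial⟩, trivial⟩
  · simp [candidateE, andE, orE, eqB, leE, BExpr.WF, wf_entry_iff, varBound, hl7, hl8, hp]
  · simp [testE, connE, countE, memE, centerE, lipE, cycleE, andE, orE, notE, leE, ltE, eqE, allE,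
      sumE, maxE, BExpr.WF, wf_entry_iff, varBound, hd10, hd11, regA, regB, regY]

theorem wf_search {k : ℕ} (hk : k ≤ 506) : (search k).WF := by
  induction k with
  | zero => exact wf_testGuess
  | succ k ih => exact ⟨by omega, by rw [varBound]; omega, ih (by omega)⟩

end Cmd

/-! ### The computations before the guesses -/

section
variable {n : ℕ}

open Classical in
/-- The matrix that describes the graph in the input. -/
noncomputable def inputMatrix (G : SimpleGraph (Fin n)) (idx : Sym2 (Fin n) → ℕ)
    (i j : Fin n) : ℕ :=
  if G.Adj i j then idx s(i, j) else 0

/-- The store holds the input and the weights. -/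
structure Base (G : SimpleGraph (Fin n)) (idx : Sym2 (Fin n) → ℕ) (r : Bool → Point n)
    (s : Store) : Prop where
  size : s.reg 0 = n
  codeA : ∀ b, s.reg (regA b) = ((r b).code.1 : ℕ)
  codeB : ∀ b, s.reg (regB b) = ((r b).code.2 : ℕ)
  inf : s.reg 14 = infWeight n
  graph : s.Mat 0 (inputMatrix G idx)
  weight : s.Mat 2 fun i j => 8 ^ (n * n) + 8 ^ (n * n - inputMatrix G idx i j)

/-- The store holds in addition the threshold for the distances and the distances in `G`. -/
structure Ready (G : SimpleGraph (Fin n)) (idx : Sym2 (Fin n) → ℕ) (d : ℕ) (r : Bool → Point n)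
    (s : Store) : Prop extends Base G idx r s where
  threshold : s.reg 15 = (d + 1) * 8 ^ (n * n)
  dist : s.Mat 3 (allDist idx G)

variable {G : SimpleGraph (Fin n)} {idx : Sym2 (Fin n) → ℕ} {d : ℕ} {r : Bool → Point n}
  {s s' : Store}

theorem Base.frame (h : Base G idx r s) {R A : List ℕ} (hf : Frame R A s s')
    (hR : ∀ x ∈ [0, 2, 3, 4, 5, 14], x ∉ R) (hA : ∀ a ∈ [0, 2], a ∉ A) : Base G idx r s' where
  size := (hf.1 0 (hR 0 (by simp))).trans h.size
  codeA b := (hf.1 _ (hR _ (by cases b <;> simp [regA]))).trans (h.codeA b)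
  codeB b := (hf.1 _ (hR _ (by cases b <;> simp [regB]))).trans (h.codeB b)
  inf := (hf.1 14 (hR 14 (by simp))).trans h.inf
  graph := hf.mat (hA 0 (by simp)) h.graph
  weight := hf.mat (hA 2 (by simp)) h.weight

theorem Ready.frame (h : Ready G idx d r s) {R A : List ℕ} (hf : Frame R A s s')
    (hR : ∀ x ∈ [0, 2, 3, 4, 5, 14, 15], x ∉ R) (hA : ∀ a ∈ [0, 2, 3], a ∉ A) :
    Ready G idx d r s' where
  toBase := h.toBase.frame hf (fun x hx => hR x (by simp at hx ⊢; tauto))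
    (fun a ha => hA a (by simp at ha ⊢; tauto))
  threshold := (hf.1 15 (hR 15 (by simp))).trans h.threshold
  dist := hf.mat (hA 3 (by simp)) h.dist

theorem frame_setReg (s : Store) (x v : ℕ) : Frame [x] [] s (s.setReg x v) :=
  (Frame.refl [x] [] s).setReg (by simp) v

theorem Ready.setReg (h : Ready G idx d r s) {x : ℕ} (v : ℕ)
    (hx : x ∉ [0, 2, 3, 4, 5, 14, 15]) : Ready G idx d r (s.setReg x v) :=
  h.frame (frame_setReg s x v) (fun y hy hyx => hx (by
    rw [List.mem_singleton] at hyx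
    rwa [← hyx])) (by simp)

theorem Base.holds_graph (hidx : IsEdgeIndex G idx) (h : Base G idx r s) {x y : ℕ} {i j : Fin n}
    (hx : x ≠ 6) (hx' : x ≠ 17) (hi : s.reg x = i) (hj : s.reg y = j) :
    (BExpr.entry 0 x y).Holds s ↔ G.Adj i j := by
  rw [BExpr.Holds, BExpr.eval_entry 0 h.size hx hx' hi hj, h.graph i j, inputMatrix]
  split_ifs with hadj
  · have := (hidx.bounds (e := s(i, j)) hadj).1
    exact iff_of_true (by omega) hadj
  · exact iff_of_false (by simp) hadj

theorem Base.eval_weight (h : Base G idx r s) {x y : ℕ} {i j : Fin n}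
    (hx : x ≠ 6) (hx' : x ≠ 17) (hi : s.reg x = i) (hj : s.reg y = j) (hadj : G.Adj i j) :
    (BExpr.entry 2 x y).eval s = halfWeight idx s(i, j) := by
  rw [BExpr.eval_entry 2 h.size hx hx' hi hj, h.weight i j, halfWeight]
  simp only [inputMatrix, if_pos hadj]

theorem eval_entry_of_mat {F : Fin n → Fin n → ℕ} {a x y : ℕ} {i j : Fin n} (hF : s.Mat a F)
    (h0 : s.reg 0 = n) (hx : x ≠ 6) (hx' : x ≠ 17) (hi : s.reg x = i) (hj : s.reg y = j) :
    (BExpr.entry a x y).eval s = F i j := by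
  rw [BExpr.eval_entry a h0 hx hx' hi hj, hF i j]

/-- The computation of the distances in a subgraph of `G` whose edges are tested by `c`. -/
theorem Base.apsp_weight (h : Base G idx r s) {H : SimpleGraph (Fin n)}
    (hHG : H ≤ G) {a : ℕ} (ha : a ∉ [0, 2, 8]) {c : BExpr}
    (hc : ∀ s', Frame [7, 8] [a] s s' → ∀ i j : Fin n, s'.reg 7 = i → s'.reg 8 = j →
      (c.Holds s' ↔ H.Adj i j)) :
    Frame [7, 8, 9] [a, 8] s ((Cmd.apsp a (BExpr.weightE c)).run s) ∧
      ((Cmd.apsp a (BExpr.weightE c)).run s).Mat a (allDist idx H) := by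
  simp only [List.mem_cons, List.not_mem_nil, or_false, not_or] at ha
  refine Cmd.apsp_spec ha.2.2 h.size (weightMatrix idx H) fun s' hf i j hi hj => ?_
  have hB : Base G idx r s' := h.frame hf (by decide) (by
    simp only [List.mem_cons, List.not_mem_nil, or_false, forall_eq_or_imp, forall_eq]
    omega)
  rw [BExpr.weightE, BExpr.eval_ite, BExpr.eval_ite, weightMatrix, BExpr.holds_eqE, hi, hj,
    Fin.val_inj]
  by_cases hij : i = j
  · rw [if_pos hij, if_pos hij, BExpr.eval]
  rw [if_neg hij, if_neg hij]
  by_cases hadj : H.Adj i j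
  · rw [if_pos hadj, if_pos ((hc s' hf i j hi hj).2 hadj), BExpr.eval,
      hB.eval_weight (by decide) (by decide) hi hj (hHG hadj)]
    ring
  · rw [if_neg hadj, if_neg (mt (hc s' hf i j hi hj).1 hadj), BExpr.eval]
    exact hB.inf

theorem eval_powE_one {i : BExpr} (h0 : s.reg 0 = n) :
    (BExpr.powE (.const 1) i).eval s = i.eval s * 8 ^ (n * n) := by
  classical
  rw [BExpr.eval_powE (by simp [BExpr.Fresh]) h0]
  simp [BExpr.Holds, BExpr.eval]

/-- The input is stored. -/
structure Input (G : SimpleGraph (Fin n)) (idx : Sym2 (Fin n) → ℕ) (d : ℕ) (r : Bool → Point n)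
    (s : Store) : Prop where
  size : s.reg 0 = n
  bound : s.reg 1 = d
  codeA : ∀ b, s.reg (regA b) = ((r b).code.1 : ℕ)
  codeB : ∀ b, s.reg (regB b) = ((r b).code.2 : ℕ)
  graph : s.Mat 0 (inputMatrix G idx)

theorem prelude_spec (hidx : IsEdgeIndex G idx) (h : Input G idx d r s) :
    Ready G idx d r (Cmd.prelude.run s) ∧
      Frame [7, 8, 9, 13, 14, 15] [2, 3, 8] s (Cmd.prelude.run s) := by
  classical
  obtain ⟨hn, hd, hA, hB, hG⟩ := h
  simp only [Cmd.prelude, Cmd.run]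
  have e1 : (BExpr.powE (.const 1) (.const 1)).eval s = 8 ^ (n * n) := by
    rw [eval_powE_one hn, BExpr.eval, one_mul]
  have hf1 := frame_setReg s 13 (8 ^ (n * n))
  have h13 := s.setReg_reg_self 13 (8 ^ (n * n))
  rw [e1]
  generalize s.setReg 13 (8 ^ (n * n)) = s₁ at hf1 h13 ⊢
  have hn1 : s₁.reg 0 = n := (hf1.1 0 (by decide)).trans hn
  have e2 : (BExpr.sumE 10 (.add (.add (.reg 13) (.reg 13)) (.add (.reg 13) (.reg 13)))).eval s₁ =
      infWeight n := by
    rw [BExpr.eval_sumE (by simp [BExpr.Fresh]) hn1]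
    simp [BExpr.eval, Store.setReg, h13, infWeight]
    ring_nf
    simp
  have hf2 := frame_setReg s₁ 14 (infWeight n)
  have h14 := s₁.setReg_reg_self 14 (infWeight n)
  rw [e2]
  generalize s₁.setReg 14 (infWeight n) = s₂ at hf2 h14 ⊢
  have hn2 : s₂.reg 0 = n := (hf2.1 0 (by decide)).trans hn1
  have hd2 : s₂.reg 1 = d := (hf2.1 1 (by decide)).trans ((hf1.1 1 (by decide)).trans hd)
  -- The product starts from d + 1 and is multiplied by eight n² times, so the time does not depend
  -- on d.
  have e3 : (BExpr.powE (.const 1) (.add (.reg 1) (.const 1))).eval s₂ =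
      (d + 1) * 8 ^ (n * n) := by
    rw [eval_powE_one hn2, BExpr.eval, BExpr.eval, BExpr.eval, hd2]
  have hf3 := frame_setReg s₂ 15 ((d + 1) * 8 ^ (n * n))
  have h15 := s₂.setReg_reg_self 15 ((d + 1) * 8 ^ (n * n))
  rw [e3]
  generalize s₂.setReg 15 ((d + 1) * 8 ^ (n * n)) = s₃ at hf3 h15 ⊢
  have hf : Frame [13, 14, 15] [] s s₃ := (hf1.mono (by simp) (by simp)).trans
    ((hf2.mono (by simp) (by simp)).trans (hf3.mono (by simp) (by simp)))
  have hn3 : s₃.reg 0 = n := (hf.1 0 (by decide)).trans hn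
  have hG3 : s₃.Mat 0 (inputMatrix G idx) := hf.mat (by simp) hG
  have h13' : s₃.reg 13 = 8 ^ (n * n) :=
    (hf3.1 13 (by decide)).trans ((hf2.1 13 (by decide)).trans h13)
  have h14' : s₃.reg 14 = infWeight n := (hf3.1 14 (by decide)).trans h14
  obtain ⟨hf4, hM4⟩ := Cmd.fill_spec (a := 2) (e := BExpr.halfWeightE) hn3
    (fun i j => 8 ^ (n * n) + 8 ^ (n * n - inputMatrix G idx i j)) (by
      intro s' hf i j hi hj
      have hn' : s'.reg 0 = n := (hf.1 0 (by decide)).trans hn3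
      rw [BExpr.halfWeightE, BExpr.eval, BExpr.eval_powE
        (by simp [BExpr.Fresh, BExpr.ltE, BExpr.mulE, BExpr.entry]) hn', BExpr.eval, BExpr.eval,
        hf.1 13 (by decide), h13', one_mul, ← BExpr.sum_sum_lt]
      refine congrArg (fun k => 8 ^ (n * n) + 8 ^ k) ?_
      refine Finset.sum_congr rfl fun u hu => Finset.sum_congr rfl fun v hv => ?_
      have hu' := Finset.mem_range.1 hu
      have h0 : ((s'.setReg 10 u).setReg 11 v).reg 0 = n := by simpa [Store.setReg] using hn'
      have h7 : ((s'.setReg 10 u).setReg 11 v).reg 7 = i := by simpa [Store.setReg] using hi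
      have h8 : ((s'.setReg 10 u).setReg 11 v).reg 8 = j := by simpa [Store.setReg] using hj
      have h10 : ((s'.setReg 10 u).setReg 11 v).reg 10 = u := by simp [Store.setReg]
      have h11 : ((s'.setReg 10 u).setReg 11 v).reg 11 = v := by simp [Store.setReg]
      have hM : ((s'.setReg 10 u).setReg 11 v).Mat 0 (inputMatrix G idx) :=
        hf.mat (by decide) hG3
      generalize (s'.setReg 10 u).setReg 11 v = t at *
      refine if_congr ?_ rfl rfl
      rw [BExpr.holds_ltE, BExpr.eval_mulE h0 (by decide) (by decide) h0.le, BExpr.eval,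
        BExpr.eval, BExpr.eval_mulE h0 (by decide) (by decide) (by omega), BExpr.eval,
        eval_entry_of_mat hM h0 (by decide) (by decide) h7 h8, h0, h10, h11])
  generalize (Cmd.fill 2 BExpr.halfWeightE).run s₃ = s₄ at hf4 hM4 ⊢
  have hf04 : Frame [7, 8, 9, 13, 14, 15] [2, 3, 8] s s₄ :=
    (hf.mono (by simp) (by simp)).trans (hf4.mono (by simp) (by simp))
  have hbase : Base G idx r s₄ :=
    { size := (hf04.1 0 (by decide)).trans hn
      codeA := fun b => (hf04.1 _ (by cases b <;> decide)).trans (hA b)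
      codeB := fun b => (hf04.1 _ (by cases b <;> decide)).trans (hB b)
      inf := (hf4.1 14 (by decide)).trans h14'
      graph := hf4.mat (by decide) hG3
      weight := hM4 }
  obtain ⟨hf5, hM5⟩ := hbase.apsp_weight (H := G) (a := 3) (c := BExpr.entry 0 7 8) le_rfl
    (by decide) (fun s' hf i j hi hj => (hbase.frame hf (by decide)
      (by decide)).holds_graph hidx (by decide) (by decide) hi hj)
  refine ⟨⟨hbase.frame hf5 (by decide) (by decide), ?_, hM5⟩,
    hf04.trans (hf5.mono (by simp) (by simp))⟩
  rw [hf5.1 15 (by decide), hf4.1 15 (by decide), h15]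

end

/-! ### One guess -/

section
variable {n : ℕ} {G Q : SimpleGraph (Fin n)} {idx : Sym2 (Fin n) → ℕ} {d : ℕ}
  {r : Bool → Point n} {s s' : Store} {g : ℕ → Fin n} {y : Bool → Fin n}

/-- The registers of the guessed vertices hold `g`. -/
def Digits (s : Store) (g : ℕ → Fin n) : Prop := ∀ k < 506, s.reg (20 + k) = (g k : ℕ)

theorem Digits.frame (h : Digits s g) {R A : List ℕ} (hf : Frame R A s s')
    (hR : ∀ x ∈ R, x < 20) : Digits s' g := fun k hk =>
  (hf.1 _ fun h' => absurd (hR _ h') (by omega)).trans (h k hk)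

theorem regA_ne (b : Bool) : regA b ≠ 6 ∧ regA b ≠ 17 := by cases b <;> decide

theorem Base.eval_offset (h : Base G idx r s) (hr : ∀ b, r b ∈ points G) (b : Bool) :
    (BExpr.offsetE b).eval s = natLen idx (r b).half := by
  have h1 := h.codeA b
  have h2 := h.codeB b
  have h3 := hr b
  rw [BExpr.offsetE, BExpr.eval_ite, BExpr.holds_eqE, h1, h2, Fin.val_inj]
  rcases hb : r b with v | e
  · simp [Point.code, BExpr.eval, Point.half]
  · rw [hb] at h1 h2 h3
    have hadj : G.Adj (Point.code (Sum.inr e)).1 (Point.code (Sum.inr e)).2 :=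
      ((mem_points_iff h3).1 h3).resolve_left (Point.code_inr_ne h3)
    rw [if_neg (Point.code_inr_ne h3), h.eval_weight (regA_ne b).1 (regA_ne b).2 h1 h2 hadj]
    simp only [Point.code, mk_inf_sup, Point.half, natLen_cons, natLen_nil, add_zero]

theorem Ready.eval_chain (h : Ready G idx d r s) (hg : Digits s g) {k m : ℕ} (hk : k < 12)
    (hm : m ≤ 38) : (BExpr.chainE k m).eval s = ∑ j ∈ Finset.range m,
      allDist idx G (g (40 * k + 1 + j)) (g (40 * k + 2 + j)) := by
  induction m with
  | zero => rfl
  | succ m ih =>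
    rw [Finset.sum_range_succ, BExpr.chainE, BExpr.eval, ih (by omega),
      eval_entry_of_mat h.dist h.size (by omega) (by omega) (hg _ (by omega)) (hg _ (by omega))]

theorem Ready.eval_value (h : Ready G idx d r s) (hr : ∀ b, r b ∈ points G) (hg : Digits s g)
    {k : ℕ} (hk : k < 12) : (BExpr.valueE k).eval s =
      guessValue (allDist idx G) (fun b => natLen idx (r b).half) g k := by
  rw [BExpr.valueE, BExpr.eval, h.eval_chain hg hk le_rfl, guessValue, BExpr.eval,
    h.eval_offset hr, h.eval_offset hr, BExpr.eval, hg _ (by omega)]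
  congr 1
  split_ifs <;> first | rfl | contradiction

theorem Ready.eval_label (h : Ready G idx d r s) (hr : ∀ b, r b ∈ points G) (hg : Digits s g)
    {x : ℕ} {v : Fin n} (hv : s.reg x = v) : (BExpr.labelE x 11).eval s =
      guessLabel (allDist idx G) (fun b => natLen idx (r b).half) g v := by
  have key : ∀ k < 12, (BExpr.labelE x k).eval s = minUpTo (fun k =>
      guessValue (allDist idx G) (fun b => natLen idx (r b).half) g k +
        allDist idx G (g (40 * k + 39)) v) k := by
    intro k
    induction k with
    | zero =>
      intro hk
      rw [BExpr.labelE, BExpr.eval, h.eval_value hr hg hk, minUpTo,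
        eval_entry_of_mat h.dist h.size (by omega) (by omega) (hg _ (by omega)) hv]
    | succ k ih =>
      intro hk
      rw [BExpr.labelE, BExpr.eval_minE, ih (by omega), BExpr.eval, h.eval_value hr hg hk, minUpTo,
        eval_entry_of_mat h.dist h.size (by omega) (by omega) (hg _ (by omega)) hv]
  exact key 11 (by omega)

theorem holds_pairE (hg : Digits s g) {i j : Fin n} (hi : s.reg 7 = i) (hj : s.reg 8 = j) :
    (BExpr.pairE 12).Holds s ↔ ∃ k < 12, (g (480 + 2 * k) = i ∧ g (481 + 2 * k) = j) ∨
        (g (480 + 2 * k) = j ∧ g (481 + 2 * k) = i) := by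
  have key : ∀ m ≤ 12, (BExpr.pairE m).Holds s ↔
      ∃ k < m, (g (480 + 2 * k) = i ∧ g (481 + 2 * k) = j) ∨
        (g (480 + 2 * k) = j ∧ g (481 + 2 * k) = i) := by
    intro m
    induction m with
    | zero => simp [BExpr.pairE, BExpr.Holds, BExpr.eval]
    | succ m ih =>
      intro hm
      rw [Nat.exists_lt_succ_right, ← ih (by omega)]
      simp only [BExpr.pairE, BExpr.holds_orE, BExpr.holds_andE, BExpr.holds_eqE, hi, hj,
        hg (480 + 2 * m) (by omega), hg (481 + 2 * m) (by omega), Fin.val_inj]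
  exact key 12 le_rfl

open Classical in
/-- The adjacency matrix with entries `0` and `1`. -/
noncomputable def indicator (Q : SimpleGraph (Fin n)) (i j : Fin n) : ℕ :=
  if Q.Adj i j then 1 else 0

theorem indicator_ne_zero {i j : Fin n} : indicator Q i j ≠ 0 ↔ Q.Adj i j := by
  simp [indicator]

theorem Ready.eval_candidate (hidx : IsEdgeIndex G idx) (h : Ready G idx d r s)
    (hr : ∀ b, r b ∈ points G) (hg : Digits s g) {i j : Fin n} (hi : s.reg 7 = i)
    (hj : s.reg 8 = j) : BExpr.candidateE.eval s = indicator
      (guessGraph G idx (allDist idx G) (fun b => natLen idx (r b).half) g) i j := by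
  have key : ((BExpr.entry 0 7 8).andE
      (((BExpr.labelE 8 11).eqB ((BExpr.labelE 7 11).add ((BExpr.entry 2 7 8).add
        (BExpr.entry 2 7 8)))).orE (((BExpr.labelE 7 11).eqB ((BExpr.labelE 8 11).add
        ((BExpr.entry 2 7 8).add (BExpr.entry 2 7 8)))).orE (BExpr.pairE 12)))).Holds s ↔
      (guessGraph G idx (allDist idx G) (fun b => natLen idx (r b).half) g).Adj i j := by
    rw [BExpr.holds_andE, h.holds_graph hidx (by decide) (by decide) hi hj]
    refine and_congr_right fun hadj => ?_
    simp only [BExpr.holds_orE, BExpr.eqB, BExpr.holds_andE, BExpr.holds_leE, BExpr.eval,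
      h.eval_label hr hg hi, h.eval_label hr hg hj, holds_pairE hg hi hj,
      h.eval_weight (by decide) (by decide) hi hj hadj, ← two_mul]
    simp only [← le_antisymm_iff]
  rw [BExpr.candidateE, BExpr.eval_ite, indicator]
  by_cases hQ : (guessGraph G idx (allDist idx G) (fun b => natLen idx (r b).half) g).Adj i j
  · rw [if_pos (key.2 hQ), if_pos hQ, BExpr.eval]
  · rw [if_neg (mt key.1 hQ), if_neg hQ, BExpr.eval]

/-- The store holds the candidate `Q`, the witnesses, and the distances needed for the test. -/
structure Tested (G : SimpleGraph (Fin n)) (idx : Sym2 (Fin n) → ℕ) (d : ℕ) (r : Bool → Point n)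
    (Q : SimpleGraph (Fin n)) (y : Bool → Fin n) (s : Store) : Prop
    extends Ready G idx d r s where
  cand : s.Mat 4 (indicator Q)
  candDist : s.Mat 5 (allDist idx Q)
  witness : ∀ b, s.reg (regY b) = (y b : ℕ)
  delDist : ∀ b, s.Mat (arrY b) (allDist idx (Q.deleteEdges {s((r b).code.1, y b)}))

theorem Tested.setReg (h : Tested G idx d r Q y s) {x : ℕ} (v : ℕ)
    (hx : x ∉ [0, 2, 3, 4, 5, 14, 15, 524, 525]) : Tested G idx d r Q y (s.setReg x v) where
  toReady := h.toReady.setReg v (by simp at hx ⊢; tauto)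
  cand := h.cand
  candDist := h.candDist
  witness b := (Store.setReg_reg_of_ne _ _ (by
    rintro rfl
    exact hx (by cases b <;> simp [regY]))).trans (h.witness b)
  delDist := h.delDist

theorem holds_connE {a : ℕ} {D : Fin n → Fin n → ℕ} (h : Base G idx r s) (hD : s.Mat a D) :
    (BExpr.connE a).Holds s ↔ ∀ i j, D i j < infWeight n := by
  rw [BExpr.connE, BExpr.holds_allE (n := n)
    (by simp [BExpr.Fresh, BExpr.allE, BExpr.ltE, BExpr.entry, BExpr.mulE]) h.size]
  refine forall_congr' fun i => ?_
  have h1 : Base G idx r (s.setReg 10 i) := h.frame (frame_setReg s 10 i) (by decide) (by decide)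
  have e1 : (s.setReg 10 i).reg 10 = i := Store.setReg_reg_self _ _ _
  have hD1 : (s.setReg 10 i).Mat a D := hD
  generalize s.setReg 10 i = s₁ at *
  rw [BExpr.holds_allE (n := n)
    (by simp [BExpr.Fresh, BExpr.ltE, BExpr.entry, BExpr.mulE]) h1.size]
  refine forall_congr' fun j => ?_
  have h2 : Base G idx r (s₁.setReg 11 j) :=
    h1.frame (frame_setReg s₁ 11 j) (by decide) (by decide)
  have e2 : (s₁.setReg 11 j).reg 11 = j := Store.setReg_reg_self _ _ _
  have e1' : (s₁.setReg 11 j).reg 10 = i := (Store.setReg_reg_of_ne _ _ (by decide)).trans e1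
  have hD2 : (s₁.setReg 11 j).Mat a D := hD1
  rw [BExpr.holds_ltE, BExpr.eval, h2.inf,
    eval_entry_of_mat hD2 h2.size (by decide) (by decide) e1' e2]

theorem Tested.eval_count (h : Tested G idx d r Q y s) : BExpr.countE.eval s = adjCount Q := by
  rw [BExpr.countE, BExpr.eval_sumE (n := n)
    (by simp [BExpr.Fresh, BExpr.sumE, BExpr.entry, BExpr.mulE]) h.size, adjCount]
  refine Finset.sum_congr rfl fun i _ => ?_
  have h1 := h.setReg (x := 10) i (by decide)
  have e1 : (s.setReg 10 i).reg 10 = i := Store.setReg_reg_self _ _ _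
  generalize s.setReg 10 i = s₁ at *
  rw [BExpr.eval_sumE (n := n) (by simp [BExpr.Fresh, BExpr.entry, BExpr.mulE]) h1.size]
  refine Finset.sum_congr rfl fun j _ => ?_
  have h2 := h1.setReg (x := 11) j (by decide)
  have e2 : (s₁.setReg 11 j).reg 11 = j := Store.setReg_reg_self _ _ _
  have e1' : (s₁.setReg 11 j).reg 10 = i := (Store.setReg_reg_of_ne _ _ (by decide)).trans e1
  exact eval_entry_of_mat h2.cand h2.size (by decide) (by decide) e1' e2

theorem Tested.eval_dist (h : Tested G idx d r Q y s) (hr : ∀ b, r b ∈ points G) (b : Bool)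
    {x : ℕ} {v : Fin n} (hv : s.reg x = v) :
    (BExpr.distE b x).eval s = codeDist idx (allDist idx Q) (r b) v := by
  rw [BExpr.distE, BExpr.eval, h.eval_offset hr, BExpr.eval_minE,
    eval_entry_of_mat h.candDist h.size (regA_ne b).1 (regA_ne b).2 (h.codeA b) hv,
    eval_entry_of_mat h.candDist h.size (by cases b <;> decide) (by cases b <;> decide)
      (h.codeB b) hv, codeDist]

theorem fresh_distE (b : Bool) {x : ℕ} (hx : x ≠ 6) : (BExpr.distE b x).Fresh 6 := by
  cases b <;> simp [BExpr.distE, BExpr.offsetE, BExpr.minE, BExpr.eqE, BExpr.andE, BExpr.leE,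
    BExpr.Fresh, BExpr.entry, BExpr.mulE, regA, regB, hx]

theorem Tested.holds_mem (h : Tested G idx d r Q y s) (b : Bool) :
    (BExpr.memE b).Holds s ↔ (r b).code.1 = (r b).code.2 ∨ Q.Adj (r b).code.1 (r b).code.2 := by
  rw [BExpr.memE, BExpr.holds_orE, BExpr.holds_eqE, h.codeA, h.codeB, Fin.val_inj, BExpr.Holds,
    eval_entry_of_mat h.cand h.size (regA_ne b).1 (regA_ne b).2 (h.codeA b) (h.codeB b),
    indicator_ne_zero]

theorem Tested.holds_center (h : Tested G idx d r Q y s) (hr : ∀ b, r b ∈ points G) (b : Bool) :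
    (BExpr.centerE b).Holds s ↔
      ∀ v, codeDist idx (allDist idx Q) (r b) v < (d + 1) * 8 ^ (n * n) := by
  rw [BExpr.centerE, BExpr.holds_allE (n := n) (by
    simp [BExpr.Fresh, BExpr.ltE, fresh_distE b (x := 10) (by decide)]) h.size]
  refine forall_congr' fun v => ?_
  have h1 := h.setReg (x := 10) v (by decide)
  rw [BExpr.holds_ltE, h1.eval_dist hr b (Store.setReg_reg_self _ _ _), BExpr.eval, h1.threshold]

theorem Tested.holds_lip (hidx : IsEdgeIndex G idx) (h : Tested G idx d r Q y s)
    (hr : ∀ b, r b ∈ points G) : BExpr.lipE.Holds s ↔ ∀ u v, G.Adj u v →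
      max (codeDist idx (allDist idx Q) (r false) v) (codeDist idx (allDist idx Q) (r true) v) ≤
      max (codeDist idx (allDist idx Q) (r false) u) (codeDist idx (allDist idx Q) (r true) u) +
        2 * halfWeight idx s(u, v) := by
  have hf := fun b => fresh_distE b (x := 10) (by decide)
  have hf' := fun b => fresh_distE b (x := 11) (by decide)
  rw [BExpr.lipE, BExpr.holds_allE (n := n) (by simp [BExpr.Fresh, BExpr.allE]) h.size]
  refine forall_congr' fun u => ?_
  have h1 := h.setReg (x := 10) u (by decide)
  have e1 : (s.setReg 10 u).reg 10 = u := Store.setReg_reg_self _ _ _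
  generalize s.setReg 10 u = s₁ at *
  rw [BExpr.holds_allE (n := n) (by simp [BExpr.Fresh, BExpr.orE, BExpr.notE, BExpr.leE,
    BExpr.maxE, BExpr.entry, BExpr.mulE, hf, hf']) h1.size]
  refine forall_congr' fun v => ?_
  have h2 := h1.setReg (x := 11) v (by decide)
  have e2 : (s₁.setReg 11 v).reg 11 = v := Store.setReg_reg_self _ _ _
  have e1' : (s₁.setReg 11 v).reg 10 = u := (Store.setReg_reg_of_ne _ _ (by decide)).trans e1
  rw [BExpr.holds_orE, BExpr.holds_notE, h2.holds_graph hidx (by decide) (by decide) e1' e2,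
    ← imp_iff_not_or]
  refine imp_congr_right fun hadj => ?_
  rw [BExpr.holds_leE, BExpr.eval_maxE, BExpr.eval, BExpr.eval_maxE, BExpr.eval,
    h2.eval_dist hr _ e1', h2.eval_dist hr _ e1', h2.eval_dist hr _ e2, h2.eval_dist hr _ e2,
    h2.eval_weight (by decide) (by decide) e1' e2 hadj, ← two_mul]

theorem Tested.holds_cycle (h : Tested G idx d r Q y s) (b : Bool) :
    (BExpr.cycleE b).Holds s ↔ Q.Adj (r b).code.1 (y b) ∧
      ((r b).code.1 = (r b).code.2 ∨ y b = (r b).code.2) ∧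
      ∀ i j, allDist idx (Q.deleteEdges {s((r b).code.1, y b)}) i j < infWeight n := by
  rw [BExpr.cycleE, BExpr.holds_andE, BExpr.holds_andE, BExpr.holds_orE, BExpr.holds_eqE,
    BExpr.holds_eqE, holds_connE h.toBase (h.delDist b), h.codeA, h.codeB, h.witness, Fin.val_inj,
    Fin.val_inj, BExpr.Holds, eval_entry_of_mat h.cand h.size (regA_ne b).1 (regA_ne b).2
      (h.codeA b) (h.witness b), indicator_ne_zero]

theorem Tested.holds_test (hidx : IsEdgeIndex G idx) (h : Tested G idx d r Q y s)
    (hr : ∀ b, r b ∈ points G) : BExpr.testE.Holds s ↔ Passes G idx d r Q y := by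
  have h2n : (BExpr.add (.reg 0) (.reg 0)).eval s = n + n := by
    rw [BExpr.eval, BExpr.eval, h.size]
  simp only [BExpr.testE, BExpr.holds_andE, BExpr.holds_orE, holds_connE h.toBase h.candDist,
    BExpr.holds_leE, BExpr.holds_ltE, h.eval_count, h2n, h.holds_mem, h.holds_center hr,
    h.holds_lip hidx hr, h.holds_cycle]
  constructor
  · rintro ⟨h1, h2, h3, h4, h5, h6⟩
    exact ⟨h1, h2, Bool.forall_bool.2 h3, Bool.forall_bool.2 h4, h5, h6.imp_right Bool.forall_bool.2⟩
  · rintro ⟨h1, h2, h3, h4, h5, h6⟩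
    exact ⟨h1, h2, Bool.forall_bool.1 h3, Bool.forall_bool.1 h4, h5, h6.imp_right Bool.forall_bool.1⟩

theorem holds_deletedE (h : Base G idx r s) (hQ : s.Mat 4 (indicator Q))
    (hy : ∀ b, s.reg (regY b) = (y b : ℕ)) (b : Bool) {i j : Fin n} (hi : s.reg 7 = i)
    (hj : s.reg 8 = j) :
    (BExpr.deletedE b).Holds s ↔ (Q.deleteEdges {s((r b).code.1, y b)}).Adj i j := by
  rw [BExpr.deletedE, BExpr.holds_andE, BExpr.Holds, eval_entry_of_mat hQ h.size (by decide)
    (by decide) hi hj, indicator_ne_zero, SimpleGraph.deleteEdges_adj, Set.mem_singleton_iff,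
    Sym2.eq_iff]
  simp only [BExpr.holds_notE, BExpr.holds_orE, BExpr.holds_andE, BExpr.holds_eqE, hi, hj,
    h.codeA, hy, Fin.val_inj]

/-- A failing guess leaves the flag and the output array alone, so an earlier success is never
destroyed. -/
theorem testGuess_spec (hidx : IsEdgeIndex G idx) (h : Ready G idx d r s)
    (hr : ∀ b, r b ∈ points G) (hg : Digits s g)
    (hQ : Q = guessGraph G idx (allDist idx G) (fun b => natLen idx (r b).half) g)
    (hy : y = fun b => bif b then g 505 else g 504) :
    Frame [7, 8, 9, 16] [1, 4, 5, 6, 7, 8] s (Cmd.testGuess.run s) ∧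
      (Passes G idx d r Q y → (Cmd.testGuess.run s).reg 16 = 1 ∧
        (Cmd.testGuess.run s).Mat 1 (indicator Q)) ∧
      (¬ Passes G idx d r Q y → (Cmd.testGuess.run s).reg 16 = s.reg 16 ∧
        (Cmd.testGuess.run s).arr 1 = s.arr 1) := by
  have hQG : Q ≤ G := hQ ▸ guessGraph_le _ _ _ _ _
  simp only [Cmd.testGuess, Cmd.run]
  obtain ⟨hf1, hM1⟩ := Cmd.fill_spec (a := 4) (e := BExpr.candidateE) h.size (indicator Q)
    (fun s' hf i j hi hj => by
      rw [hQ]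
      exact (h.frame hf (by decide) (by decide)).eval_candidate hidx hr (hg.frame hf (by decide))
        hi hj)
  generalize (Cmd.fill 4 BExpr.candidateE).run s = s₁ at *
  have h1 : Ready G idx d r s₁ := h.frame hf1 (by decide) (by decide)
  have hw1 : ∀ b, s₁.reg (regY b) = (y b : ℕ) := by
    intro b
    have hg1 := hg.frame hf1 (by decide)
    cases b
    · exact (hg1 504 (by omega)).trans (by rw [hy]; rfl)
    · exact (hg1 505 (by omega)).trans (by rw [hy]; rfl)
  obtain ⟨hf2, hM2⟩ := h1.apsp_weight hQG (a := 5) (c := BExpr.entry 4 7 8) (by decide)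
    (fun s' hf i j hi hj => by
      rw [BExpr.Holds, eval_entry_of_mat (hf.mat (by decide) hM1) ((hf.1 0 (by decide)).trans h1.size)
        (by decide) (by decide) hi hj, indicator_ne_zero])
  generalize (Cmd.apsp 5 (BExpr.weightE (BExpr.entry 4 7 8))).run s₁ = s₂ at *
  have h2 : Ready G idx d r s₂ := h1.frame hf2 (by decide) (by decide)
  have hM12 : s₂.Mat 4 (indicator Q) := hf2.mat (by decide) hM1
  have hw2 : ∀ b, s₂.reg (regY b) = (y b : ℕ) := fun b =>
    (hf2.1 _ (by cases b <;> decide)).trans (hw1 b)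
  have hdel : ∀ b, Q.deleteEdges {s((r b).code.1, y b)} ≤ G := fun b =>
    (SimpleGraph.deleteEdges_le _).trans hQG
  obtain ⟨hf3, hM3⟩ := h2.apsp_weight (hdel false) (a := arrY false) (c := BExpr.deletedE false)
    (by decide) (fun s' hf i j hi hj => holds_deletedE (h2.toBase.frame hf (by decide) (by decide))
      (hf.mat (by decide) hM12)
      (fun b => (hf.1 _ (by cases b <;> decide)).trans (hw2 b)) false hi hj)
  generalize (Cmd.apsp (arrY false) (BExpr.weightE (BExpr.deletedE false))).run s₂ = s₃ at *
  have h3 : Ready G idx d r s₃ := h2.frame hf3 (by decide) (by decide)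
  have hM13 : s₃.Mat 4 (indicator Q) := hf3.mat (by decide) hM12
  have hw3 : ∀ b, s₃.reg (regY b) = (y b : ℕ) := fun b =>
    (hf3.1 _ (by cases b <;> decide)).trans (hw2 b)
  obtain ⟨hf4, hM4⟩ := h3.apsp_weight (hdel true) (a := arrY true) (c := BExpr.deletedE true)
    (by decide) (fun s' hf i j hi hj => holds_deletedE (h3.toBase.frame hf (by decide) (by decide))
      (hf.mat (by decide) hM13)
      (fun b => (hf.1 _ (by cases b <;> decide)).trans (hw3 b)) true hi hj)
  generalize (Cmd.apsp (arrY true) (BExpr.weightE (BExpr.deletedE true))).run s₃ = s₄ at *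
  have h4 : Tested G idx d r Q y s₄ :=
    { toReady := h3.frame hf4 (by decide) (by decide)
      cand := hf4.mat (by decide) hM13
      candDist := hf4.mat (by decide) (hf3.mat (by decide) hM2)
      witness := fun b => (hf4.1 _ (by cases b <;> decide)).trans (hw3 b)
      delDist := fun b => by
        cases b
        · exact hf4.mat (by decide) hM3
        · exact hM4 }
  have hf : Frame [7, 8, 9] [4, 5, 6, 7, 8] s s₄ :=
    (hf1.mono (by simp) (by simp)).trans ((hf2.mono (by simp) (by simp)).trans
      ((hf3.mono (by simp) (by simp [arrY])).trans (hf4.mono (by simp) (by simp [arrY]))))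
  have htest := h4.holds_test hidx hr
  rw [BExpr.Holds] at htest
  by_cases hp : Passes G idx d r Q y
  · rw [if_pos (htest.2 hp)]
    obtain ⟨hf5, hM5⟩ := Cmd.fill_spec (a := 1) (e := BExpr.entry 4 7 8) h4.size (indicator Q)
      (fun s' hf i j hi hj => eval_entry_of_mat (hf.mat (by decide) h4.cand)
        ((hf.1 0 (by decide)).trans h4.size) (by decide) (by decide) hi hj)
    refine ⟨((hf.mono (by simp) (by simp)).trans (hf5.mono (by simp) (by simp))).setReg (by simp) _,
      fun _ => ⟨Store.setReg_reg_self _ _ _, hM5⟩, fun h' => absurd hp h'⟩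
  · rw [if_neg (mt htest.1 hp)]
    exact ⟨hf.mono (by simp) (by simp), fun h' => absurd h' hp,
      fun _ => ⟨hf.1 16 (by decide), hf.2 1 (by decide)⟩⟩

/-! ### The search -/

/-- The output so far is correct: if the flag is set, then array `1` holds a good triplet. -/
def Sound (G : SimpleGraph (Fin n)) (idx : Sym2 (Fin n) → ℕ) (d : ℕ) (r : Bool → Point n)
    (s : Store) : Prop :=
  s.reg 16 = 0 ∨ s.reg 16 = 1 ∧ ∃ Q : SimpleGraph (Fin n),
    Reconf G d (r false) (r true) Q ∧ IsGood G idx (r false) (r true) Q ∧ s.Mat 1 (indicator Q)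

/-- The guess `g` succeeds. -/
def Succeeds (G : SimpleGraph (Fin n)) (idx : Sym2 (Fin n) → ℕ) (d : ℕ) (r : Bool → Point n)
    (g : ℕ → Fin n) : Prop :=
  Passes G idx d r (guessGraph G idx (allDist idx G) (fun b => natLen idx (r b).half) g)
    (fun b => bif b then g 505 else g 504)

/-- The entries from `k` on are fixed by the outer loops, and the search covers every guess that
agrees with them there. The flag is never reset, so one success suffices. -/
theorem search_spec (hidx : IsEdgeIndex G idx) (hr : ∀ b, r b ∈ points G)
    (hne : r false ≠ r true) (k : ℕ) (hk : k ≤ 506) (s : Store) (h : Ready G idx d r s)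
    (hs : Sound G idx d r s) (hlt : ∀ m, k ≤ m → m < 506 → s.reg (20 + m) < n) :
    Ready G idx d r ((Cmd.search k).run s) ∧ Sound G idx d r ((Cmd.search k).run s) ∧
      (∀ m, k ≤ m → m < 506 → ((Cmd.search k).run s).reg (20 + m) = s.reg (20 + m)) ∧
      (s.reg 16 = 1 → ((Cmd.search k).run s).reg 16 = 1) ∧
      ∀ g : ℕ → Fin n, (∀ m, k ≤ m → m < 506 → s.reg (20 + m) = (g m : ℕ)) →
        Succeeds G idx d r g → ((Cmd.search k).run s).reg 16 = 1 := by
  induction k generalizing s with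
  | zero =>
    have hn := two_le_of_points (hr false) (hr true) hne
    obtain ⟨g, hg⟩ : ∃ g : ℕ → Fin n, Digits s g :=
      ⟨fun m => if hm : m < 506 then ⟨s.reg (20 + m), hlt m (Nat.zero_le m) hm⟩ else ⟨0, by omega⟩,
        fun m hm => by simp [hm]⟩
    obtain ⟨hf, hpos, hneg⟩ := testGuess_spec hidx h hr hg rfl rfl
    rw [Cmd.search]
    refine ⟨h.frame hf (by decide) (by decide), ?_, fun m _ _ => hf.1 _ ?_, fun h1 => ?_,
      fun g' hg' hp => ?_⟩
    · by_cases hp : Succeeds G idx d r g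
      · obtain ⟨h1, h2⟩ := hpos hp
        obtain ⟨h3, h4⟩ := (exists_passes_iff hidx hr hne (guessGraph_le _ _ _ _ _)).1 ⟨_, hp⟩
        exact .inr ⟨h1, _, h3, h4, h2⟩
      · obtain ⟨h1, h2⟩ := hneg hp
        rw [Sound, h1]
        refine hs.imp_right ?_
        rintro ⟨h3, Q, h4, h5, h6⟩
        refine ⟨h3, Q, h4, h5, fun i j => ?_⟩
        rw [h2]
        exact h6 i j
    · simp only [List.mem_cons, List.not_mem_nil, or_false]
      omega
    · by_cases hp : Succeeds G idx d r g
      · exact (hpos hp).1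
      · exact (hneg hp).1.trans h1
    · exact (testGuess_spec hidx h hr (g := g') (fun m hm => hg' m (Nat.zero_le m) hm) rfl rfl).2.1
        hp |>.1
  | succ k ih =>
    rw [Cmd.search]
    have key := Cmd.run_loop_induct (c := Cmd.search k) (x := 20 + k) (fun t s' =>
      Ready G idx d r s' ∧ Sound G idx d r s' ∧
      (∀ m, k + 1 ≤ m → m < 506 → s'.reg (20 + m) = s.reg (20 + m)) ∧
      (s.reg 16 = 1 → s'.reg 16 = 1) ∧
      -- After `t` rounds, the guesses whose entry `k` is below `t` have been tried.
      ∀ g : ℕ → Fin n, (∀ m, k + 1 ≤ m → m < 506 → s.reg (20 + m) = (g m : ℕ)) → (g k : ℕ) < t →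
        Succeeds G idx d r g → s'.reg 16 = 1) h.size
      ⟨h, hs, fun _ _ _ => rfl, id, fun _ _ h' => absurd h' (Nat.not_lt_zero _)⟩ ?_
    · exact ⟨key.1, key.2.1, key.2.2.1, key.2.2.2.1, fun g hg => key.2.2.2.2 g hg (g k).2⟩
    rintro t ht s' ⟨h1, h2, h3, h4, h5⟩
    have hreg : ∀ x, x ≠ 20 + k → (s'.setReg (20 + k) t).reg x = s'.reg x := fun x hx =>
      Store.setReg_reg_of_ne _ _ hx
    have hself : (s'.setReg (20 + k) t).reg (20 + k) = t := Store.setReg_reg_self _ _ _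
    obtain ⟨i1, i2, i3, i4, i5⟩ := ih (by omega) (s'.setReg (20 + k) t)
      (h1.setReg _ (by simp only [List.mem_cons, List.not_mem_nil, or_false]; omega))
      (by
        rw [Sound, hreg 16 (by omega)]
        exact h2)
      (by
        intro m hm hm'
        rcases Nat.eq_or_lt_of_le hm with rfl | hm
        · rw [hself]
          exact ht
        · rw [hreg _ (by omega), h3 m hm hm']
          exact hlt m hm hm')
    refine ⟨i1, i2, fun m hm hm' => ?_, fun hf => i4 ?_, fun g hg hgt hp => ?_⟩
    · rw [i3 m (by omega) hm', hreg _ (by omega), h3 m hm hm']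
    · rw [hreg 16 (by omega)]
      exact h4 hf
    · rcases Nat.lt_succ_iff_lt_or_eq.1 hgt with hgt | hgt
      · refine i4 ?_
        rw [hreg 16 (by omega)]
        exact h5 g hg hgt hp
      · refine i5 g (fun m hm hm' => ?_) hp
        rcases Nat.eq_or_lt_of_le hm with rfl | hm
        · rw [hself, hgt]
        · rw [hreg _ (by omega), h3 m hm hm', hg m hm hm']

theorem input_inputStore (G : SimpleGraph (Fin n)) (idx : Sym2 (Fin n) → ℕ) (d : ℕ)
    (r : Bool → Point n) :
    Input G idx d r (inputStore G idx d (r false) (r true)) where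
  size := rfl
  bound := rfl
  codeA b := by cases b <;> simp [inputStore, regA, pointCode_eq]
  codeB b := by cases b <;> simp [inputStore, regB, pointCode_eq]
  graph i j := by
    have hlt : (i : ℕ) * n + j < n * n := by
      have := Nat.mul_le_mul_right n (Nat.succ_le_iff.2 i.2)
      rw [Nat.succ_mul] at this
      have := j.2
      omega
    have h0 : 0 < n := by have := i.2; omega
    have hi : Fin.divNat ⟨i * n + j, hlt⟩ = i := by
      ext
      rw [Fin.coe_divNat]
      show ((i : ℕ) * n + j) / n = i
      rw [mul_comm, Nat.mul_add_div h0, Nat.div_eq_of_lt j.2, add_zero]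
    have hj : Fin.modNat ⟨i * n + j, hlt⟩ = j := by
      ext
      rw [Fin.coe_modNat]
      show ((i : ℕ) * n + j) % n = j
      rw [mul_comm, Nat.mul_add_mod, Nat.mod_eq_of_lt j.2]
    simp only [inputStore, inputMatrix, hlt, and_self, dif_pos]
    rw [hi, hj]

end

theorem mainTheorem6 :
    ∃ (A : Prog) (p : Polynomial ℕ),
      ∀ (n : ℕ) (G : SimpleGraph (Fin n)) (idx : Sym2 (Fin n) → ℕ) (d : ℕ) (r₁ r₂ : Point n),
        IsEdgeIndex G idx → 0 < d → r₁ ∈ points G → r₂ ∈ points G → r₁ ≠ r₂ →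
        ∃ (t : ℕ) (s : Store),
          Exec A (inputStore G idx d r₁ r₂) t s ∧ t ≤ p.eval n ∧
          ((∃ Q : SimpleGraph (Fin n),
              Reconf G d r₁ r₂ Q ∧ IsGood G idx r₁ r₂ Q ∧ OutputsGraph s Q) ∨
            ((¬ ∃ Q : SimpleGraph (Fin n), Reconf G d r₁ r₂ Q ∧ IsGood G idx r₁ r₂ Q) ∧
              OutputsNone s)) := by
  have hwf : (Cmd.seq Cmd.prelude (Cmd.search 506)).WF := ⟨Cmd.wf_prelude, Cmd.wf_search le_rfl⟩
  obtain ⟨p, hp⟩ := Cmd.exec_compile _ hwf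
  refine ⟨algorithm, p + 2, fun n G idx d r₁ r₂ hidx _ hr₁ hr₂ hne => ?_⟩
  let r : Bool → Point n := fun b => bif b then r₂ else r₁
  have hr : ∀ b, r b ∈ points G := fun b => by cases b <;> assumption
  obtain ⟨t, s, hexec, ht, hagree, -⟩ := hp varBound le_rfl (inputStore G idx d r₁ r₂)
  obtain ⟨hready, hframe⟩ := prelude_spec hidx (input_inputStore G idx d r)
  have hzero : (Cmd.prelude.run (inputStore G idx d r₁ r₂)).reg 16 = 0 := hframe.1 16 (by decide)
  obtain ⟨-, hsound, -, -, hcomplete⟩ := search_spec hidx hr hne 506 le_rfl _ hready (.inl hzero)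
    (fun m hm hm' => absurd hm (by omega))
  change (Cmd.run (Cmd.search 506) (Cmd.prelude.run (inputStore G idx d r₁ r₂))).Agree _ s at hagree
  change Sound G idx d r
    (Cmd.run (Cmd.search 506) (Cmd.prelude.run (inputStore G idx d r₁ r₂))) at hsound
  have h16 := hagree.2 16 (by decide)
  -- Register `0` has to hold n for all loops, so the flag is moved there only at the end, in two
  -- more steps.
  refine ⟨_, s.setReg 0 (s.reg 16), .seq hexec (.assign _ _ _), ?_, ?_⟩
  · have : (inputStore G idx d r₁ r₂).reg 0 = n := rfl
    rw [this] at ht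
    simp [Expr.cost]
    omega
  · rcases hsound with h0 | ⟨h1, Q, hQ1, hQ2, hQ3⟩
    · right
      refine ⟨?_, (Store.setReg_reg_self _ _ _).trans (h16.symm.trans h0)⟩
      rintro ⟨Q, hQ⟩
      obtain ⟨g, hg⟩ := exists_guess_passes (r := r) hidx hr hne hQ
      have h1 := hcomplete g (fun m hm hm' => absurd hm (by omega)) hg
      exact absurd (h0.symm.trans h1) (by decide)
    · left
      refine ⟨Q, hQ1, hQ2, (Store.setReg_reg_self _ _ _).trans (h16.symm.trans h1), fun i j => ?_⟩
      have hij : (s.setReg 0 (s.reg 16)).arr 1 (i * n + j) = indicator Q i j := by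
        rw [← hQ3 i j, hagree.1]
        rfl
      rw [hij, indicator]
      exact ⟨fun h => if_pos h, fun h => if_neg h⟩
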